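/- Let $K=\{(x,y,z)\in\mathbb R^3: 0<x,y,z,\ x+y+z<1\}$ be the reference tetrahedron with vertices $v_1=e_3$, $v_2=e_2$, $v_3=e_1$, $v_4=0$, let $\Gamma_i$ be its closed face opposite to $v_i$, let $\gamma_{ij}=\Gamma_i\cap\Gamma_j$ ($i\ne j$) be the edge shared by $\Gamma_i$ and $\Gamma_j$, and let $T=\{(x_1,x_2)\in\mathbb R^2: 0<x_1,x_2,\ x_1+x_2<1\}$. Let $0\le s<1$ and $1<p<\infty$. For $S=\partial K$ or $S=\Gamma_i$, the space $W^{s,p}(S)$ consists of the real-valued $f\in L^p(S)$ (with respect to surface measure) for which $$\|f\|_{s,p,S}^p:=\int_S|f|^p\,dx+\begin{cases}\displaystyle\iint_{S\times S}\frac{|f(x)-f(y)|^p}{|x-y|^{sp+2}}\,dx\,dy&\text{if }s>0,\\ 0&\text{if }s=0,\end{cases}$$ is finite. For $i\neq j$ let $a,b$ be the endpoints of $\gamma_{ij}=\gamma_{ji}$ (in an order fixed for the pair), let $F_{ij}:T\to\Gamma_i$ be the affine map with $F_{ij}(0,0)=a$, $F_{ij}(1,0)=b$ and $F_{ij}(0,1)$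 the remaining vertex of $\Gamma_i$, and set $$\mathcal I_{ij}^p(f,g):=\int_T |f(F_{ij}(x))-g(F_{ji}(x))|^p\,\frac{dx}{x_2}.$$ Write $f_i=f|_{\Gamma_i}$. When $sp>1$, $f_i|_{\gamma_{ij}}$ denotes the trace of $f_i\in W^{s,p}(\Gamma_i)$, i.e. the image of $f_i$ under the continuous extension to a map $W^{s,p}(\Gamma_i)\to L^p(\gamma_{ij})$ of the restriction $\varphi\mapsto\varphi|_{\gamma_{ij}}$, $\varphi\in W^{s,p}(\Gamma_i)\cap C(\Gamma_i)$. Then $f\in L^p(\partial K)$ satisfies $f\in W^{s,p}(\partial K)$ if and only if (i) $f_i\in W^{s,p}(\Gamma_i)$ for $1\le i\le 4$; (ii) if $s>1/p$, then $f_i|_{\gamma_{ij}}=f_j|_{\gamma_{ij}}$ a.e. on $\gamma_{ij}$ for all $1\le i<j\le4$; and (iii) if $s=1/p$, then $\mathcal I_{ij}^p(f_i,f_j)<\infty$ for all $1\le i<j\le 4$. Moreover, there is a constant $C>0$, depending only on $s$ and $p$, such that for all $f\in W^{s,p}(\partial K)$ $$C^{-1}\,|||f|||_{s,p,\partial K}\le\|f\|_{s,p,\partial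 K}\le C\,|||f|||_{s,p,\partial K},$$ where $$|||f|||_{s,p,\partial K}^p:=\sum_{i=1}^4\|f_i\|_{s,p,\Gamma_i}^p+\begin{cases}\displaystyle\sum_{1\le i<j\le4}\mathcal I_{ij}^p(f_i,f_j)&\text{if }sp=1,\\ 0&\text{otherwise.}\end{cases}$$ -/

import Mathlib

open MeasureTheory Filter Topology
open scoped ENNReal NNReal

namespace TetBoundary

noncomputable section

/-- Three-dimensional Euclidean space. -/
abbrev E3 : Type := EuclideanSpace ℝ (Fin 3)

/-- Two-dimensional Euclidean space. -/
abbrev E2 : Type := EuclideanSpace ℝ (Fin 2)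

/-- The (open) reference tetrahedron `K`. -/
def refTet : Set E3 :=
  {x | 0 < x 0 ∧ 0 < x 1 ∧ 0 < x 2 ∧ x 0 + x 1 + x 2 < 1}

/-- The (open) reference triangle `T`. -/
def refTri : Set E2 :=
  {x | 0 < x 0 ∧ 0 < x 1 ∧ x 0 + x 1 < 1}

/-- The vertices of `K`, in the order `e₃, e₂, e₁, 0`. -/
def vertex : Fin 4 → E3 :=
  ![EuclideanSpace.single 2 1, EuclideanSpace.single 1 1, EuclideanSpace.single 0 1, 0]

/-- The (closed) face `Γ_i`, opposite to the `i`-th vertex. -/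
def face (i : Fin 4) : Set E3 := convexHull ℝ (vertex '' {k | k ≠ i})

/-- For `i ≠ j`, the smallest index different from `i` and `j`. -/
def edgeStart (i j : Fin 4) : Fin 4 :=
  if 0 ≠ i ∧ 0 ≠ j then 0 else if 1 ≠ i ∧ 1 ≠ j then 1 else 2

/-- For `i ≠ j`, the largest index different from `i` and `j`. -/
def edgeEnd (i j : Fin 4) : Fin 4 :=
  if 3 ≠ i ∧ 3 ≠ j then 3 else if 2 ≠ i ∧ 2 ≠ j then 2 else 1

/-- For `i ≠ j`, the four indices `i`, `j`, `edgeStart i j`, `edgeEnd i j` are distinct, so that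
the two last ones are exactly the indices of the two vertices common to `Γ_i` and `Γ_j`. -/
theorem edge_indices (i j : Fin 4) (h : i ≠ j) :
    edgeStart i j ≠ i ∧ edgeStart i j ≠ j ∧ edgeEnd i j ≠ i ∧ edgeEnd i j ≠ j ∧
      edgeStart i j ≠ edgeEnd i j ∧
      edgeStart i j = edgeStart j i ∧ edgeEnd i j = edgeEnd j i := by
  revert i j
  decide

/-- The edge `γ_ij` shared by the faces `Γ_i` and `Γ_j` (`i ≠ j`). -/
def edge (i j : Fin 4) : Set E3 :=
  segment ℝ (vertex (edgeStart i j)) (vertex (edgeEnd i j))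

/-- The affine map `F_ij` from the reference triangle onto `Γ_i` (`i ≠ j`): with `a`, `b` the
endpoints of `γ_ij` and `c` the remaining vertex of `Γ_i` (which is the `j`-th vertex of `K`), it
maps `(0,0)` to `a`, `(1,0)` to `b` and `(0,1)` to `c`. -/
def faceMap (i j : Fin 4) (x : E2) : E3 :=
  vertex (edgeStart i j) + x 0 • (vertex (edgeEnd i j) - vertex (edgeStart i j))
    + x 1 • (vertex j - vertex (edgeStart i j))

/-- Surface measure on `S`: the two-dimensional Hausdorff measure in the normalization that agrees
with area on planes. -/
def surf (S : Set E3) : Measure E3 := (μHE[2] : Measure E3).restrict S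

/-- Arc length measure on `γ`. -/
def arc (γ : Set E3) : Measure E3 := (μHE[1] : Measure E3).restrict γ

/-- The `p`-th power of the Slobodeckij seminorm of order `s` on the surface `S`. -/
def seminormPow (s p : ℝ) (S : Set E3) (f : E3 → ℝ) : ℝ≥0∞ :=
  ∫⁻ x, ∫⁻ y, ‖f x - f y‖ₑ ^ p / edist x y ^ (s * p + 2) ∂(surf S) ∂(surf S)

/-- The `p`-th power of the `W^{s,p}(S)`-norm, for `0 ≤ s < 1`. For `s = 0` this is the `p`-th
power of the `L^p`-norm. -/
def normPow (s p : ℝ) (S : Set E3) (f : E3 → ℝ) : ℝ≥0∞ :=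
  (∫⁻ x, ‖f x‖ₑ ^ p ∂(surf S)) + if 0 < s then seminormPow s p S f else 0

/-- The norm `‖f‖_{s,p,S}`, for `0 ≤ s < 1`. -/
def wNorm (s p : ℝ) (S : Set E3) (f : E3 → ℝ) : ℝ≥0∞ := normPow s p S f ^ (1 / p)

/-- Membership of (the restriction to `S` of) `f` in `L^p(S)`. -/
def MemLpOn (p : ℝ) (S : Set E3) (f : E3 → ℝ) : Prop := MemLp f (ENNReal.ofReal p) (surf S)

/-- Membership of (the restriction to `S` of) `f` in `W^{s,p}(S)`, for `0 ≤ s < 1`. -/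
def MemW (s p : ℝ) (S : Set E3) (f : E3 → ℝ) : Prop :=
  MemLpOn p S f ∧ wNorm s p S f < ∞

/-- `g` is the trace on the edge `γ ⊆ Γ_i` of the restriction of `f` to the face `Γ_i`: the trace
operator is the continuous extension, from `W^{s,p}(Γ_i)` to `L^p(γ)`, of the restriction map
`φ ↦ φ|_γ` on those members of `W^{s,p}(Γ_i)` that are continuous on the closed face. -/
def IsEdgeTrace (s p : ℝ) (i : Fin 4) (γ : Set E3) (f g : E3 → ℝ) : Prop :=
  MemLp g (ENNReal.ofReal p) (arc γ) ∧
  ∃ φ : ℕ → E3 → ℝ,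
    (∀ n, ContinuousOn (φ n) (face i) ∧ MemW s p (face i) (φ n)) ∧
    Tendsto (fun n => wNorm s p (face i) (φ n - f)) atTop (𝓝 0) ∧
    Tendsto (fun n => eLpNorm (φ n - g) (ENNReal.ofReal p) (arc γ)) atTop (𝓝 0)

/-- The traces on `γ_ij` of `f|_{Γ_i}` and `f|_{Γ_j}` exist and agree almost everywhere. -/
def TracesAgree (s p : ℝ) (i j : Fin 4) (f : E3 → ℝ) : Prop :=
  ∃ g h : E3 → ℝ, IsEdgeTrace s p i (edge i j) f g ∧ IsEdgeTrace s p j (edge i j) f h ∧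
    g =ᵐ[arc (edge i j)] h

/-- The edge integral `I_ij^p(f, g)`, for `f` on `Γ_i` and `g` on `Γ_j`. -/
def edgeIntegral (p : ℝ) (i j : Fin 4) (f g : E3 → ℝ) : ℝ≥0∞ :=
  ∫⁻ x in refTri, ‖f (faceMap i j x) - g (faceMap j i x)‖ₑ ^ p / ENNReal.ofReal (x 1)

/-- The face-wise norm on the boundary of `K`. -/
def faceNorm (s p : ℝ) (f : E3 → ℝ) : ℝ≥0∞ :=
  ((∑ i, wNorm s p (face i) f ^ p) +
    if s * p = 1 then ∑ i, ∑ j ∈ Finset.Ioi i, edgeIntegral p i j f f else 0) ^ (1 / p)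

end

end TetBoundary

/-! Any two distinct faces of a tetrahedron share an edge, so the double integral over the boundary
splits into the four face seminorms and the interactions of pairs of faces meeting along an edge.
With q = sp, everything reduces to two functions f, g on the reference triangle, thought of as two
sheets glued along the bottom edge, where the distance between u on one sheet and v on the other is
comparable to `foldDist u v`.

The interaction `crossPow` of the two sheets is equivalent, up to the Slobodeckij seminorms of f and
g, to the weighted jump `hardyPow q p (f - g)`, that is, the integral of |f - g|^p against the power
-q of the distance to the edge. One direction averages over a small box next to the edge
(`hardyPow_sub_le_crossPow`). The other compares f(u) with f(v) on one sheet and integrates the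
kernel in u, which leaves the power -q of the height of v (`crossPow_le`).

What remains is to decide when the jump is finite, and the three regimes come from Hardy's
inequality. For q < 1 the weighted integral of any function is bounded by its norm
(`exists_hardyPow_le`), so there is no condition. For q = 1 the jump is the edge integral itself.
For q > 1 a function minus its trace has finite weighted integral (`exists_hardyPow_sub_trace_le`),
whereas a nonzero function of the edge variable alone has infinite weighted integral
(`ae_eq_zero_of_hardyPow_lt_top`). Hence the jump is finite exactly when the traces agree, and is
then controlled by the seminorms.

Both Hardy inequalities compare h with h ∘ `halve`: halving the height multiplies the weighted
integral by a power of 2 whose exponent changes sign at q = 1, and the difference h - h ∘ `halve` is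
controlled by the seminorm for every q ≥ 0 (`hardyPow_sub_halve_le`). Traces are obtained from
density of continuous functions (`exists_continuous_approx`), proved by mollification towards an
inner ball, together with the trace inequality `exists_trace_le`. Affine parametrizations carry all
of this to the faces. -/

namespace TetBoundary

/-! ### Integral functionals on the reference triangle -/

/-- The open reference triangle in `ℝ × ℝ`. -/
def tri : Set (ℝ × ℝ) := {u | 0 < u.1 ∧ 0 < u.2 ∧ u.1 + u.2 < 1}

theorem isOpen_tri : IsOpen tri := by
  exact (isOpen_lt continuous_const continuous_fst).inter ((isOpen_lt continuous_const
    continuous_snd).inter (isOpen_lt (continuous_fst.add continuous_snd) continuous_const))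

theorem measurableSet_tri : MeasurableSet tri := isOpen_tri.measurableSet

/-- The `p`-th power of the `L^p`-norm on the triangle. -/
noncomputable def lpPow (p : ℝ) (h : ℝ × ℝ → ℝ) : ℝ≥0∞ := ∫⁻ u in tri, ‖h u‖ₑ ^ p

/-- The `p`-th power of the Slobodeckij seminorm of order `q / p` on the triangle. -/
noncomputable def slobPow (q p : ℝ) (h : ℝ × ℝ → ℝ) : ℝ≥0∞ :=
  ∫⁻ u in tri, ∫⁻ v in tri, ‖h u - h v‖ₑ ^ p / edist u v ^ (q + 2)

/-- The integral of `|h|^p` against a power of the inverse distance to the bottom edge. -/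
noncomputable def hardyPow (q p : ℝ) (h : ℝ × ℝ → ℝ) : ℝ≥0∞ :=
  ∫⁻ u in tri, ‖h u‖ₑ ^ p / ENNReal.ofReal u.2 ^ q

/-- A distance between points of two triangles glued along the bottom edge. -/
noncomputable def foldDist (u v : ℝ × ℝ) : ℝ := max (max |u.1 - v.1| u.2) v.2

/-- The interaction of functions on two triangles glued along the bottom edge. -/
noncomputable def crossPow (q p : ℝ) (f g : ℝ × ℝ → ℝ) : ℝ≥0∞ :=
  ∫⁻ u in tri, ∫⁻ v in tri, ‖f u - g v‖ₑ ^ p / ENNReal.ofReal (foldDist u v) ^ (q + 2)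

theorem enorm_sub_rpow_le {p : ℝ} (hp : 1 ≤ p) (a b c : ℝ) :
    ‖a - c‖ₑ ^ p ≤ 2 ^ (p - 1) * (‖a - b‖ₑ ^ p + ‖b - c‖ₑ ^ p) := by
  refine le_trans ?_ (ENNReal.rpow_add_le_mul_rpow_add_rpow _ _ hp)
  refine ENNReal.rpow_le_rpow ?_ (by linarith)
  have : a - c = (a - b) + (b - c) := by ring
  rw [this]
  exact enorm_add_le _ _

theorem two_rpow_lt_top (r : ℝ) : (2 : ℝ≥0∞) ^ r < ∞ :=
  (ENNReal.rpow_ne_top_of_ne_zero (by simp) (by simp)).lt_top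

/-! ### Averaging over a box near the edge: the interaction controls the jump -/

/-- The measurable rectangle near the bottom edge used for averaging. -/
def nearBox (u : ℝ × ℝ) : Set (ℝ × ℝ) := Set.Ioo u.1 (u.1 + u.2 / 2) ×ˢ Set.Ioo 0 (u.2 / 2)

theorem nearBox_subset {u : ℝ × ℝ} (hu : u ∈ tri) : nearBox u ⊆ tri := by
  rintro v ⟨⟨h1, h2⟩, h3, h4⟩
  obtain ⟨a, b, c⟩ := hu
  exact ⟨by linarith, h3, by linarith⟩

theorem volume_nearBox (u : ℝ × ℝ) (hu : u ∈ tri) :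
    volume (nearBox u) = ENNReal.ofReal u.2 ^ (2 : ℝ) / 4 := by
  obtain ⟨a, b, c⟩ := hu
  rw [nearBox, Measure.volume_eq_prod, Measure.prod_prod, Real.volume_Ioo, Real.volume_Ioo,
    ← ENNReal.ofReal_mul (by linarith), ENNReal.ofReal_rpow_of_pos b,
    show (4 : ℝ≥0∞) = ENNReal.ofReal 4 by simp, ← ENNReal.ofReal_div_of_pos (by norm_num)]
  congr 1
  rw [Real.rpow_two]; ring

/-- The box has area `u.2 ^ 2 / 4`, so integrating a constant lower bound over it trades two powers
of the height for the factor 4. This turns kernels of order q + 2 into Hardy weights of order q. -/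
theorem div_rpow_le_of_nearBox {q : ℝ} {u : ℝ × ℝ} (hu : u ∈ tri) {a : ℝ≥0∞}
    {k : ℝ × ℝ → ℝ≥0∞} (h : ∀ v ∈ nearBox u, a / ENNReal.ofReal u.2 ^ (q + 2) ≤ k v) :
    a / ENNReal.ofReal u.2 ^ q ≤ 4 * ∫⁻ v in tri, k v := by
  have hy : ENNReal.ofReal u.2 ≠ 0 := by simpa using hu.2.1
  have hy' : ENNReal.ofReal u.2 ≠ ∞ := by simp
  have h1 : a / ENNReal.ofReal u.2 ^ (q + 2) * volume (nearBox u) ≤ ∫⁻ v in tri, k v := by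
    rw [← setLIntegral_const]
    refine (setLIntegral_mono_ae' (measurableSet_Ioo.prod measurableSet_Ioo)
      (Eventually.of_forall h)).trans ?_
    exact lintegral_mono_set (nearBox_subset hu)
  refine le_trans (le_of_eq ?_) (mul_le_mul_right h1 4)
  rw [volume_nearBox u hu, ENNReal.rpow_add _ _ hy hy']
  set y := ENNReal.ofReal u.2
  have h2 : y ^ (2 : ℝ) ≠ 0 := by simp [hy]
  have h2' : y ^ (2 : ℝ) ≠ ∞ := by simp [hy']
  have h3 : y ^ q ≠ 0 := by simp [hy, hy']
  have h3' : y ^ q ≠ ∞ := by simp [hy, hy']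
  rw [div_eq_mul_inv, div_eq_mul_inv, div_eq_mul_inv, ENNReal.mul_inv (Or.inl h3) (Or.inl h3')]
  calc a * (y ^ q)⁻¹ = a * (y ^ q)⁻¹ * (((y ^ (2:ℝ))⁻¹ * y ^ (2 : ℝ)) * (4 * (4:ℝ≥0∞)⁻¹)) := by
        rw [ENNReal.inv_mul_cancel h2 h2', ENNReal.mul_inv_cancel (by simp) (by simp)]; simp
    _ = _ := by ring

theorem edist_le_of_mem_nearBox {u v : ℝ × ℝ} (hu : u ∈ tri) (hv : v ∈ nearBox u) :
    edist v u ≤ ENNReal.ofReal u.2 := by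
  obtain ⟨⟨h1, h2⟩, h3, h4⟩ := hv
  have := hu.2.1
  rw [edist_dist, Prod.dist_eq, Real.dist_eq, Real.dist_eq]
  apply ENNReal.ofReal_le_ofReal
  refine max_le (abs_le.2 ⟨by linarith, by linarith⟩) (abs_le.2 ⟨by linarith, by linarith⟩)

theorem div_rpow_le_div_rpow {a x y : ℝ≥0∞} {r : ℝ} (hr : 0 ≤ r) (h : x ≤ y) :
    a / y ^ r ≤ a / x ^ r :=
  ENNReal.div_le_div_left (ENNReal.rpow_le_rpow h hr) _

@[fun_prop]
theorem measurable_foldDist : Measurable fun z : (ℝ × ℝ) × (ℝ × ℝ) => foldDist z.1 z.2 := by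
  unfold foldDist; fun_prop

theorem measurable_slob {f g : ℝ × ℝ → ℝ} (hf : Measurable f) (hg : Measurable g) (r p : ℝ) :
    Measurable fun z : (ℝ × ℝ) × (ℝ × ℝ) => ‖f z.1 - g z.2‖ₑ ^ p / edist z.1 z.2 ^ r := by
  have : Measurable fun z : (ℝ × ℝ) × (ℝ × ℝ) => edist z.1 z.2 := measurable_edist
  fun_prop

theorem measurable_cross {f g : ℝ × ℝ → ℝ} (hf : Measurable f) (hg : Measurable g) (r p : ℝ) :
    Measurable fun z : (ℝ × ℝ) × (ℝ × ℝ) =>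
      ‖f z.1 - g z.2‖ₑ ^ p / ENNReal.ofReal (foldDist z.1 z.2) ^ r := by
  fun_prop

theorem slobPow_swap {q p : ℝ} {h : ℝ × ℝ → ℝ} :
    slobPow q p h = ∫⁻ u in tri, ∫⁻ v in tri, ‖h v - h u‖ₑ ^ p / edist v u ^ (q + 2) := by
  unfold slobPow
  congr! 5 with u v
  · rw [enorm_sub_rev]
  · rw [edist_comm]

/-- Split f(u) - g(u) through g(v) with v in `nearBox u`. There both the folded distance and the
distance of v to u are at most the height of u, so averaging over v gives the two kernels. -/
theorem hardyPow_sub_le_crossPow {q p : ℝ} (hq : 0 ≤ q) (hp : 1 ≤ p) {f g : ℝ × ℝ → ℝ}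
    (hf : Measurable f) (hg : Measurable g) :
    hardyPow q p (f - g) ≤ 4 * 2 ^ (p - 1) * (crossPow q p f g + slobPow q p g) := by
  rw [slobPow_swap]
  unfold hardyPow crossPow
  have hm := measurable_cross hf hg (q + 2) p
  have key : ∀ u ∈ tri, ‖(f - g) u‖ₑ ^ p / ENNReal.ofReal u.2 ^ q ≤
      4 * 2 ^ (p - 1) * ((∫⁻ v in tri, ‖f u - g v‖ₑ ^ p / ENNReal.ofReal (foldDist u v) ^ (q + 2)) +
        ∫⁻ v in tri, ‖g v - g u‖ₑ ^ p / edist v u ^ (q + 2)) := by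
    intro u hu
    refine (div_rpow_le_of_nearBox hu (k := fun v => 2 ^ (p - 1) *
      (‖f u - g v‖ₑ ^ p / ENNReal.ofReal (foldDist u v) ^ (q + 2)
        + ‖g v - g u‖ₑ ^ p / edist v u ^ (q + 2))) ?_).trans ?_
    · intro v hv
      refine (ENNReal.div_le_div_right (enorm_sub_rpow_le hp (f u) (g v) (g u)) _).trans ?_
      rw [mul_div_assoc, ENNReal.add_div]
      gcongr
      · obtain ⟨⟨h1, h2⟩, h3, h4⟩ := hv
        have := hu.2.1
        exact max_le (max_le (abs_le.2 ⟨by linarith, by linarith⟩) le_rfl) (by linarith)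
      · exact edist_le_of_mem_nearBox hu hv
    · rw [lintegral_const_mul' _ _ (two_rpow_lt_top _).ne, lintegral_add_left, mul_assoc]
      exact hm.comp measurable_prodMk_left
  refine (setLIntegral_mono_ae' measurableSet_tri (Eventually.of_forall key)).trans ?_
  rw [lintegral_const_mul' _ _ (ENNReal.mul_ne_top (by simp) (two_rpow_lt_top _).ne),
    lintegral_add_left]
  exact hm.lintegral_prod_right'

/-! ### Comparison of a function with its vertical contraction -/

/-- The vertical contraction by `1 / 2`. -/
noncomputable def halve (u : ℝ × ℝ) : ℝ × ℝ := (u.1, u.2 / 2)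

@[fun_prop]
theorem measurable_halve : Measurable halve := by unfold halve; fun_prop

theorem halve_mem_tri {u : ℝ × ℝ} (hu : u ∈ tri) : halve u ∈ tri := by
  obtain ⟨a, b, c⟩ := hu
  exact ⟨a, by simpa [halve] using b, by simp only [halve]; linarith⟩

theorem lintegral_comp_halve (k : ℝ × ℝ → ℝ≥0∞) (hk : Measurable k) :
    ∫⁻ u, k (halve u) = 2 * ∫⁻ u, k u := by
  have h : Measure.map halve (volume : Measure (ℝ × ℝ)) = (2 : ℝ≥0∞) • volume := by
    have : halve = Prod.map id (fun x : ℝ => x * (1 / 2)) := by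
      ext u <;> simp [halve, div_eq_mul_inv]
    rw [this, Measure.volume_eq_prod, ← Measure.map_prod_map _ _ measurable_id (by fun_prop),
      Measure.map_id, Real.map_volume_mul_right (by norm_num), Measure.prod_smul_right]
    norm_num
  rw [← lintegral_map hk measurable_halve, h, lintegral_smul_measure, smul_eq_mul]

theorem setLIntegral_comp_halve_le {k : ℝ × ℝ → ℝ≥0∞} (hk : Measurable k) {s t : Set (ℝ × ℝ)}
    (hs : MeasurableSet s) (ht : MeasurableSet t) (hst : ∀ u ∈ s, halve u ∈ t) :
    ∫⁻ u in s, k (halve u) ≤ 2 * ∫⁻ u in t, k u := by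
  rw [← lintegral_indicator hs, ← lintegral_indicator ht, ← lintegral_comp_halve _ (hk.indicator ht)]
  refine lintegral_mono fun u => ?_
  by_cases hu : u ∈ s
  · simp [hu, hst u hu]
  · simp [hu]

/-- Both u and `halve u` are within `u.2` of every point of `nearBox u`, so the difference can be
averaged through the box. The constant is 12 = 4 · (1 + 2): 4 from the area of the box, 1 from the
term at u, and 2 from the change of variables in the term at `halve u`. -/
theorem hardyPow_sub_halve_le {q p : ℝ} (hq : 0 ≤ q) (hp : 1 ≤ p) {h : ℝ × ℝ → ℝ}
    (hh : Measurable h) :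
    hardyPow q p (h - h ∘ halve) ≤ 12 * 2 ^ (p - 1) * slobPow q p h := by
  have hm := measurable_slob hh hh (q + 2) p
  set H : ℝ × ℝ → ℝ≥0∞ := fun u => ∫⁻ v in tri, ‖h u - h v‖ₑ ^ p / edist u v ^ (q + 2) with hH
  have hHm : Measurable H := hm.lintegral_prod_right'
  have key : ∀ u ∈ tri, ‖(h - h ∘ halve) u‖ₑ ^ p / ENNReal.ofReal u.2 ^ q ≤
      4 * 2 ^ (p - 1) * (H u + H (halve u)) := by
    intro u hu
    refine (div_rpow_le_of_nearBox hu (k := fun v => 2 ^ (p - 1) *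
      (‖h u - h v‖ₑ ^ p / edist u v ^ (q + 2)
        + ‖h (halve u) - h v‖ₑ ^ p / edist (halve u) v ^ (q + 2))) ?_).trans ?_
    · intro v hv
      refine (ENNReal.div_le_div_right (enorm_sub_rpow_le hp (h u) (h v) (h (halve u))) _).trans ?_
      rw [mul_div_assoc, ENNReal.add_div, enorm_sub_rev (h v)]
      gcongr
      · rw [edist_comm]; exact edist_le_of_mem_nearBox hu hv
      · obtain ⟨⟨h1, h2⟩, h3, h4⟩ := hv
        have := hu.2.1
        rw [edist_dist, Prod.dist_eq, Real.dist_eq, Real.dist_eq]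
        apply ENNReal.ofReal_le_ofReal
        simp only [halve]
        refine max_le (abs_le.2 ⟨by linarith, by linarith⟩) (abs_le.2 ⟨by linarith, by linarith⟩)
    · rw [lintegral_const_mul' _ _ (two_rpow_lt_top _).ne, lintegral_add_left, mul_assoc]
      exact hm.comp measurable_prodMk_left
  refine (setLIntegral_mono_ae' measurableSet_tri (Eventually.of_forall key)).trans ?_
  rw [lintegral_const_mul' _ _ (ENNReal.mul_ne_top (by simp) (two_rpow_lt_top _).ne),
    lintegral_add_left hHm]
  have h2 := setLIntegral_comp_halve_le hHm measurableSet_tri measurableSet_tri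
    fun u hu => halve_mem_tri hu
  have h3 : slobPow q p h = ∫⁻ u in tri, H u := rfl
  rw [h3]
  calc 4 * 2 ^ (p - 1) * ((∫⁻ u in tri, H u) + ∫⁻ u in tri, H (halve u))
      ≤ 4 * 2 ^ (p - 1) * ((∫⁻ u in tri, H u) + 2 * ∫⁻ u in tri, H u) := by gcongr
    _ = _ := by ring

/-! ### The jump controls the interaction -/

/-- The folded distance is at least half of `v.2 + ‖u - v‖`. Rescaling by `v.2` leaves the integral
of (1 + ‖w‖)^(-(q + 2)) over the plane, which converges because q > 0. -/
theorem lintegral_kernel_le {q : ℝ} (hq : 0 < q) :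
    ∃ C : ℝ≥0∞, C < ∞ ∧ ∀ v ∈ tri,
      ∫⁻ u in tri, (ENNReal.ofReal (foldDist u v) ^ (q + 2))⁻¹ ≤ C / ENNReal.ofReal v.2 ^ q := by
  have hfin : ((Module.finrank ℝ (ℝ × ℝ) : ℕ) : ℝ) < q + 2 := by simpa using by linarith
  set D := ∫⁻ x : ℝ × ℝ, ENNReal.ofReal ((1 + ‖x‖) ^ (-(q + 2))) with hD
  have hDfin : D < ∞ := finite_integral_one_add_norm hfin
  refine ⟨ENNReal.ofReal (2 ^ (q + 2)) * D, ENNReal.mul_lt_top (by simp) hDfin, fun v hv => ?_⟩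
  have hy : 0 < v.2 := hv.2.1
  have key : ∀ u ∈ tri, (ENNReal.ofReal (foldDist u v) ^ (q + 2))⁻¹ ≤
      ENNReal.ofReal ((v.2 / 2) ^ (-(q + 2))) *
        ENNReal.ofReal ((1 + ‖v.2⁻¹ • (u + -v)‖) ^ (-(q + 2))) := by
    intro u hu
    have h0 : 0 < foldDist u v := hy.trans_le (le_max_right _ _)
    rw [← ENNReal.rpow_neg, ENNReal.ofReal_rpow_of_pos h0, ← ENNReal.ofReal_mul (by positivity),
      ← Real.mul_rpow (by positivity) (by positivity)]
    apply ENNReal.ofReal_le_ofReal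
    refine Real.rpow_le_rpow_of_nonpos (by positivity) ?_ (by linarith)
    have h1 : v.2 ≤ foldDist u v := le_max_right _ _
    have h2 : ‖u + -v‖ ≤ foldDist u v := by
      rw [← sub_eq_add_neg, Prod.norm_def]
      have := hu.2.1
      refine max_le ((le_max_left _ _).trans (le_max_left _ _)) ?_
      refine abs_le.2 ⟨?_, ?_⟩
      · simp only [Prod.snd_sub]; linarith
      · have : u.2 ≤ foldDist u v := (le_max_right _ _).trans (le_max_left _ _)
        simp only [Prod.snd_sub]; linarith
    rw [norm_smul, norm_inv, Real.norm_of_nonneg hy.le]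
    calc v.2 / 2 * (1 + v.2⁻¹ * ‖u + -v‖) = (v.2 + ‖u + -v‖) / 2 := by field_simp
      _ ≤ foldDist u v := by linarith
  calc ∫⁻ u in tri, (ENNReal.ofReal (foldDist u v) ^ (q + 2))⁻¹
      ≤ ∫⁻ u in tri, ENNReal.ofReal ((v.2 / 2) ^ (-(q + 2))) *
        ENNReal.ofReal ((1 + ‖v.2⁻¹ • (u + -v)‖) ^ (-(q + 2))) :=
        setLIntegral_mono_ae' measurableSet_tri (Eventually.of_forall key)
    _ ≤ ∫⁻ u, ENNReal.ofReal ((v.2 / 2) ^ (-(q + 2))) *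
        ENNReal.ofReal ((1 + ‖v.2⁻¹ • (u + -v)‖) ^ (-(q + 2))) := setLIntegral_le_lintegral _ _
    _ = ENNReal.ofReal ((v.2 / 2) ^ (-(q + 2))) * (ENNReal.ofReal (v.2 ^ 2) * D) := by
        rw [lintegral_const_mul' _ _ (by simp), lintegral_add_right_eq_self
          (fun w : ℝ × ℝ => ENNReal.ofReal ((1 + ‖v.2⁻¹ • w‖) ^ (-(q + 2)))) (-v),
          ← lintegral_map (f := fun w : ℝ × ℝ => ENNReal.ofReal ((1 + ‖w‖) ^ (-(q + 2))))
            (g := fun w : ℝ × ℝ => v.2⁻¹ • w) (by fun_prop) (by fun_prop),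
          Measure.map_addHaar_smul _ (by positivity), lintegral_smul_measure]
        congr 3
        simp [abs_of_pos hy]
    _ = _ := by
        rw [← mul_assoc, ← ENNReal.ofReal_mul (by positivity), ENNReal.ofReal_rpow_of_pos hy,
          mul_comm _ D, mul_comm _ D, mul_div_assoc, ← ENNReal.ofReal_div_of_pos (by positivity)]
        congr 2
        rw [Real.div_rpow hy.le (by norm_num), Real.rpow_neg hy.le, Real.rpow_neg (by norm_num),
          Real.rpow_add hy, Real.rpow_two]
        field_simp

/-- Split f(u) - g(v) through f(v). Folding only increases distances, so the first part is dominated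
by the seminorm of f. In the second part the numerator depends on v alone, and `lintegral_kernel_le`
integrates out u. -/
theorem crossPow_le {q p : ℝ} (hq : 0 < q) (hp : 1 ≤ p) :
    ∃ C : ℝ≥0∞, C < ∞ ∧ ∀ f g : ℝ × ℝ → ℝ, Measurable f → Measurable g →
      crossPow q p f g ≤ C * (slobPow q p f + hardyPow q p (f - g)) := by
  obtain ⟨C, hC, hk⟩ := lintegral_kernel_le hq
  refine ⟨2 ^ (p - 1) * (1 + C), ENNReal.mul_lt_top (two_rpow_lt_top _) (by simp [hC]),
    fun f g hf hg => ?_⟩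
  have hm := measurable_slob hf hf (q + 2) p
  have h1 : crossPow q p f g ≤ ∫⁻ u in tri, ∫⁻ v in tri, 2 ^ (p - 1) *
      (‖f u - f v‖ₑ ^ p / edist u v ^ (q + 2) +
        ‖f v - g v‖ₑ ^ p / ENNReal.ofReal (foldDist u v) ^ (q + 2)) := by
    refine setLIntegral_mono_ae' measurableSet_tri (Eventually.of_forall fun u hu =>
      setLIntegral_mono_ae' measurableSet_tri (Eventually.of_forall fun v hv => ?_))
    refine (ENNReal.div_le_div_right (enorm_sub_rpow_le hp (f u) (f v) (g v)) _).trans ?_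
    rw [mul_div_assoc, ENNReal.add_div]
    gcongr
    rw [edist_dist, Prod.dist_eq, Real.dist_eq, Real.dist_eq]
    apply ENNReal.ofReal_le_ofReal
    have := hu.2.1
    have := hv.2.1
    refine max_le ((le_max_left _ _).trans (le_max_left _ _)) ?_
    unfold foldDist
    rcases le_total u.2 v.2 with h | h
    · exact (abs_le.2 ⟨by linarith, by linarith⟩).trans (le_max_right _ _)
    · exact (abs_le.2 ⟨by linarith, by linarith⟩ : |u.2 - v.2| ≤ u.2).trans
        ((le_max_right _ _).trans (le_max_left _ _))
  refine h1.trans ?_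
  have hmk : Measurable fun z : (ℝ × ℝ) × (ℝ × ℝ) =>
      ‖f z.2 - g z.2‖ₑ ^ p / ENNReal.ofReal (foldDist z.1 z.2) ^ (q + 2) := by fun_prop
  have h2 : ∫⁻ u in tri, ∫⁻ v in tri, ‖f v - g v‖ₑ ^ p / ENNReal.ofReal (foldDist u v) ^ (q + 2)
      ≤ C * hardyPow q p (f - g) := by
    rw [lintegral_lintegral_swap hmk.aemeasurable, hardyPow, ← lintegral_const_mul' _ _ hC.ne]
    refine setLIntegral_mono_ae' measurableSet_tri (Eventually.of_forall fun v hv => ?_)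
    simp_rw [div_eq_mul_inv]
    rw [lintegral_const_mul _ (by fun_prop)]
    refine (mul_le_mul_right (hk v hv) _).trans (le_of_eq ?_)
    rw [Pi.sub_apply, div_eq_mul_inv]; ring
  have h3 : ∀ u, ∫⁻ v in tri, 2 ^ (p - 1) *
      (‖f u - f v‖ₑ ^ p / edist u v ^ (q + 2) +
        ‖f v - g v‖ₑ ^ p / ENNReal.ofReal (foldDist u v) ^ (q + 2)) = 2 ^ (p - 1) *
      ((∫⁻ v in tri, ‖f u - f v‖ₑ ^ p / edist u v ^ (q + 2)) +
        ∫⁻ v in tri, ‖f v - g v‖ₑ ^ p / ENNReal.ofReal (foldDist u v) ^ (q + 2)) := by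
    intro u
    rw [lintegral_const_mul' _ _ (two_rpow_lt_top _).ne, lintegral_add_left]
    exact hm.comp measurable_prodMk_left
  simp_rw [h3]
  rw [lintegral_const_mul' _ _ (two_rpow_lt_top _).ne, lintegral_add_left hm.lintegral_prod_right',
    mul_assoc]
  gcongr
  calc _ ≤ slobPow q p f + C * hardyPow q p (f - g) := by gcongr; exact le_rfl
    _ ≤ (1 + C) * slobPow q p f + (1 + C) * hardyPow q p (f - g) := by
        gcongr
        · exact le_mul_of_one_le_left' (by simp)
        · simp
    _ = _ := by ring

theorem div_rpow_le_const_mul {a x y c : ℝ≥0∞} {r : ℝ} (hr : 0 ≤ r) (hc : c ≠ 0) (hc' : c ≠ ∞)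
    (h : y ≤ c * x) : a / x ^ r ≤ c ^ r * (a / y ^ r) := by
  have h1 : c ^ r ≠ 0 := by simp [hc, hc']
  have h2 : c ^ r ≠ ∞ := by simp [hc, hc']
  calc a / x ^ r = c ^ r * (a / (c * x) ^ r) := by
        rw [ENNReal.mul_rpow_of_nonneg _ _ hr, ← mul_div_assoc, ENNReal.mul_div_mul_left _ _ h1 h2]
    _ ≤ c ^ r * (a / y ^ r) := by gcongr

/-! ### Reflection, carrying estimates from the left half of the edge to the right half -/

/-- The affine symmetry of the triangle exchanging the endpoints of the bottom edge. -/
def mirror (u : ℝ × ℝ) : ℝ × ℝ := (1 - u.1 - u.2, u.2)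

theorem continuous_mirror : Continuous mirror := by unfold mirror; fun_prop

@[fun_prop]
theorem measurable_mirror : Measurable mirror := continuous_mirror.measurable

theorem mirror_mirror (u : ℝ × ℝ) : mirror (mirror u) = u := by
  ext
  · simp only [mirror]; ring
  · rfl

theorem mirror_mem_tri {u : ℝ × ℝ} (hu : u ∈ tri) : mirror u ∈ tri := by
  obtain ⟨a, b, c⟩ := hu
  refine ⟨?_, b, ?_⟩ <;> simp only [mirror] <;> linarith

theorem edist_mirror_le (u v : ℝ × ℝ) : edist (mirror u) (mirror v) ≤ 2 * edist u v := by
  rw [edist_dist, edist_dist, show (2 : ℝ≥0∞) = ENNReal.ofReal 2 by simp,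
    ← ENNReal.ofReal_mul (by norm_num)]
  apply ENNReal.ofReal_le_ofReal
  simp only [Prod.dist_eq, Real.dist_eq, mirror]
  have h1 := le_max_left |u.1 - v.1| |u.2 - v.2|
  have h2 := le_max_right |u.1 - v.1| |u.2 - v.2|
  refine max_le ?_ (by linarith [abs_nonneg (u.2 - v.2)])
  rw [show 1 - u.1 - u.2 - (1 - v.1 - v.2) = -(u.1 - v.1) - (u.2 - v.2) by ring]
  refine (abs_sub _ _).trans ?_
  rw [abs_neg]; linarith

theorem lintegral_comp_mirror {k : ℝ × ℝ → ℝ≥0∞} (hk : Measurable k) :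
    ∫⁻ u, k (mirror u) = ∫⁻ u, k u := by
  rw [Measure.volume_eq_prod, lintegral_prod_symm' (fun u => k (mirror u))
    (hk.comp measurable_mirror), lintegral_prod_symm' _ hk]
  refine lintegral_congr fun y => ?_
  rw [← lintegral_sub_left_eq_self (fun x => k (x, y)) (1 - y)]
  refine lintegral_congr fun x => ?_
  simp only [mirror]; congr 2; ring

theorem setLIntegral_comp_mirror_le {k : ℝ × ℝ → ℝ≥0∞} (hk : Measurable k) {s t : Set (ℝ × ℝ)}
    (hs : MeasurableSet s) (ht : MeasurableSet t) (hst : ∀ u ∈ s, mirror u ∈ t) :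
    ∫⁻ u in s, k (mirror u) ≤ ∫⁻ u in t, k u := by
  rw [← lintegral_indicator hs, ← lintegral_indicator ht, ← lintegral_comp_mirror (hk.indicator ht)]
  refine lintegral_mono fun u => ?_
  by_cases hu : u ∈ s
  · simp [hu, hst u hu]
  · simp [hu]

theorem lpPow_comp_mirror_le {p : ℝ} {h : ℝ × ℝ → ℝ} (hh : Measurable h) :
    lpPow p (h ∘ mirror) ≤ lpPow p h :=
  setLIntegral_comp_mirror_le (k := fun u => ‖h u‖ₑ ^ p) (by fun_prop) measurableSet_tri
    measurableSet_tri fun _ => mirror_mem_tri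

theorem slobPow_comp_mirror_le {q p : ℝ} (hq : 0 ≤ q) {h : ℝ × ℝ → ℝ} (hh : Measurable h) :
    slobPow q p (h ∘ mirror) ≤ 2 ^ (q + 2) * slobPow q p h := by
  have hm := measurable_slob hh hh (q + 2) p
  set H : ℝ × ℝ → ℝ≥0∞ := fun u => ∫⁻ v in tri, ‖h u - h v‖ₑ ^ p / edist u v ^ (q + 2) with hH
  have hHm : Measurable H := hm.lintegral_prod_right'
  have h0 : ∀ u v, ‖h (mirror u) - h (mirror v)‖ₑ ^ p / edist u v ^ (q + 2) ≤
      2 ^ (q + 2) * (‖h (mirror u) - h (mirror v)‖ₑ ^ p / edist (mirror u) (mirror v) ^ (q + 2)) :=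
    fun u v => div_rpow_le_const_mul (by linarith) (by simp) (by simp) (edist_mirror_le u v)
  have h2 : ∀ u, ∫⁻ v in tri, ‖h (mirror u) - h (mirror v)‖ₑ ^ p / edist (mirror u) (mirror v) ^ (q + 2) ≤
      H (mirror u) := by
    intro u
    have hmu : Measurable fun w => ‖h (mirror u) - h w‖ₑ ^ p / edist (mirror u) w ^ (q + 2) := by
      have : Measurable fun w => edist (mirror u) w := by fun_prop
      fun_prop
    exact setLIntegral_comp_mirror_le hmu measurableSet_tri measurableSet_tri
        fun _ => mirror_mem_tri
  have h1 : slobPow q p (h ∘ mirror) ≤ ∫⁻ u in tri, 2 ^ (q + 2) * H (mirror u) := by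
    refine lintegral_mono fun u => ?_
    refine (lintegral_mono (h0 u)).trans ?_
    rw [lintegral_const_mul' _ _ (two_rpow_lt_top _).ne]
    exact mul_le_mul_right (h2 u) _
  refine h1.trans ?_
  rw [lintegral_const_mul' _ _ (two_rpow_lt_top _).ne]
  exact mul_le_mul_right (setLIntegral_comp_mirror_le hHm measurableSet_tri
    measurableSet_tri fun _ => mirror_mem_tri) _

/-! ### Hardy's inequality in the subcritical range -/

/-- A square in the triangle adjacent to the bottom edge. -/
def cornerSq : Set (ℝ × ℝ) := Set.Ioo 0 (1 / 2) ×ˢ Set.Ioo 0 (1 / 2)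

theorem measurableSet_cornerSq : MeasurableSet cornerSq := measurableSet_Ioo.prod measurableSet_Ioo

theorem cornerSq_subset : cornerSq ⊆ tri := by
  rintro u ⟨⟨a, b⟩, c, d⟩
  exact ⟨a, c, by linarith⟩

/-- Convexity of the p-th power with weights 1 - t and t, where t^p = c, gives coefficient t^p ·
t^(1 - p) = t < 1 for b^p. Unlike the crude bound with 2^(p - 1), this keeps the scaling gain c < 1,
which is what makes absorption and iteration possible. -/
theorem exists_weighted_rpow_add_le {p c : ℝ} (hp : 1 < p) (hc : 0 < c) (hc1 : c < 1) :
    ∃ A θ : ℝ≥0∞, A < ∞ ∧ θ < 1 ∧ ∀ a b : ℝ≥0∞,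
      ENNReal.ofReal c * (a + b) ^ p ≤ A * a ^ p + θ * b ^ p := by
  have hp0 : 0 < p := by linarith
  set t : ℝ := c ^ (1 / p) with ht
  have ht0 : 0 < t := Real.rpow_pos_of_pos hc _
  have ht1 : t < 1 := Real.rpow_lt_one hc.le hc1 (by positivity)
  have htc : t ^ p = c := by rw [ht, ← Real.rpow_mul hc.le]; simp [hp0.ne']
  refine ⟨ENNReal.ofReal (c * (1 - t) ^ (1 - p)), ENNReal.ofReal t, by simp, by simpa using ht1,
    fun a b => ?_⟩
  have hw : ENNReal.ofReal (1 - t) + ENNReal.ofReal t = 1 := by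
    rw [← ENNReal.ofReal_add (by linarith) ht0.le]; simp
  have hcancel : ∀ (w : ℝ), 0 < w → ∀ x : ℝ≥0∞, ENNReal.ofReal w * (ENNReal.ofReal w⁻¹ * x) = x := by
    intro w h0 x
    rw [← mul_assoc, ← ENNReal.ofReal_mul h0.le, mul_inv_cancel₀ h0.ne']; simp
  have hpow : ∀ (w : ℝ), 0 < w → ∀ x : ℝ≥0∞, ENNReal.ofReal w * (ENNReal.ofReal w⁻¹ * x) ^ p
      = ENNReal.ofReal (w ^ (1 - p)) * x ^ p := by
    intro w h0 x
    rw [ENNReal.mul_rpow_of_nonneg _ _ hp0.le, ENNReal.ofReal_rpow_of_pos (by positivity),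
      ← mul_assoc, ← ENNReal.ofReal_mul h0.le, Real.inv_rpow h0.le, Real.rpow_sub h0, Real.rpow_one,
      div_eq_mul_inv]
  have := ENNReal.rpow_arith_mean_le_arith_mean2_rpow (ENNReal.ofReal (1 - t)) (ENNReal.ofReal t)
    (ENNReal.ofReal (1 - t)⁻¹ * a) (ENNReal.ofReal t⁻¹ * b) hw hp.le
  rw [hcancel _ (by linarith), hcancel _ ht0, hpow _ (by linarith), hpow _ ht0] at this
  refine (mul_le_mul_right this _).trans (le_of_eq ?_)
  rw [mul_add, ← mul_assoc, ← mul_assoc, ← ENNReal.ofReal_mul hc.le, ← ENNReal.ofReal_mul hc.le]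
  congr 3
  rw [← htc, ← Real.rpow_add ht0]; simp

/-- Absorption of θN into the left side, legitimate only for finite N; the Hardy integral is
therefore first cut off away from the edge. -/
theorem le_of_le_add_mul {N D θ : ℝ≥0∞} (hN : N < ∞) (hθ : θ < 1) (h : N ≤ D + θ * N) :
    N ≤ (1 - θ)⁻¹ * D := by
  have h1 : (1 - θ) ≠ 0 := (tsub_pos_of_lt hθ).ne'
  have h2 : (1 - θ) ≠ ∞ := ENNReal.sub_ne_top (by simp)
  have hθN : θ * N ≠ ∞ := ENNReal.mul_ne_top (hθ.trans (by simp)).ne hN.ne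
  have h3 : (1 - θ) * N ≤ D := by
    rw [ENNReal.sub_mul (fun _ _ => hN.ne), one_mul]
    exact tsub_le_iff_right.2 h
  rw [mul_comm, ← div_eq_mul_inv]
  rw [ENNReal.le_div_iff_mul_le (Or.inl h1) (Or.inl h2), mul_comm]
  exact h3

theorem ofReal_halve_rpow {q : ℝ} (hq : 0 ≤ q) (u : ℝ × ℝ) (a : ℝ≥0∞) :
    a / ENNReal.ofReal (halve u).2 ^ q = 2 ^ q * (a / ENNReal.ofReal u.2 ^ q) := by
  have h1 : (2 : ℝ≥0∞) ^ q ≠ 0 := by simp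
  have h2 : (2 : ℝ≥0∞) ^ q ≠ ∞ := (two_rpow_lt_top _).ne
  have h3 : ENNReal.ofReal u.2 = 2 * ENNReal.ofReal (halve u).2 := by
    rw [show (2 : ℝ≥0∞) = ENNReal.ofReal 2 by simp, ← ENNReal.ofReal_mul (by norm_num)]
    simp only [halve]; congr 1; ring
  rw [h3, ENNReal.mul_rpow_of_nonneg _ _ hq, ← mul_div_assoc, ENNReal.mul_div_mul_left _ _ h1 h2]

/-- Monotone convergence removes a cut-off at height ε once the bound is uniform in ε. -/
theorem setLIntegral_le_of_forall_pos {s : Set (ℝ × ℝ)}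
    (hpos : ∀ u ∈ s, 0 < u.2) {k : ℝ × ℝ → ℝ≥0∞} {B : ℝ≥0∞}
    (h : ∀ ε : ℝ, 0 < ε → ∫⁻ u in s ∩ {u | ε < u.2}, k u ≤ B) : ∫⁻ u in s, k u ≤ B := by
  have hU : s = ⋃ n : ℕ, s ∩ {u | 1 / ((n : ℝ) + 1) < u.2} := by
    ext u
    simp only [Set.mem_iUnion, Set.mem_inter_iff, Set.mem_ofPred_eq, exists_and_left]
    exact ⟨fun hu => ⟨hu, exists_nat_one_div_lt (hpos u hu)⟩, fun hu => hu.1⟩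
  rw [hU, setLIntegral_iUnion_of_directed]
  · exact iSup_le fun n => h _ (by positivity)
  · refine (monotone_nat_of_le_succ fun n u hu => ⟨hu.1, ?_⟩).directed_le
    have h2 : 1 / ((n : ℝ) + 1) < u.2 := hu.2
    exact lt_of_le_of_lt (Nat.one_div_le_one_div n.le_succ) h2

/-- Hardy's inequality on the corner square, away from the edge, in the subcritical range. -/
theorem exists_cornerSq_hardy_le {q p : ℝ} (hq : 0 < q) (hq1 : q < 1) (hp : 1 < p) :
    ∃ C : ℝ≥0∞, C < ∞ ∧ ∀ h : ℝ × ℝ → ℝ, Measurable h →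
      ∫⁻ u in cornerSq, ‖h u‖ₑ ^ p / ENNReal.ofReal u.2 ^ q ≤ C * (lpPow p h + slobPow q p h) := by
  have hc1 : (2 : ℝ) ^ (q - 1) < 1 := Real.rpow_lt_one_of_one_lt_of_neg (by norm_num) (by linarith)
  obtain ⟨A, θ, hA, hθ, hw⟩ := exists_weighted_rpow_add_le hp
    (Real.rpow_pos_of_pos two_pos (q - 1)) hc1
  -- Passing to half the height costs 1/2 in area and gains 2^q in the weight; the product is below
  -- 1 because q < 1.
  have hc : ENNReal.ofReal ((2 : ℝ) ^ (q - 1)) = 2⁻¹ * 2 ^ q := by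
    rw [Real.rpow_sub two_pos, Real.rpow_one, mul_comm, ← div_eq_mul_inv,
      ENNReal.ofReal_div_of_pos two_pos, ← ENNReal.ofReal_rpow_of_pos two_pos]; simp
  set B : ℝ≥0∞ := A * (12 * 2 ^ (p - 1)) + 4 ^ q with hB
  have h4 : (4 : ℝ≥0∞) ^ q < ∞ := (ENNReal.rpow_ne_top_of_ne_zero (by simp) (by simp)).lt_top
  have hBfin : B < ∞ := ENNReal.add_lt_top.2 ⟨ENNReal.mul_lt_top hA
    (ENNReal.mul_lt_top (by simp) (two_rpow_lt_top _)), h4⟩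
  refine ⟨(1 - θ)⁻¹ * B, ENNReal.mul_lt_top (by simpa using hθ) hBfin, fun h hh => ?_⟩
  -- If the L^p part is infinite the bound is trivial, the constant being nonzero since B ≥ 4^q.
  -- Otherwise the truncated Hardy integral N is finite, because its weight is bounded on heights
  -- above ε.
  by_cases hL : lpPow p h = ∞
  · rw [hL, top_add, ENNReal.mul_top]
    · simp
    · refine mul_ne_zero (by simp) ?_
      have : (4 : ℝ≥0∞) ^ q ≠ 0 := by simp
      simp [hB, this]
  set k : ℝ × ℝ → ℝ≥0∞ := fun u => ‖h u‖ₑ ^ p / ENNReal.ofReal u.2 ^ q with hk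
  have hkm : Measurable k := by fun_prop
  have hsqε : ∀ ε : ℝ, MeasurableSet (cornerSq ∩ {u | ε < u.2}) := fun ε =>
    measurableSet_cornerSq.inter (measurableSet_lt measurable_const measurable_snd)
  have hstep : ∀ ε : ℝ, 0 < ε → ∫⁻ u in cornerSq ∩ {u | ε < u.2}, k u ≤
      (1 - θ)⁻¹ * (B * (lpPow p h + slobPow q p h)) := by
    intro ε hε
    set N := ∫⁻ u in cornerSq ∩ {u | ε < u.2}, k u with hN
    have hεq : ENNReal.ofReal ε ^ q ≠ 0 := by simp [hε]
    have hfin : N < ∞ := by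
      calc N ≤ ∫⁻ u in cornerSq ∩ {u | ε < u.2}, ‖h u‖ₑ ^ p / ENNReal.ofReal ε ^ q := by
            refine setLIntegral_mono_ae' (hsqε ε) (Eventually.of_forall fun u hu => ?_)
            exact div_rpow_le_div_rpow hq.le (ENNReal.ofReal_le_ofReal hu.2.le)
        _ ≤ ∫⁻ u in tri, ‖h u‖ₑ ^ p / ENNReal.ofReal ε ^ q :=
            lintegral_mono_set (Set.inter_subset_left.trans cornerSq_subset)
        _ = lpPow p h / ENNReal.ofReal ε ^ q := by
            simp_rw [div_eq_mul_inv]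
            rw [lintegral_mul_const' _ _ (by simpa using hεq)]; rfl
        _ < ∞ := ENNReal.div_lt_top hL hεq
    refine le_of_le_add_mul hfin hθ ?_
    set S := (cornerSq ∩ {u | ε < u.2}) ∩ {u | u.2 < 1 / 4} with hS
    have hSm : MeasurableSet S := (hsqε ε).inter (measurableSet_lt measurable_snd measurable_const)
    set S' := (cornerSq ∩ {u | ε < u.2}) ∩ {u | 1 / 4 ≤ u.2} with hS'
    have hSm' : MeasurableSet S' := (hsqε ε).inter (measurableSet_le measurable_const measurable_snd)
    have hsub : cornerSq ∩ {u | ε < u.2} ⊆ S ∪ S' := by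
      intro u hu
      rcases lt_or_ge u.2 (1 / 4) with h | h
      · exact Or.inl ⟨hu, h⟩
      · exact Or.inr ⟨hu, h⟩
    have h1 : N ≤ (∫⁻ u in S, k u) + ∫⁻ u in S', k u :=
      (lintegral_mono_set hsub).trans (lintegral_union_le _ _ _)
    have h2 : ∫⁻ u in S', k u ≤ 4 ^ q * lpPow p h := by
      calc ∫⁻ u in S', k u ≤ ∫⁻ u in S', 4 ^ q * ‖h u‖ₑ ^ p := by
            refine setLIntegral_mono_ae' hSm' (Eventually.of_forall fun u hu => ?_)
            have h5 : (1 : ℝ≥0∞) ≤ 4 * ENNReal.ofReal u.2 := by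
              rw [show (4 : ℝ≥0∞) = ENNReal.ofReal 4 by simp, ← ENNReal.ofReal_mul (by norm_num)]
              rw [← ENNReal.ofReal_one]
              have := hu.2
              simp only [Set.mem_ofPred_eq] at this
              exact ENNReal.ofReal_le_ofReal (by linarith)
            simpa using div_rpow_le_const_mul (a := ‖h u‖ₑ ^ p) hq.le (by simp) (by simp) h5
        _ ≤ ∫⁻ u in tri, 4 ^ q * ‖h u‖ₑ ^ p := lintegral_mono_set
            (Set.inter_subset_left.trans (Set.inter_subset_left.trans cornerSq_subset))
        _ = _ := lintegral_const_mul' _ _ h4.ne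
    have h3 : ∫⁻ u in S, k u ≤ A * (12 * 2 ^ (p - 1) * slobPow q p h) + θ * N := by
      set Q := cornerSq ∩ {u | ε < u.2} with hQ
      have hQm : MeasurableSet Q := hsqε ε
      -- Doubling the height of a point of S stays in the truncated square: heights below 1/4 go
      -- below 1/2 and heights above ε stay above ε. This is why the argument runs on a square
      -- rather than on the triangle, which is not stable under such doubling.
      have h6 : 2 * ∫⁻ u in S, k u ≤ ∫⁻ u in Q, k (halve u) := by
        rw [← lintegral_indicator hSm, ← lintegral_comp_halve _ (hkm.indicator hSm),
          ← lintegral_indicator hQm]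
        refine lintegral_mono fun u => ?_
        by_cases hu : halve u ∈ S
        · have : u ∈ Q := by
            obtain ⟨⟨⟨⟨a, b⟩, c, d⟩, e⟩, f⟩ := hu
            simp only [halve, Set.mem_ofPred_eq] at a b c d e f
            exact ⟨⟨⟨a, b⟩, by linarith, by linarith⟩, by simp only [Set.mem_ofPred_eq]; linarith⟩
          simp [hu, this]
        · simp [hu]
      have h7 : ∀ u, 2⁻¹ * k (halve u) ≤ A * (‖(h - h ∘ halve) u‖ₑ ^ p / ENNReal.ofReal u.2 ^ q) +
          θ * k u := by
        intro u
        simp only [hk]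
        rw [ofReal_halve_rpow hq.le, ← mul_assoc, ← hc, ← mul_div_assoc, ← mul_div_assoc,
          ← mul_div_assoc, ← ENNReal.add_div]
        gcongr
        refine le_trans ?_ (hw _ _)
        gcongr
        rw [Pi.sub_apply, Function.comp, enorm_sub_rev]
        calc ‖h (halve u)‖ₑ = ‖(h (halve u) - h u) + h u‖ₑ := by simp
          _ ≤ _ := enorm_add_le _ _
      calc ∫⁻ u in S, k u = 2⁻¹ * (2 * ∫⁻ u in S, k u) := by
            rw [← mul_assoc, ENNReal.inv_mul_cancel (by simp) (by simp), one_mul]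
        _ ≤ 2⁻¹ * ∫⁻ u in Q, k (halve u) := by gcongr
        _ = ∫⁻ u in Q, 2⁻¹ * k (halve u) := (lintegral_const_mul' _ _ (by simp)).symm
        _ ≤ ∫⁻ u in Q, (A * (‖(h - h ∘ halve) u‖ₑ ^ p / ENNReal.ofReal u.2 ^ q) + θ * k u) :=
            lintegral_mono fun u => h7 u
        _ = A * (∫⁻ u in Q, ‖(h - h ∘ halve) u‖ₑ ^ p / ENNReal.ofReal u.2 ^ q) + θ * N := by
            rw [lintegral_add_right _ (hkm.const_mul _), lintegral_const_mul' _ _ hA.ne,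
              lintegral_const_mul' _ _ (hθ.trans (by simp)).ne]
        _ ≤ A * hardyPow q p (h - h ∘ halve) + θ * N := by
            gcongr
            exact lintegral_mono_set (Set.inter_subset_left.trans cornerSq_subset)
        _ ≤ _ := by
            gcongr
            exact hardyPow_sub_halve_le hq.le hp.le hh
    calc N ≤ A * (12 * 2 ^ (p - 1) * slobPow q p h) + θ * N + 4 ^ q * lpPow p h :=
          h1.trans (add_le_add h3 h2)
      _ = A * (12 * 2 ^ (p - 1)) * slobPow q p h + 4 ^ q * lpPow p h + θ * N := by ring
      _ ≤ B * slobPow q p h + B * lpPow p h + θ * N := by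
          gcongr
          · exact le_self_add
          · exact le_add_self
      _ = _ := by ring
  rw [mul_assoc]
  exact setLIntegral_le_of_forall_pos (fun u hu => hu.2.1) hstep

/-- **Hardy's inequality** on the triangle in the subcritical range. -/
theorem exists_hardyPow_le {q p : ℝ} (hq : 0 < q) (hq1 : q < 1) (hp : 1 < p) :
    ∃ C : ℝ≥0∞, C < ∞ ∧ ∀ h : ℝ × ℝ → ℝ, Measurable h →
      hardyPow q p h ≤ C * (lpPow p h + slobPow q p h) := by
  obtain ⟨C, hC, hle⟩ := exists_cornerSq_hardy_le hq hq1 hp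
  have hC2 : C * 2 ^ (q + 2) < ∞ := ENNReal.mul_lt_top hC (two_rpow_lt_top _)
  refine ⟨C + C * 2 ^ (q + 2) + 2 ^ q, by simp [hC, hC2, two_rpow_lt_top], fun h hh => ?_⟩
  set k : ℝ × ℝ → ℝ≥0∞ := fun u => ‖h u‖ₑ ^ p / ENNReal.ofReal u.2 ^ q with hk
  have hkm : Measurable k := by fun_prop
  set S := mirror ⁻¹' cornerSq with hS
  have hSm : MeasurableSet S := measurable_mirror measurableSet_cornerSq
  set S' := tri ∩ {u | 1 / 2 ≤ u.2} with hS'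
  have hSm' : MeasurableSet S' :=
    measurableSet_tri.inter (measurableSet_le measurable_const measurable_snd)
  -- The corner square handles the left half near the edge, its mirror image the right half, and on
  -- heights at least 1/2 the weight is bounded.
  have hcover : tri ⊆ cornerSq ∪ S ∪ S' := by
    rintro u ⟨a, b, c⟩
    rcases lt_or_ge u.2 (1 / 2) with h1 | h1
    · left
      rcases lt_or_ge u.1 (1 / 2) with h2 | h2
      · exact Or.inl ⟨⟨a, h2⟩, b, h1⟩
      · refine Or.inr ⟨⟨?_, ?_⟩, b, h1⟩ <;> simp only [mirror] <;> linarith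
    · exact Or.inr ⟨⟨a, b, c⟩, h1⟩
  have h1 : hardyPow q p h ≤ (∫⁻ u in cornerSq, k u) + (∫⁻ u in S, k u) + ∫⁻ u in S', k u := by
    refine (lintegral_mono_set hcover).trans ((lintegral_union_le _ _ _).trans ?_)
    gcongr
    exact lintegral_union_le _ _ _
  have h2 : ∫⁻ u in S, k u ≤ C * 2 ^ (q + 2) * (lpPow p h + slobPow q p h) := by
    set k' : ℝ × ℝ → ℝ≥0∞ := fun u => ‖(h ∘ mirror) u‖ₑ ^ p / ENNReal.ofReal u.2 ^ q with hk'
    have hm' : Measurable k' := by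
      have := hh.comp measurable_mirror
      rw [hk']
      fun_prop
    have h3 : ∀ u, k u = k' (mirror u) := by
      intro u
      simp only [hk, hk', Function.comp, mirror_mirror]
      rfl
    simp_rw [h3]
    calc ∫⁻ u in S, k' (mirror u) ≤ ∫⁻ u in cornerSq, k' u :=
          setLIntegral_comp_mirror_le hm' hSm measurableSet_cornerSq fun _ hu => hu
      _ ≤ C * (lpPow p (h ∘ mirror) + slobPow q p (h ∘ mirror)) :=
          hle _ (hh.comp measurable_mirror)
      _ ≤ C * (2 ^ (q + 2) * lpPow p h + 2 ^ (q + 2) * slobPow q p h) := by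
          gcongr
          · refine (lpPow_comp_mirror_le hh).trans (le_mul_of_one_le_left' ?_)
            exact ENNReal.one_le_rpow (by norm_num) (by linarith)
          · exact slobPow_comp_mirror_le hq.le hh
      _ = _ := by ring
  have h4 : ∫⁻ u in S', k u ≤ 2 ^ q * lpPow p h := by
    calc ∫⁻ u in S', k u ≤ ∫⁻ u in S', 2 ^ q * ‖h u‖ₑ ^ p := by
          refine setLIntegral_mono_ae' hSm' (Eventually.of_forall fun u hu => ?_)
          have h5 : (1 : ℝ≥0∞) ≤ 2 * ENNReal.ofReal u.2 := by
            rw [show (2 : ℝ≥0∞) = ENNReal.ofReal 2 by simp, ← ENNReal.ofReal_mul (by norm_num),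
              ← ENNReal.ofReal_one]
            have := hu.2
            simp only [Set.mem_ofPred_eq] at this
            exact ENNReal.ofReal_le_ofReal (by linarith)
          simpa using div_rpow_le_const_mul (a := ‖h u‖ₑ ^ p) hq.le (by simp) (by simp) h5
      _ ≤ ∫⁻ u in tri, 2 ^ q * ‖h u‖ₑ ^ p := lintegral_mono_set Set.inter_subset_left
      _ = _ := lintegral_const_mul' _ _ (two_rpow_lt_top _).ne
  calc hardyPow q p h ≤ C * (lpPow p h + slobPow q p h) +
        C * 2 ^ (q + 2) * (lpPow p h + slobPow q p h) + 2 ^ q * (lpPow p h + slobPow q p h) := by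
        refine h1.trans (add_le_add (add_le_add (hle h hh) h2) (h4.trans ?_))
        gcongr
        exact le_self_add
    _ = _ := by ring

/-! ### Hardy's inequality in the supercritical range -/

/-- The change of variables gives a factor 2 and the weight a factor 2^(-q). The product is a
contraction factor exactly when q > 1. -/
theorem hardyPow_comp_halve_le {q p : ℝ} (hq : 0 ≤ q) {g : ℝ × ℝ → ℝ} (hg : Measurable g) :
    hardyPow q p (g ∘ halve) ≤ ENNReal.ofReal (2 ^ (1 - q)) * hardyPow q p g := by
  have h2q : (2 : ℝ≥0∞) ^ q ≠ 0 := by simp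
  have h2q' : (2 : ℝ≥0∞) ^ q ≠ ∞ := (two_rpow_lt_top _).ne
  set k : ℝ × ℝ → ℝ≥0∞ := fun u => ‖g u‖ₑ ^ p / ENNReal.ofReal u.2 ^ q with hk
  have h1 : (2 : ℝ≥0∞) ^ q * hardyPow q p (g ∘ halve) ≤ 2 * hardyPow q p g := by
    have : (2 : ℝ≥0∞) ^ q * hardyPow q p (g ∘ halve) = ∫⁻ u in tri, k (halve u) := by
      rw [hardyPow, ← lintegral_const_mul' _ _ h2q']
      refine lintegral_congr fun u => ?_
      simp only [hk]
      rw [ofReal_halve_rpow hq]; rfl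
    rw [this]
    exact setLIntegral_comp_halve_le (k := k) (by fun_prop) measurableSet_tri measurableSet_tri
      fun u => halve_mem_tri
  calc hardyPow q p (g ∘ halve) = (2 ^ q)⁻¹ * (2 ^ q * hardyPow q p (g ∘ halve)) := by
        rw [← mul_assoc, ENNReal.inv_mul_cancel h2q h2q', one_mul]
    _ ≤ (2 ^ q)⁻¹ * (2 * hardyPow q p g) := by gcongr
    _ = _ := by
        rw [← ENNReal.ofReal_rpow_of_pos two_pos, ENNReal.rpow_sub _ _ (by simp) (by simp)]
        simp [div_eq_mul_inv]; ring

theorem halve_iterate (n : ℕ) (u : ℝ × ℝ) : halve^[n] u = (u.1, u.2 / 2 ^ n) := by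
  induction n with
  | zero => simp
  | succ n ih => rw [Function.iterate_succ_apply', ih, halve, pow_succ]; simp [div_div]

/-- The closed reference triangle. -/
def ctri : Set (ℝ × ℝ) := {u | 0 ≤ u.1 ∧ 0 ≤ u.2 ∧ u.1 + u.2 ≤ 1}

theorem tri_subset_ctri : tri ⊆ ctri := fun _ hu => ⟨hu.1.le, hu.2.1.le, hu.2.2.le⟩

theorem isClosed_ctri : IsClosed ctri :=
  (isClosed_le continuous_const continuous_fst).inter ((isClosed_le continuous_const
    continuous_snd).inter (isClosed_le (continuous_fst.add continuous_snd) continuous_const))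

/-- **Hardy's inequality** on the triangle in the supercritical range, for continuous functions
minus their boundary values. -/
theorem exists_hardyPow_sub_bottom_le {q p : ℝ} (hq1 : 1 < q) (hp : 1 < p) :
    ∃ C : ℝ≥0∞, C < ∞ ∧ ∀ φ : ℝ × ℝ → ℝ, Measurable φ → ContinuousOn φ ctri →
      hardyPow q p (fun u => φ u - φ (u.1, 0)) ≤ C * slobPow q p φ := by
  have hq : 0 ≤ q := by linarith
  have hc0 : (0 : ℝ) < 2 ^ (1 - q) := Real.rpow_pos_of_pos two_pos _
  have hc1 : (2 : ℝ) ^ (1 - q) < 1 := Real.rpow_lt_one_of_one_lt_of_neg (by norm_num) (by linarith)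
  obtain ⟨A, θ, hA, hθ, hw⟩ := exists_weighted_rpow_add_le hp hc0 hc1
  set c := ENNReal.ofReal ((2 : ℝ) ^ (1 - q)) with hc
  have hc0' : c ≠ 0 := by simpa [hc] using hc0
  have hc' : c ≠ ∞ := by simp [hc]
  have hθ' : 1 - θ ≠ 0 := (tsub_pos_of_lt hθ).ne'
  have hinv : (1 - θ)⁻¹ = 1 + θ * (1 - θ)⁻¹ := by
    have h1 : (1 - θ) * (1 - θ)⁻¹ = 1 := ENNReal.mul_inv_cancel hθ' (ENNReal.sub_ne_top (by simp))
    calc (1 - θ)⁻¹ = ((1 - θ) + θ) * (1 - θ)⁻¹ := by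
          rw [tsub_add_cancel_of_le hθ.le, one_mul]
      _ = _ := by rw [add_mul, h1]
  refine ⟨c⁻¹ * ((1 - θ)⁻¹ * (A * (12 * 2 ^ (p - 1)))), ?_, fun φ hφ hcont => ?_⟩
  · have := two_rpow_lt_top (p - 1)
    refine ENNReal.mul_lt_top (by simpa using hc0'.bot_lt) (ENNReal.mul_lt_top (by simpa using hθ)
      (ENNReal.mul_lt_top hA (ENNReal.mul_lt_top (by simp) this)))
  set D := hardyPow q p (φ - φ ∘ halve) with hD
  have hmit : ∀ n, Measurable (φ - φ ∘ halve^[n]) := fun n =>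
    hφ.sub (hφ.comp (measurable_halve.iterate n))
  -- Telescoping: φ - φ ∘ halve^(n+1) is (φ - φ ∘ halve) plus (φ - φ ∘ halve^n) ∘ halve. The bound
  -- (1 - θ)⁻¹AD is the fixed point of x ↦ AD + θx, so it propagates from the value 0 at n = 0
  -- without any prior finiteness.
  have hrec : ∀ n, c * hardyPow q p (φ - φ ∘ halve^[n]) ≤ (1 - θ)⁻¹ * (A * D) := by
    intro n
    induction n with
    | zero => simp [hardyPow, show (0 : ℝ) < p by linarith]
    | succ n ih =>
      set g := φ - φ ∘ halve^[n] with hg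
      have h1 : c * hardyPow q p (φ - φ ∘ halve^[n + 1]) ≤ A * D + θ * hardyPow q p (g ∘ halve) := by
        rw [hD, hardyPow, hardyPow, hardyPow, ← lintegral_const_mul' _ _ hc',
          ← lintegral_const_mul' _ _ hA.ne, ← lintegral_const_mul' _ _ (hθ.trans (by simp)).ne,
          ← lintegral_add_left]
        · refine lintegral_mono fun u => ?_
          rw [← mul_div_assoc, ← mul_div_assoc, ← mul_div_assoc, ← ENNReal.add_div]
          gcongr
          refine le_trans ?_ (hw _ _)
          gcongr
          refine le_trans (le_of_eq ?_) (enorm_add_le _ _)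
          simp [hg]
        · have := hmit 1
          simp only [Function.iterate_one] at this
          fun_prop
      have h2 := hardyPow_comp_halve_le (p := p) hq (hmit n)
      calc _ ≤ A * D + θ * hardyPow q p (g ∘ halve) := h1
        _ ≤ A * D + θ * (c * hardyPow q p g) := by gcongr
        _ ≤ A * D + θ * ((1 - θ)⁻¹ * (A * D)) := by gcongr
        _ = (1 + θ * (1 - θ)⁻¹) * (A * D) := by ring
        _ = _ := by rw [← hinv]
  have hrec' : ∀ n, hardyPow q p (φ - φ ∘ halve^[n]) ≤ c⁻¹ * ((1 - θ)⁻¹ * (A * D)) := by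
    intro n
    calc _ = c⁻¹ * (c * hardyPow q p (φ - φ ∘ halve^[n])) := by
          rw [← mul_assoc, ENNReal.inv_mul_cancel hc0' hc', one_mul]
      _ ≤ _ := mul_le_mul_right (hrec n) _
  -- Continuity up to the edge identifies the limit of the iterates with the boundary value; Fatou's
  -- lemma then passes the uniform bound to the limit.
  have hlim : ∀ u ∈ tri, ‖φ u - φ (u.1, 0)‖ₑ ^ p / ENNReal.ofReal u.2 ^ q ≤
      liminf (fun n => ‖(φ - φ ∘ halve^[n]) u‖ₑ ^ p / ENNReal.ofReal u.2 ^ q) atTop := by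
    intro u hu
    refine (Tendsto.liminf_eq ?_).ge
    have h3 : Tendsto (fun n : ℕ => φ (halve^[n] u)) atTop (𝓝 (φ (u.1, 0))) := by
      have hmem : (u.1, (0 : ℝ)) ∈ ctri := ⟨hu.1.le, le_rfl, by
        have := hu.2.1; have := hu.2.2; simp only; linarith⟩
      refine (hcont _ hmem).tendsto.comp (tendsto_nhdsWithin_iff.2 ⟨?_, Eventually.of_forall
        fun n => ?_⟩)
      · simp_rw [halve_iterate]
        refine tendsto_const_nhds.prodMk_nhds ?_
        simpa [div_eq_mul_inv] using (tendsto_pow_atTop_nhds_zero_of_lt_one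
          (by norm_num : (0 : ℝ) ≤ 1 / 2) (by norm_num)).const_mul u.2
      · refine tri_subset_ctri ?_
        induction n with
        | zero => exact hu
        | succ n ih => rw [Function.iterate_succ_apply']; exact halve_mem_tri ih
    have h4 : Tendsto (fun n : ℕ => ‖(φ - φ ∘ halve^[n]) u‖ₑ ^ p) atTop
        (𝓝 (‖φ u - φ (u.1, 0)‖ₑ ^ p)) :=
      (ENNReal.continuous_rpow_const.tendsto _).comp (tendsto_const_nhds.sub h3).enorm
    refine ENNReal.Tendsto.div_const h4 (Or.inr ?_)
    simp [hu.2.1]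
  calc hardyPow q p (fun u => φ u - φ (u.1, 0))
      ≤ ∫⁻ u in tri, liminf (fun n => ‖(φ - φ ∘ halve^[n]) u‖ₑ ^ p / ENNReal.ofReal u.2 ^ q) atTop :=
        setLIntegral_mono_ae' measurableSet_tri (Eventually.of_forall hlim)
    _ ≤ liminf (fun n => hardyPow q p (φ - φ ∘ halve^[n])) atTop := by
        refine lintegral_liminf_le fun n => ?_
        have := hmit n
        fun_prop
    _ ≤ c⁻¹ * ((1 - θ)⁻¹ * (A * D)) := by
        refine (liminf_le_liminf (Eventually.of_forall hrec')).trans ?_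
        simp
    _ ≤ c⁻¹ * ((1 - θ)⁻¹ * (A * (12 * 2 ^ (p - 1) * slobPow q p φ))) := by
        gcongr
        exact hardyPow_sub_halve_le hq hp.le hφ
    _ = _ := by ring

/-! ### The trace inequality -/

/-- Every vertical fibre of the corner square has length 1/2, so the boundary integral is twice the
integral over the square of the boundary value extended constantly upwards. That extension is
compared with φ by the supercritical Hardy inequality, whose weight is at least 1 on the triangle.
-/
theorem exists_half_trace_le {q p : ℝ} (hq1 : 1 < q) (hp : 1 < p) :
    ∃ C : ℝ≥0∞, C < ∞ ∧ ∀ φ : ℝ × ℝ → ℝ, Measurable φ → ContinuousOn φ ctri →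
      ∫⁻ x in Set.Ioo (0 : ℝ) (1 / 2), ‖φ (x, 0)‖ₑ ^ p ≤ C * (lpPow p φ + slobPow q p φ) := by
  obtain ⟨C, hC, hle⟩ := exists_hardyPow_sub_bottom_le hq1 hp
  have hq : 0 ≤ q := by linarith
  refine ⟨2 * 2 ^ (p - 1) * (1 + C), ENNReal.mul_lt_top (ENNReal.mul_lt_top (by simp)
    (two_rpow_lt_top _)) (by simp [hC]), fun φ hφ hcont => ?_⟩
  have hb : Measurable fun x : ℝ => φ (x, 0) := hφ.comp (by fun_prop)
  have hI : volume (Set.Ioo (0 : ℝ) (1 / 2)) = 2⁻¹ := by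
    rw [Real.volume_Ioo]; simp
  have h1 : ∫⁻ u in cornerSq, ‖φ (u.1, 0)‖ₑ ^ p =
      2⁻¹ * ∫⁻ x in Set.Ioo (0 : ℝ) (1 / 2), ‖φ (x, 0)‖ₑ ^ p := by
    rw [cornerSq, Measure.volume_eq_prod, ← Measure.prod_restrict, lintegral_prod _ (by fun_prop)]
    simp only [lintegral_const, Measure.restrict_apply_univ, hI]
    rw [lintegral_mul_const' _ _ (by simp), mul_comm]
  have h2 : ∫⁻ u in cornerSq, ‖φ (u.1, 0)‖ₑ ^ p ≤
      2 ^ (p - 1) * (hardyPow q p (fun u => φ u - φ (u.1, 0)) + lpPow p φ) := by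
    calc _ ≤ ∫⁻ u in tri, ‖φ (u.1, 0)‖ₑ ^ p := lintegral_mono_set cornerSq_subset
      _ ≤ ∫⁻ u in tri, 2 ^ (p - 1) * (‖φ u - φ (u.1, 0)‖ₑ ^ p / ENNReal.ofReal u.2 ^ q +
            ‖φ u‖ₑ ^ p) := by
          refine setLIntegral_mono_ae' measurableSet_tri (Eventually.of_forall fun u hu => ?_)
          have h3 := enorm_sub_rpow_le hp.le (φ (u.1, 0)) (φ u) 0
          simp only [sub_zero] at h3
          refine h3.trans ?_
          gcongr
          rw [enorm_sub_rev]
          have h4 : ENNReal.ofReal u.2 ≤ 1 := by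
            obtain ⟨a, b, c⟩ := hu
            simp only [ENNReal.ofReal_le_one]; linarith
          simpa using div_rpow_le_div_rpow (a := ‖φ u - φ (u.1, 0)‖ₑ ^ p) hq h4
      _ = _ := by
          rw [lintegral_const_mul' _ _ (two_rpow_lt_top _).ne, lintegral_add_right _ (by fun_prop)]
          rfl
  calc ∫⁻ x in Set.Ioo (0 : ℝ) (1 / 2), ‖φ (x, 0)‖ₑ ^ p
      = 2 * (2⁻¹ * ∫⁻ x in Set.Ioo (0 : ℝ) (1 / 2), ‖φ (x, 0)‖ₑ ^ p) := by
        rw [← mul_assoc, ENNReal.mul_inv_cancel (by simp) (by simp), one_mul]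
    _ ≤ 2 * (2 ^ (p - 1) * (C * slobPow q p φ + lpPow p φ)) := by
        rw [← h1]
        gcongr
        exact h2.trans (by gcongr; exact hle φ hφ hcont)
    _ ≤ 2 * (2 ^ (p - 1) * ((1 + C) * slobPow q p φ + (1 + C) * lpPow p φ)) := by
        gcongr
        · simp
        · exact le_mul_of_one_le_left' (by simp)
    _ = _ := by ring

/-- The **trace inequality** on the bottom edge. -/
theorem exists_trace_le {q p : ℝ} (hq1 : 1 < q) (hp : 1 < p) :
    ∃ C : ℝ≥0∞, C < ∞ ∧ ∀ φ : ℝ × ℝ → ℝ, Measurable φ → ContinuousOn φ ctri →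
      ∫⁻ x in Set.Ioo (0 : ℝ) 1, ‖φ (x, 0)‖ₑ ^ p ≤ C * (lpPow p φ + slobPow q p φ) := by
  obtain ⟨C, hC, hle⟩ := exists_half_trace_le hq1 hp
  have hq : 0 ≤ q := by linarith
  have hC2 : C * 2 ^ (q + 2) < ∞ := ENNReal.mul_lt_top hC (two_rpow_lt_top _)
  refine ⟨C + C * 2 ^ (q + 2), by simp [hC, hC2], fun φ hφ hcont => ?_⟩
  have hb : Measurable fun x : ℝ => φ (x, 0) := hφ.comp (by fun_prop)
  have hcont' : ContinuousOn (φ ∘ mirror) ctri := by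
    refine hcont.comp continuous_mirror.continuousOn fun u hu => ?_
    obtain ⟨a, b, c⟩ := hu
    refine ⟨?_, b, ?_⟩ <;> simp only [mirror] <;> linarith
  have h1 : ∫⁻ x in Set.Ioo (0 : ℝ) 1, ‖φ (x, 0)‖ₑ ^ p ≤
      (∫⁻ x in Set.Ioc (0 : ℝ) (1 / 2), ‖φ (x, 0)‖ₑ ^ p) +
        ∫⁻ x in Set.Ioo (1 / 2 : ℝ) 1, ‖φ (x, 0)‖ₑ ^ p := by
    refine (lintegral_mono_set ?_).trans (lintegral_union_le _ _ _)
    intro x hx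
    rcases le_or_gt x (1 / 2) with h | h
    · exact Or.inl ⟨hx.1, h⟩
    · exact Or.inr ⟨h, hx.2⟩
  have h2 : ∫⁻ x in Set.Ioo (1 / 2 : ℝ) 1, ‖φ (x, 0)‖ₑ ^ p =
      ∫⁻ x in Set.Ioo (0 : ℝ) (1 / 2), ‖(φ ∘ mirror) (x, 0)‖ₑ ^ p := by
    rw [← lintegral_indicator measurableSet_Ioo, ← lintegral_indicator measurableSet_Ioo,
      ← lintegral_sub_left_eq_self _ 1]
    refine lintegral_congr fun x => ?_
    have : 1 - x ∈ Set.Ioo (1 / 2 : ℝ) 1 ↔ x ∈ Set.Ioo (0 : ℝ) (1 / 2) := by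
      simp only [Set.mem_Ioo]; constructor <;> rintro ⟨a, b⟩ <;> constructor <;> linarith
    by_cases hx : x ∈ Set.Ioo (0 : ℝ) (1 / 2)
    · rw [Set.indicator_of_mem hx, Set.indicator_of_mem (this.2 hx)]
      simp [mirror]
    · rw [Set.indicator_of_notMem hx, Set.indicator_of_notMem (fun h => hx (this.1 h))]
  rw [h2, ← restrict_Ioo_eq_restrict_Ioc] at h1
  calc _ ≤ C * (lpPow p φ + slobPow q p φ) +
        C * (lpPow p (φ ∘ mirror) + slobPow q p (φ ∘ mirror)) :=
        h1.trans (add_le_add (hle φ hφ hcont) (hle _ (hφ.comp measurable_mirror) hcont'))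
    _ ≤ C * (lpPow p φ + slobPow q p φ) +
        C * (2 ^ (q + 2) * lpPow p φ + 2 ^ (q + 2) * slobPow q p φ) := by
        gcongr
        · refine (lpPow_comp_mirror_le hφ).trans (le_mul_of_one_le_left' ?_)
          exact ENNReal.one_le_rpow (by norm_num) (by linarith)
        · exact slobPow_comp_mirror_le hq hφ
    _ = _ := by ring

/-! ### Density of continuous functions by mollification -/

theorem volume_tri_lt_top : volume tri < ∞ := by
  refine lt_of_le_of_lt (measure_mono (t := Metric.closedBall 0 1) fun u hu => ?_)
    measure_closedBall_lt_top
  obtain ⟨a, b, c⟩ := hu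
  rw [mem_closedBall_zero_iff, Prod.norm_def]
  exact max_le (abs_le.2 ⟨by linarith, by linarith⟩) (abs_le.2 ⟨by linarith, by linarith⟩)

/-- Almost everywhere convergence together with convergence of norms implies norm convergence. -/
theorem tendsto_lintegral_enorm_sub_rpow {α : Type*} [MeasurableSpace α] {μ : Measure α} {p : ℝ}
    (hp : 1 ≤ p) {g : α → ℝ} {G : ℕ → α → ℝ} (hg : Measurable g) (hG : ∀ n, Measurable (G n))
    (hlim : ∀ᵐ x ∂μ, Tendsto (fun n => G n x) atTop (𝓝 (g x)))
    (hfin : ∫⁻ x, ‖g x‖ₑ ^ p ∂μ ≠ ∞) {c : ℕ → ℝ≥0∞} (hc : Tendsto c atTop (𝓝 1))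
    (hle : ∀ n, ∫⁻ x, ‖G n x‖ₑ ^ p ∂μ ≤ c n * ∫⁻ x, ‖g x‖ₑ ^ p ∂μ) :
    Tendsto (fun n => ∫⁻ x, ‖G n x - g x‖ₑ ^ p ∂μ) atTop (𝓝 0) := by
  have hp0 : 0 < p := by linarith
  set A := ∫⁻ x, ‖g x‖ₑ ^ p ∂μ with hA
  have h2 : (2 : ℝ≥0∞) ^ (p - 1) ≠ ∞ := (two_rpow_lt_top _).ne
  set M : ℝ≥0∞ := 2 ^ (p - 1) * (A + A) with hM
  have hMfin : M ≠ ∞ := ENNReal.mul_ne_top h2 (by simp [hfin])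
  -- Convexity makes this difference a genuine nonnegative one. Fatou's lemma applied to it bounds
  -- the lower limit of its integrals by M from below, while the norm bounds make the integral of
  -- the minuend at most asymptotically M; the error integral is squeezed to 0.
  set K : ℕ → α → ℝ≥0∞ := fun n x => 2 ^ (p - 1) * (‖G n x‖ₑ ^ p + ‖g x‖ₑ ^ p) - ‖G n x - g x‖ₑ ^ p
  have hKm : ∀ n, Measurable (K n) := fun n => by
    have := hG n
    fun_prop
  set d : ℕ → ℝ≥0∞ := fun n => ∫⁻ x, ‖G n x - g x‖ₑ ^ p ∂μ with hd
  have hsum : ∀ n, (∫⁻ x, K n x ∂μ) + d n ≤ 2 ^ (p - 1) * (c n * A + A) := by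
    intro n
    have hGn := hG n
    rw [hd, ← lintegral_add_left (hKm n)]
    calc _ = ∫⁻ x, 2 ^ (p - 1) * (‖G n x‖ₑ ^ p + ‖g x‖ₑ ^ p) ∂μ := by
          refine lintegral_congr fun x => tsub_add_cancel_of_le ?_
          simpa [enorm_neg] using enorm_sub_rpow_le hp (G n x) 0 (g x)
      _ = 2 ^ (p - 1) * ((∫⁻ x, ‖G n x‖ₑ ^ p ∂μ) + A) := by
          rw [lintegral_const_mul' _ _ h2, lintegral_add_left (by fun_prop)]
      _ ≤ _ := by gcongr; exact hle n
  have hlow : M ≤ liminf (fun n => ∫⁻ x, K n x ∂μ) atTop := by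
    refine le_trans ?_ (lintegral_liminf_le hKm)
    have : M = ∫⁻ x, 2 ^ (p - 1) * (‖g x‖ₑ ^ p + ‖g x‖ₑ ^ p) ∂μ := by
      rw [lintegral_const_mul' _ _ h2, lintegral_add_left (by fun_prop)]
    rw [this]
    refine lintegral_mono_ae (hlim.mono fun x hx => ?_)
    refine (Tendsto.liminf_eq ?_).ge
    have h3 : Tendsto (fun n => ‖G n x‖ₑ ^ p) atTop (𝓝 (‖g x‖ₑ ^ p)) :=
      (ENNReal.continuous_rpow_const.tendsto _).comp hx.enorm
    have h4 : Tendsto (fun n => ‖G n x - g x‖ₑ ^ p) atTop (𝓝 0) := by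
      have := (ENNReal.continuous_rpow_const (y := p).tendsto _).comp (hx.sub_const (g x)).enorm
      simpa [hp0, Function.comp_def] using this
    have h5 := ENNReal.Tendsto.sub (ENNReal.Tendsto.const_mul (h3.add_const (‖g x‖ₑ ^ p))
      (Or.inr h2)) h4 (Or.inr (by simp))
    simpa using h5
  have hup : Tendsto (fun n => 2 ^ (p - 1) * (c n * A + A)) atTop (𝓝 M) := by
    have h6 : Tendsto (fun n => c n * A) atTop (𝓝 A) := by
      simpa using ENNReal.Tendsto.mul_const hc (Or.inr hfin)
    exact ENNReal.Tendsto.const_mul (h6.add_const A) (Or.inr h2)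
  rw [ENNReal.tendsto_nhds_zero]
  intro δ hδ
  by_cases hM0 : M = 0
  · have hA0 : A = 0 := by
      have : (2 : ℝ≥0∞) ^ (p - 1) ≠ 0 := by simp
      simpa [hM, this] using hM0
    refine Eventually.of_forall fun n => ?_
    have h8 := (le_add_self (a := d n) (b := ∫⁻ x, K n x ∂μ)).trans (hsum n)
    rw [hA0] at h8
    simp only [mul_zero, add_zero, nonpos_iff_eq_zero] at h8
    change d n ≤ δ
    rw [h8]; exact zero_le
  by_cases hδ' : δ = ∞
  · simp [hδ']
  have hδ2 : δ / 2 ≠ 0 := by simp [hδ.ne']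
  have h7 : ∀ᶠ n in atTop, M - δ / 2 < ∫⁻ x, K n x ∂μ :=
    eventually_lt_of_lt_liminf (lt_of_lt_of_le (ENNReal.sub_lt_self hMfin hM0 hδ2) hlow)
  have h8 : ∀ᶠ n in atTop, 2 ^ (p - 1) * (c n * A + A) < M + δ / 2 :=
    hup.eventually (gt_mem_nhds (ENNReal.lt_add_right hMfin hδ2))
  filter_upwards [h7, h8] with n h7 h8
  have h9 : M ≤ (∫⁻ x, K n x ∂μ) + δ / 2 := tsub_le_iff_right.1 h7.le
  have hKfin : (∫⁻ x, K n x ∂μ) ≠ ∞ := by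
    refine (lt_of_le_of_lt (le_self_add.trans (hsum n)) (h8.trans ?_)).ne
    exact ENNReal.add_lt_top.2 ⟨hMfin.lt_top, (ENNReal.div_lt_top hδ' (by simp))⟩
  have h10 : (∫⁻ x, K n x ∂μ) + d n ≤ (∫⁻ x, K n x ∂μ) + δ := by
    calc _ ≤ M + δ / 2 := (hsum n).trans h8.le
      _ ≤ (∫⁻ x, K n x ∂μ) + δ / 2 + δ / 2 := by gcongr
      _ = _ := by rw [add_assoc, ENNReal.add_halves]
  exact (ENNReal.add_le_add_iff_left hKfin).1 h10

/-- Jensen's inequality, obtained from monotonicity of L^p norms in the exponent over a probability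
space. -/
theorem enorm_integral_rpow_le {α : Type*} [MeasurableSpace α] {μ : Measure α}
    [IsProbabilityMeasure μ] {p : ℝ} (hp : 1 ≤ p) {g : α → ℝ} (hg : Measurable g) :
    ‖∫ x, g x ∂μ‖ₑ ^ p ≤ ∫⁻ x, ‖g x‖ₑ ^ p ∂μ := by
  have hp0 : 0 < p := by linarith
  have h1 := eLpNorm'_le_eLpNorm'_of_exponent_le (f := g) (μ := μ) one_pos hp
    hg.aestronglyMeasurable
  rw [eLpNorm'_eq_lintegral_enorm, eLpNorm'_eq_lintegral_enorm] at h1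
  simp only [ENNReal.rpow_one, div_one] at h1
  calc _ ≤ ((∫⁻ x, ‖g x‖ₑ ^ p ∂μ) ^ (1 / p)) ^ p := by
        gcongr
        exact (enorm_integral_le_lintegral_enorm _).trans h1
    _ = _ := by rw [← ENNReal.rpow_mul]; simp [hp0.ne']

/-- Dominated convergence: for w off the sphere around m, which is null, membership of w in the ball
is locally constant in the centre. -/
theorem continuous_setIntegral_closedBall {f : ℝ × ℝ → ℝ} (hf : Integrable f) {r : ℝ}
    (hr : 0 < r) : Continuous fun m : ℝ × ℝ => ∫ w in Metric.closedBall m r, f w := by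
  simp_rw [← integral_indicator Metric.isClosed_closedBall.measurableSet]
  refine continuous_iff_continuousAt.2 fun m => ?_
  refine continuousAt_of_dominated (bound := fun w => ‖f w‖) ?_ ?_ hf.norm ?_
  · exact Eventually.of_forall fun x =>
      hf.aestronglyMeasurable.indicator Metric.isClosed_closedBall.measurableSet
  · exact Eventually.of_forall fun x => Eventually.of_forall fun w => norm_indicator_le_norm_self _ _
  · have h0 : volume (Metric.sphere m r) = 0 := Measure.addHaar_sphere_of_ne_zero _ _ hr.ne'
    filter_upwards [compl_mem_ae_iff.2 h0] with w hw
    have hd : Continuous fun x : ℝ × ℝ => dist w x := by fun_prop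
    rcases lt_or_gt_of_ne (show dist w m ≠ r from hw) with h | h
    · have : (fun x => (Metric.closedBall x r).indicator f w) =ᶠ[𝓝 m] fun _ => f w := by
        filter_upwards [hd.continuousAt.eventually (gt_mem_nhds h)] with x hx
        exact Set.indicator_of_mem (Metric.mem_closedBall.2 hx.le) _
      exact this.continuousAt
    · have : (fun x => (Metric.closedBall x r).indicator f w) =ᶠ[𝓝 m] fun _ => 0 := by
        filter_upwards [hd.continuousAt.eventually (lt_mem_nhds h)] with x hx
        exact Set.indicator_of_notMem (fun h' => not_lt.2 (Metric.mem_closedBall.1 h') hx) _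
      exact this.continuousAt

/-- A closed ball inside the triangle. -/
def innerBall : Set (ℝ × ℝ) := Metric.closedBall (1 / 4, 1 / 4) (1 / 8)

theorem measurableSet_innerBall : MeasurableSet innerBall :=
  Metric.isClosed_closedBall.measurableSet

/-- The contraction of the triangle towards an inner point. -/
def shrink (ε : ℝ) (u z : ℝ × ℝ) : ℝ × ℝ := (1 - ε) • u + ε • z

@[fun_prop]
theorem measurable_shrink (ε : ℝ) : Measurable fun w : (ℝ × ℝ) × (ℝ × ℝ) => shrink ε w.1 w.2 := by
  unfold shrink; fun_prop

/-- Points of the inner ball have coordinates at least 1/8 with sum at most 3/4, so mixing them in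
makes every inequality strict. The mollifier thus samples only inside the triangle, even up to its
boundary, and no extension operator is needed. -/
theorem shrink_mem_tri {ε : ℝ} (h0 : 0 < ε) (h1 : ε < 1) {u z : ℝ × ℝ} (hu : u ∈ ctri)
    (hz : z ∈ innerBall) : shrink ε u z ∈ tri := by
  obtain ⟨a, b, c⟩ := hu
  rw [innerBall, Metric.mem_closedBall, Prod.dist_eq, max_le_iff, Real.dist_eq, Real.dist_eq,
    abs_le, abs_le] at hz
  obtain ⟨⟨d, e⟩, f, g⟩ := hz
  simp only at d e f g
  have h1' : 0 < 1 - ε := by linarith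
  refine ⟨?_, ?_, ?_⟩ <;> simp only [shrink, Prod.fst_add, Prod.snd_add, Prod.smul_fst,
    Prod.smul_snd, smul_eq_mul]
  · have := mul_nonneg h1'.le a
    have := mul_pos h0 (show 0 < z.1 by linarith)
    linarith
  · have := mul_nonneg h1'.le b
    have := mul_pos h0 (show 0 < z.2 by linarith)
    linarith
  · have := mul_le_mul_of_nonneg_left c h1'.le
    have := mul_lt_mul_of_pos_left (show z.1 + z.2 < 1 by linarith) h0
    linarith

/-- The average of a function over a small ball obtained by contracting the triangle. -/
noncomputable def mollify (ε : ℝ) (f : ℝ × ℝ → ℝ) (u : ℝ × ℝ) : ℝ :=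
  ⨍ z in innerBall, f (shrink ε u z)

theorem setIntegral_innerBall_comp_shrink {ε : ℝ} (h0 : 0 < ε) (f : ℝ × ℝ → ℝ) (u : ℝ × ℝ) :
    ∫ z in innerBall, f (shrink ε u z) =
      (ε ^ 2)⁻¹ * ∫ w in Metric.closedBall (shrink ε u (1 / 4, 1 / 4)) (ε * (1 / 8)), f w := by
  rw [← integral_indicator measurableSet_innerBall,
    ← integral_indicator Metric.isClosed_closedBall.measurableSet]
  set B := Metric.closedBall (shrink ε u (1 / 4, 1 / 4)) (ε * (1 / 8)) with hB
  have h1 : ∀ z, innerBall.indicator (fun z => f (shrink ε u z)) z =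
      B.indicator f ((1 - ε) • u + ε • z) := by
    intro z
    have h2 : z ∈ innerBall ↔ shrink ε u z ∈ B := by
      rw [innerBall, hB, Metric.mem_closedBall, Metric.mem_closedBall, shrink, shrink, dist_add_left,
        dist_smul₀, Real.norm_of_nonneg h0.le, mul_le_mul_iff_right₀ h0]
    by_cases hz : z ∈ innerBall
    · rw [Set.indicator_of_mem hz, ← shrink, Set.indicator_of_mem (h2.1 hz)]
    · rw [Set.indicator_of_notMem hz, ← shrink, Set.indicator_of_notMem (fun h => hz (h2.2 h))]
  simp_rw [h1]
  rw [Measure.integral_comp_smul volume (fun w => B.indicator f ((1 - ε) • u + w)) ε,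
    integral_add_left_eq_self]
  simp

/-- As an average over a small ball, the mollification is within reach of Lebesgue differentiation.
-/
theorem mollify_eq_average {ε : ℝ} (h0 : 0 < ε) (f : ℝ × ℝ → ℝ) (u : ℝ × ℝ) :
    mollify ε f u = ⨍ w in Metric.closedBall (shrink ε u (1 / 4, 1 / 4)) (ε * (1 / 8)), f w := by
  have h1 := setIntegral_innerBall_comp_shrink h0 (fun _ => (1 : ℝ)) u
  rw [mollify, setAverage_eq, setAverage_eq, setIntegral_innerBall_comp_shrink h0]
  simp only [integral_const, smul_eq_mul, mul_one, MeasurableSet.univ, measureReal_restrict_apply,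
    Set.univ_inter] at h1
  rw [h1, smul_eq_mul, smul_eq_mul, mul_inv, inv_inv]
  field_simp

theorem continuous_mollify {ε : ℝ} (h0 : 0 < ε) {f : ℝ × ℝ → ℝ} (hf : Integrable f) :
    Continuous (mollify ε f) := by
  have h1 : mollify ε f = fun u => (volume.real innerBall)⁻¹ * ((ε ^ 2)⁻¹ *
      ∫ w in Metric.closedBall (shrink ε u (1 / 4, 1 / 4)) (ε * (1 / 8)), f w) := by
    ext u
    rw [mollify, setAverage_eq, setIntegral_innerBall_comp_shrink h0, smul_eq_mul]
  rw [h1]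
  have h2 := (continuous_setIntegral_closedBall hf (show 0 < ε * (1 / 8) by positivity)).comp
    (show Continuous fun u : ℝ × ℝ => shrink ε u (1 / 4, 1 / 4) by unfold shrink; fun_prop)
  exact (h2.const_mul _).const_mul _

theorem ae_tendsto_mollify {f : ℝ × ℝ → ℝ} (hf : Integrable f) {ε : ℕ → ℝ} (h0 : ∀ n, 0 < ε n)
    (h1 : Tendsto ε atTop (𝓝 0)) :
    ∀ᵐ u, u ∈ tri → Tendsto (fun n => mollify (ε n) f u) atTop (𝓝 (f u)) := by
  -- The balls are not centred at u: their centres are within ε of u while their radii are ε/8,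
  -- hence the dilation factor 8.
  filter_upwards [IsUnifLocDoublingMeasure.ae_tendsto_average (μ := (volume : Measure (ℝ × ℝ)))
    hf.locallyIntegrable 8] with u hu htri
  simp_rw [fun n => mollify_eq_average (h0 n) f u]
  refine hu _ _ ?_ (Eventually.of_forall fun n => ?_)
  · refine tendsto_nhdsWithin_iff.2 ⟨by simpa only [zero_mul] using h1.mul_const (1 / 8 : ℝ), Eventually.of_forall
      fun n => ?_⟩
    have := h0 n
    simp only [Set.mem_Ioi]; positivity
  · rw [Metric.mem_closedBall, shrink, Prod.dist_eq, Real.dist_eq, Real.dist_eq]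
    obtain ⟨a, b, c⟩ := htri
    have := h0 n
    simp only [Prod.fst_add, Prod.snd_add, Prod.smul_fst, Prod.smul_snd, smul_eq_mul]
    refine max_le ?_ ?_
    · rw [show u.1 - ((1 - ε n) * u.1 + ε n * (1 / 4)) = ε n * (u.1 - 1 / 4) by ring, abs_mul,
        abs_of_pos this]
      have : |u.1 - 1 / 4| ≤ 1 := abs_le.2 ⟨by linarith, by linarith⟩
      nlinarith
    · rw [show u.2 - ((1 - ε n) * u.2 + ε n * (1 / 4)) = ε n * (u.2 - 1 / 4) by ring, abs_mul,
        abs_of_pos this]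
      have : |u.2 - 1 / 4| ≤ 1 := abs_le.2 ⟨by linarith, by linarith⟩
      nlinarith

/-- The normalized area on the inner ball. -/
noncomputable def innerProb : Measure (ℝ × ℝ) :=
  (volume.restrict innerBall Set.univ)⁻¹ • volume.restrict innerBall

instance : IsProbabilityMeasure innerProb := by
  constructor
  have h1 : volume innerBall ≠ 0 := (Metric.measure_closedBall_pos _ _ (by norm_num)).ne'
  have h2 : volume innerBall ≠ ∞ := measure_closedBall_lt_top.ne
  simp [innerProb, ENNReal.inv_mul_cancel h1 h2]

theorem ae_innerProb_mem : ∀ᵐ z ∂innerProb, z ∈ innerBall :=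
  Measure.ae_smul_measure (ae_restrict_mem measurableSet_innerBall) _

theorem integrable_comp_shrink {ε : ℝ} (h0 : 0 < ε) {f : ℝ × ℝ → ℝ} (hf : Integrable f)
    (u : ℝ × ℝ) : Integrable (fun z => f (shrink ε u z)) innerProb := by
  have h1 : Integrable fun z => f (shrink ε u z) :=
    (hf.comp_add_left ((1 - ε) • u)).comp_smul h0.ne'
  refine Integrable.smul_measure h1.integrableOn ?_
  have h1 : volume innerBall ≠ 0 := (Metric.measure_closedBall_pos _ _ (by norm_num)).ne'
  simpa using h1

theorem lintegral_comp_shrink {ε : ℝ} (h1 : ε < 1) {k : ℝ × ℝ → ℝ≥0∞} (hk : Measurable k)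
    (z : ℝ × ℝ) : ∫⁻ u, k (shrink ε u z) = ENNReal.ofReal ((1 - ε) ^ 2)⁻¹ * ∫⁻ u, k u := by
  have h1' : 0 < 1 - ε := by linarith
  rw [← lintegral_add_right_eq_self k (ε • z)]
  have := lintegral_map (μ := (volume : Measure (ℝ × ℝ))) (f := fun w => k (w + ε • z))
    (g := fun u => (1 - ε) • u) (by fun_prop) (by fun_prop)
  rw [Measure.map_addHaar_smul _ h1'.ne', lintegral_smul_measure] at this
  simp only [shrink]
  rw [← this, smul_eq_mul]
  congr 2
  simp

theorem setLIntegral_comp_shrink_le {ε : ℝ} (h0 : 0 < ε) (h1 : ε < 1) {k : ℝ × ℝ → ℝ≥0∞}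
    (hk : Measurable k) {z : ℝ × ℝ} (hz : z ∈ innerBall) :
    ∫⁻ u in tri, k (shrink ε u z) ≤ ENNReal.ofReal ((1 - ε) ^ 2)⁻¹ * ∫⁻ u in tri, k u := by
  rw [← lintegral_indicator measurableSet_tri, ← lintegral_indicator measurableSet_tri,
    ← lintegral_comp_shrink h1 (hk.indicator measurableSet_tri) z]
  refine lintegral_mono fun u => ?_
  by_cases hu : u ∈ tri
  · simp [hu, shrink_mem_tri h0 h1 (tri_subset_ctri hu) hz]
  · simp [hu]

/-- Jensen in the sampling variable, Tonelli, and the Jacobian (1 - ε)² of the contraction. What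
matters is that the constant tends to 1 with ε, so that convergence of norms can be combined with
almost everywhere convergence. -/
theorem lpPow_mollify_le {p ε : ℝ} (hp : 1 ≤ p) (h0 : 0 < ε) (h1 : ε < 1) {f : ℝ × ℝ → ℝ}
    (hf : Measurable f) :
    lpPow p (mollify ε f) ≤ ENNReal.ofReal ((1 - ε) ^ 2)⁻¹ * lpPow p f := by
  calc lpPow p (mollify ε f)
      ≤ ∫⁻ u in tri, ∫⁻ z, ‖f (shrink ε u z)‖ₑ ^ p ∂innerProb :=
        lintegral_mono fun u => enorm_integral_rpow_le (μ := innerProb) hp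
          (g := fun z => f (shrink ε u z))
          (hf.comp ((measurable_shrink ε).comp measurable_prodMk_left))
    _ = ∫⁻ z, (∫⁻ u in tri, ‖f (shrink ε u z)‖ₑ ^ p) ∂innerProb :=
        lintegral_lintegral_swap (f := fun u z => ‖f (shrink ε u z)‖ₑ ^ p)
          (Measurable.aemeasurable (((hf.comp (measurable_shrink ε)).enorm).pow_const p))
    _ ≤ ∫⁻ _, ENNReal.ofReal ((1 - ε) ^ 2)⁻¹ * lpPow p f ∂innerProb :=
        lintegral_mono_ae (ae_innerProb_mem.mono fun z hz =>
          setLIntegral_comp_shrink_le h0 h1 (k := fun u => ‖f u‖ₑ ^ p) (by fun_prop) hz)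
    _ = _ := by simp

theorem edist_shrink_le {ε : ℝ} (h0 : 0 < ε) (h1 : ε < 1) (u v z : ℝ × ℝ) :
    edist (shrink ε u z) (shrink ε v z) ≤ edist u v := by
  rw [edist_dist, edist_dist]
  apply ENNReal.ofReal_le_ofReal
  rw [shrink, shrink, dist_add_right, dist_smul₀, Real.norm_of_nonneg (by linarith)]
  nlinarith [dist_nonneg (x := u) (y := v)]

/-- Both points are sampled with the same z, so their difference is only contracted and the kernel
can only grow. The Jacobian enters once for each point, whence its square, which still tends to 1.
-/
theorem slobPow_mollify_le {p q ε : ℝ} (hp : 1 ≤ p) (hq : 0 ≤ q) (h0 : 0 < ε) (h1 : ε < 1)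
    {f : ℝ × ℝ → ℝ} (hf : Measurable f) (hfi : Integrable f) :
    slobPow q p (mollify ε f) ≤ ENNReal.ofReal ((1 - ε) ^ 2)⁻¹ ^ 2 * slobPow q p f := by
  set b := ENNReal.ofReal ((1 - ε) ^ 2)⁻¹ with hb
  have hbfin : b ≠ ∞ := by simp [hb]
  set k : ℝ × ℝ → ℝ × ℝ → ℝ≥0∞ := fun u v => ‖f u - f v‖ₑ ^ p / edist u v ^ (q + 2) with hk
  have hkm : Measurable fun w : (ℝ × ℝ) × (ℝ × ℝ) => k w.1 w.2 := measurable_slob hf hf (q + 2) p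
  have hcomp : ∀ {γ : Type} [MeasurableSpace γ] {a c : γ → ℝ × ℝ}, Measurable a → Measurable c →
      Measurable fun x => k (a x) (c x) := fun ha hc => hkm.comp (ha.prodMk hc)
  have hstep : ∀ u v, ‖mollify ε f u - mollify ε f v‖ₑ ^ p / edist u v ^ (q + 2) ≤
      ∫⁻ z, k (shrink ε u z) (shrink ε v z) ∂innerProb := by
    intro u v
    have h2 : mollify ε f u - mollify ε f v =
        ∫ z, (f (shrink ε u z) - f (shrink ε v z)) ∂innerProb :=
      (integral_sub (integrable_comp_shrink h0 hfi u) (integrable_comp_shrink h0 hfi v)).symm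
    have hu : Measurable fun z => shrink ε u z := (measurable_shrink ε).comp measurable_prodMk_left
    have hv : Measurable fun z => shrink ε v z := (measurable_shrink ε).comp measurable_prodMk_left
    rw [h2, div_eq_mul_inv]
    refine (mul_le_mul_left (enorm_integral_rpow_le hp (by fun_prop)) _).trans ?_
    rw [← lintegral_mul_const _ (by fun_prop)]
    refine lintegral_mono fun z => ?_
    rw [← div_eq_mul_inv]
    exact div_rpow_le_div_rpow (by linarith) (edist_shrink_le h0 h1 u v z)
  have hm3 : Measurable fun w : (ℝ × ℝ) × (ℝ × ℝ) =>
      ∫⁻ v in tri, k (shrink ε w.1 w.2) (shrink ε v w.2) :=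
    Measurable.lintegral_prod_right' (f := fun y : ((ℝ × ℝ) × (ℝ × ℝ)) × (ℝ × ℝ) =>
      k (shrink ε y.1.1 y.1.2) (shrink ε y.2 y.1.2))
      (hcomp ((measurable_shrink ε).comp measurable_fst)
        ((measurable_shrink ε).comp (measurable_snd.prodMk (measurable_snd.comp measurable_fst))))
  calc slobPow q p (mollify ε f)
      ≤ ∫⁻ u in tri, ∫⁻ v in tri, ∫⁻ z, k (shrink ε u z) (shrink ε v z) ∂innerProb :=
        lintegral_mono fun u => lintegral_mono fun v => hstep u v
    _ = ∫⁻ u in tri, ∫⁻ z, (∫⁻ v in tri, k (shrink ε u z) (shrink ε v z)) ∂innerProb := by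
        refine lintegral_congr fun u => lintegral_lintegral_swap
          (f := fun v z => k (shrink ε u z) (shrink ε v z)) (Measurable.aemeasurable ?_)
        exact hcomp ((measurable_shrink ε).comp (measurable_const.prodMk measurable_snd))
          (measurable_shrink ε)
    _ = ∫⁻ z, (∫⁻ u in tri, ∫⁻ v in tri, k (shrink ε u z) (shrink ε v z)) ∂innerProb :=
        lintegral_lintegral_swap hm3.aemeasurable
    _ ≤ ∫⁻ _, b ^ 2 * slobPow q p f ∂innerProb := by
        refine lintegral_mono_ae (ae_innerProb_mem.mono fun z hz => ?_)
        calc ∫⁻ u in tri, ∫⁻ v in tri, k (shrink ε u z) (shrink ε v z)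
            ≤ ∫⁻ u in tri, b * ∫⁻ v in tri, k (shrink ε u z) v := by
              refine lintegral_mono fun u => ?_
              exact setLIntegral_comp_shrink_le h0 h1 (k := fun w => k (shrink ε u z) w)
                (hcomp measurable_const measurable_id) hz
          _ = b * ∫⁻ u in tri, ∫⁻ v in tri, k (shrink ε u z) v := lintegral_const_mul' _ _ hbfin
          _ ≤ b * (b * slobPow q p f) := by
              gcongr
              exact setLIntegral_comp_shrink_le h0 h1 (k := fun w => ∫⁻ v in tri, k w v)
                hkm.lintegral_prod_right' hz
          _ = _ := by ring
    _ = _ := by simp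

/-- The measure on pairs of points of the triangle behind the Slobodeckij seminorm. -/
noncomputable def slobMeas (q : ℝ) : Measure ((ℝ × ℝ) × (ℝ × ℝ)) :=
  ((volume.restrict tri).prod (volume.restrict tri)).withDensity
    fun z => (edist z.1 z.2 ^ (q + 2))⁻¹

theorem slobPow_eq_lintegral {q p : ℝ} {h : ℝ × ℝ → ℝ} (hh : Measurable h) :
    slobPow q p h = ∫⁻ z, ‖h z.1 - h z.2‖ₑ ^ p ∂slobMeas q := by
  have hm : Measurable fun z : (ℝ × ℝ) × (ℝ × ℝ) => edist z.1 z.2 := measurable_edist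
  rw [slobMeas, lintegral_withDensity_eq_lintegral_mul _ (by fun_prop) (by fun_prop),
    lintegral_prod _ (Measurable.aemeasurable (by fun_prop))]
  refine lintegral_congr fun u => lintegral_congr fun v => ?_
  simp only [Pi.mul_apply]
  rw [mul_comm, div_eq_mul_inv]

/-- **Density** of continuous functions in the Slobodeckij space on the triangle. -/
theorem exists_continuous_approx {q p : ℝ} (hq : 0 ≤ q) (hp : 1 ≤ p) {h : ℝ × ℝ → ℝ}
    (hh : Measurable h) (hL : lpPow p h ≠ ∞) (hS : slobPow q p h ≠ ∞) :
    ∃ φ : ℕ → ℝ × ℝ → ℝ, (∀ n, Continuous (φ n)) ∧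
      (∀ n, lpPow p (φ n) ≠ ∞ ∧ slobPow q p (φ n) ≠ ∞) ∧
      Tendsto (fun n => lpPow p (φ n - h)) atTop (𝓝 0) ∧
      Tendsto (fun n => slobPow q p (φ n - h)) atTop (𝓝 0) := by
  have hp0 : 0 < p := by linarith
  -- Extension by zero makes f integrable on the plane; its values outside the triangle are never
  -- sampled.
  set f := tri.indicator h with hf
  have hfm : Measurable f := hh.indicator measurableSet_tri
  have hft : ∀ u ∈ tri, f u = h u := fun u hu => Set.indicator_of_mem hu _
  have : IsFiniteMeasure (volume.restrict tri) := ⟨by simpa using volume_tri_lt_top⟩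
  have hfi : Integrable f := by
    rw [hf, integrable_indicator_iff measurableSet_tri]
    have : MemLp h (ENNReal.ofReal p) (volume.restrict tri) := by
      refine ⟨hh.aestronglyMeasurable, ?_⟩
      rw [eLpNorm_lt_top_iff_lintegral_rpow_enorm_lt_top (by simpa using hp0) (by simp),
        ENNReal.toReal_ofReal hp0.le]
      exact hL.lt_top
    exact (this.mono_exponent (by simpa using ENNReal.ofReal_le_ofReal hp)).integrable le_rfl
  have hLf : lpPow p f = lpPow p h :=
    setLIntegral_congr_fun measurableSet_tri fun u hu => by simp only [hft u hu]
  have hSf : slobPow q p f = slobPow q p h :=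
    setLIntegral_congr_fun measurableSet_tri fun u hu =>
      setLIntegral_congr_fun measurableSet_tri fun v hv => by simp only [hft u hu, hft v hv]
  set ε : ℕ → ℝ := fun n => 1 / ((n : ℝ) + 2) with hε
  have h0 : ∀ n, 0 < ε n := fun n => by simp only [hε]; positivity
  have h1 : ∀ n, ε n < 1 := fun n => by
    simp only [hε]
    rw [div_lt_one (by positivity)]
    have : (0 : ℝ) ≤ n := n.cast_nonneg
    linarith
  have hεlim : Tendsto ε atTop (𝓝 0) := by
    have := (tendsto_one_div_add_atTop_nhds_zero_nat (𝕜 := ℝ)).comp (tendsto_add_atTop_nat 1)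
    refine this.congr fun n => ?_
    simp only [Function.comp, hε]; push_cast; ring
  set b : ℕ → ℝ≥0∞ := fun n => ENNReal.ofReal ((1 - ε n) ^ 2)⁻¹ with hb
  have hblim : Tendsto b atTop (𝓝 1) := by
    have : Tendsto (fun n => ((1 - ε n) ^ 2)⁻¹) atTop (𝓝 1) := by
      have := (((tendsto_const_nhds (x := (1 : ℝ))).sub hεlim).pow 2).inv₀ (by norm_num)
      simpa using this
    simpa using ENNReal.tendsto_ofReal this
  have hb2lim : Tendsto (fun n => b n ^ 2) atTop (𝓝 1) := by
    simpa [Function.comp_def] using ((ENNReal.continuous_pow 2).tendsto 1).comp hblim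
  have hcont : ∀ n, Continuous (mollify (ε n) f) := fun n => continuous_mollify (h0 n) hfi
  have hLle : ∀ n, lpPow p (mollify (ε n) f) ≤ b n * lpPow p f := fun n =>
    lpPow_mollify_le hp (h0 n) (h1 n) hfm
  have hSle : ∀ n, slobPow q p (mollify (ε n) f) ≤ b n ^ 2 * slobPow q p f := fun n =>
    slobPow_mollify_le hp hq (h0 n) (h1 n) hfm hfi
  have hbfin : ∀ n, b n ≠ ∞ := fun n => by simp [hb]
  have hae : ∀ᵐ u ∂(volume.restrict tri),
      Tendsto (fun n => mollify (ε n) f u) atTop (𝓝 (f u)) :=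
    (ae_restrict_iff' measurableSet_tri).2 (ae_tendsto_mollify hfi h0 hεlim)
  refine ⟨fun n => mollify (ε n) f, hcont, fun n => ⟨ne_top_of_le_ne_top
    (ENNReal.mul_ne_top (hbfin n) (hLf ▸ hL)) (hLle n), ne_top_of_le_ne_top
    (ENNReal.mul_ne_top (ENNReal.pow_ne_top (hbfin n)) (hSf ▸ hS)) (hSle n)⟩, ?_, ?_⟩
  · have := tendsto_lintegral_enorm_sub_rpow hp hfm (fun n => (hcont n).measurable) hae
      (hLf.trans_ne hL) hblim hLle
    refine this.congr fun n => ?_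
    exact setLIntegral_congr_fun measurableSet_tri fun u hu => by simp only [Pi.sub_apply, hft u hu]
  -- The seminorm is the L^p norm of the difference function on pairs with respect to `slobMeas`, so
  -- the same convergence lemma applies there.
  · have hae2 : ∀ᵐ z ∂slobMeas q, Tendsto (fun n => mollify (ε n) f z.1 - mollify (ε n) f z.2)
        atTop (𝓝 (f z.1 - f z.2)) := by
      refine (withDensity_absolutelyContinuous _ _).ae_le ?_
      filter_upwards [Measure.quasiMeasurePreserving_fst.ae hae,
        Measure.quasiMeasurePreserving_snd.ae hae] with z hz1 hz2 using hz1.sub hz2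
    have hG : ∀ n, Measurable fun z : (ℝ × ℝ) × (ℝ × ℝ) =>
        mollify (ε n) f z.1 - mollify (ε n) f z.2 := fun n =>
      ((hcont n).measurable.comp measurable_fst).sub ((hcont n).measurable.comp measurable_snd)
    have := tendsto_lintegral_enorm_sub_rpow (μ := slobMeas q) hp
      (g := fun z : (ℝ × ℝ) × (ℝ × ℝ) => f z.1 - f z.2)
      (by fun_prop) hG hae2
      (by rw [← slobPow_eq_lintegral hfm, hSf]; exact hS) hb2lim
      (fun n => by
        rw [← slobPow_eq_lintegral hfm, ← slobPow_eq_lintegral (hcont n).measurable]; exact hSle n)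
    refine this.congr fun n => ?_
    have h3 : slobPow q p (mollify (ε n) f - h) = slobPow q p (mollify (ε n) f - f) :=
      setLIntegral_congr_fun measurableSet_tri fun u hu =>
        setLIntegral_congr_fun measurableSet_tri fun v hv => by
          simp only [Pi.sub_apply, hft u hu, hft v hv]
    rw [h3, slobPow_eq_lintegral ((hcont n).measurable.sub hfm)]
    refine lintegral_congr fun z => ?_
    simp only [Pi.sub_apply]
    congr 2; ring

/-! ### Traces on the bottom edge of the triangle -/

theorem hardyPow_add_le {q p : ℝ} (hp : 1 ≤ p) {f g : ℝ × ℝ → ℝ} (hf : Measurable f) :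
    hardyPow q p (f + g) ≤ 2 ^ (p - 1) * (hardyPow q p f + hardyPow q p g) := by
  rw [hardyPow, hardyPow, hardyPow, ← lintegral_add_left (by fun_prop),
    ← lintegral_const_mul' _ _ (two_rpow_lt_top _).ne]
  refine lintegral_mono fun u => ?_
  rw [← ENNReal.add_div, ← mul_div_assoc]
  gcongr
  simpa using enorm_sub_rpow_le hp (f u) 0 (-g u)

theorem hardyPow_neg {q p : ℝ} {f : ℝ × ℝ → ℝ} : hardyPow q p (-f) = hardyPow q p f := by
  simp [hardyPow]

theorem lpPow_add_le {p : ℝ} (hp : 1 ≤ p) {f g : ℝ × ℝ → ℝ} (hf : Measurable f) :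
    lpPow p (f + g) ≤ 2 ^ (p - 1) * (lpPow p f + lpPow p g) := by
  rw [lpPow, lpPow, lpPow, ← lintegral_add_left (by fun_prop),
    ← lintegral_const_mul' _ _ (two_rpow_lt_top _).ne]
  refine lintegral_mono fun u => ?_
  simpa using enorm_sub_rpow_le hp (f u) 0 (-g u)

theorem lpPow_neg {p : ℝ} {f : ℝ × ℝ → ℝ} : lpPow p (-f) = lpPow p f := by
  simp [lpPow]

theorem slobPow_add_le {q p : ℝ} (hp : 1 ≤ p) {f g : ℝ × ℝ → ℝ} (hf : Measurable f)
    (hg : Measurable g) :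
    slobPow q p (f + g) ≤ 2 ^ (p - 1) * (slobPow q p f + slobPow q p g) := by
  rw [slobPow_eq_lintegral hf, slobPow_eq_lintegral hg, slobPow_eq_lintegral (hf.add hg),
    ← lintegral_add_left (by fun_prop), ← lintegral_const_mul' _ _ (two_rpow_lt_top _).ne]
  refine lintegral_mono fun z => ?_
  have := enorm_sub_rpow_le hp (f z.1 - f z.2) 0 (-(g z.1 - g z.2))
  simp only [sub_zero, zero_sub, neg_neg] at this
  refine le_trans (le_of_eq ?_) this
  simp only [Pi.add_apply]
  congr 2; ring

theorem slobPow_neg {q p : ℝ} {f : ℝ × ℝ → ℝ} : slobPow q p (-f) = slobPow q p f := by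
  unfold slobPow
  congr! 5 with u v
  rw [Pi.neg_apply, Pi.neg_apply, ← neg_sub', enorm_neg]

theorem eLpNorm_ofReal_eq {α : Type*} [MeasurableSpace α] {μ : Measure α} {p : ℝ} (hp : 0 < p)
    (g : α → ℝ) : eLpNorm g (ENNReal.ofReal p) μ = (∫⁻ x, ‖g x‖ₑ ^ p ∂μ) ^ (1 / p) := by
  rw [eLpNorm_eq_lintegral_rpow_enorm_toReal (by simpa using hp) (by simp),
    ENNReal.toReal_ofReal hp.le]

theorem tendsto_rpow_zero_iff {ι : Type*} {l : Filter ι} {r : ℝ} (hr : 0 < r) {a : ι → ℝ≥0∞} :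
    Tendsto (fun n => a n ^ r) l (𝓝 0) ↔ Tendsto a l (𝓝 0) := by
  constructor
  · intro h
    have := (ENNReal.continuous_rpow_const (y := 1 / r)).tendsto 0 |>.comp h
    simpa [Function.comp_def, ← ENNReal.rpow_mul, hr.ne', hr] using this
  · intro h
    have := (ENNReal.continuous_rpow_const (y := r)).tendsto 0 |>.comp h
    simpa [Function.comp_def, hr] using this

/-- `τ` is the trace of `h` on the bottom edge of the triangle. -/
def IsBottomTrace (q p : ℝ) (h : ℝ × ℝ → ℝ) (τ : ℝ → ℝ) : Prop :=
  ∃ φ : ℕ → ℝ × ℝ → ℝ, (∀ n, Measurable (φ n) ∧ ContinuousOn (φ n) ctri) ∧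
    Tendsto (fun n => lpPow p (φ n - h)) atTop (𝓝 0) ∧
    Tendsto (fun n => slobPow q p (φ n - h)) atTop (𝓝 0) ∧
    Tendsto (fun n => ∫⁻ x in Set.Ioo (0 : ℝ) 1, ‖φ n (x, 0) - τ x‖ₑ ^ p) atTop (𝓝 0)

theorem setLIntegral_tri_comp_fst_le {k : ℝ → ℝ≥0∞} (hk : Measurable k) :
    ∫⁻ u in tri, k u.1 ≤ ∫⁻ x in Set.Ioo (0 : ℝ) 1, k x := by
  have hsub : tri ⊆ Set.Ioo 0 1 ×ˢ Set.Ioo 0 1 := by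
    rintro u ⟨a, b, c⟩
    exact ⟨⟨a, by linarith⟩, b, by linarith⟩
  refine (lintegral_mono_set hsub).trans ?_
  rw [Measure.volume_eq_prod, ← Measure.prod_restrict, lintegral_prod _ (by fun_prop)]
  simp

/-- **Hardy's inequality** in the supercritical range for a function minus its trace. -/
theorem exists_hardyPow_sub_trace_le {q p : ℝ} (hq1 : 1 < q) (hp : 1 < p) :
    ∃ C : ℝ≥0∞, C < ∞ ∧ ∀ (h : ℝ × ℝ → ℝ) (τ : ℝ → ℝ), Measurable h → Measurable τ →
      IsBottomTrace q p h τ → hardyPow q p (fun u => h u - τ u.1) ≤ C * slobPow q p h := by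
  obtain ⟨C, hC, hle⟩ := exists_hardyPow_sub_bottom_le hq1 hp
  have hq : 0 ≤ q := by linarith
  set K : ℝ≥0∞ := 2 ^ (p - 1) with hK
  have hKfin : K ≠ ∞ := (two_rpow_lt_top _).ne
  refine ⟨K * K * C * K, ENNReal.mul_lt_top (ENNReal.mul_lt_top (ENNReal.mul_lt_top hKfin.lt_top
    hKfin.lt_top) hC) hKfin.lt_top, ?_⟩
  rintro h τ hh hτ ⟨φ, hφ, hL, hS, hT⟩
  -- On heights above ε the weight is at most E, so the L^p errors of φ n and of its boundary values
  -- vanish in the limit. The term that survives carries a constant independent of ε.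
  refine setLIntegral_le_of_forall_pos (fun u hu => hu.2.1) fun ε hε => ?_
  set E : ℝ≥0∞ := (ENNReal.ofReal ε ^ q)⁻¹ with hE
  have hEfin : E ≠ ∞ := by simp [hE, hε]
  set Tε := tri ∩ {u | ε < u.2} with hTε
  have hTm : MeasurableSet Tε :=
    measurableSet_tri.inter (measurableSet_lt measurable_const measurable_snd)
  have hbound : ∀ n, ∫⁻ u in Tε, ‖h u - τ u.1‖ₑ ^ p / ENNReal.ofReal u.2 ^ q ≤
      K * (E * lpPow p (φ n - h)) + K * (K * (C * (K * (slobPow q p (φ n - h) + slobPow q p h)) +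
        E * ∫⁻ x in Set.Ioo (0 : ℝ) 1, ‖φ n (x, 0) - τ x‖ₑ ^ p)) := by
    intro n
    have hφm := (hφ n).1
    have hφb : Measurable fun x : ℝ => φ n (x, 0) := hφm.comp (by fun_prop)
    have hpt : ∀ u ∈ Tε, ‖h u - τ u.1‖ₑ ^ p / ENNReal.ofReal u.2 ^ q ≤
        K * (E * ‖(φ n - h) u‖ₑ ^ p) + K * (K * (‖φ n u - φ n (u.1, 0)‖ₑ ^ p /
          ENNReal.ofReal u.2 ^ q + E * ‖φ n (u.1, 0) - τ u.1‖ₑ ^ p)) := by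
      intro u hu
      have hu2 : ε < u.2 := hu.2
      have hdiv : ∀ a : ℝ≥0∞, a / ENNReal.ofReal u.2 ^ q ≤ E * a := by
        intro a
        rw [hE, mul_comm, ← div_eq_mul_inv]
        exact div_rpow_le_div_rpow hq (ENNReal.ofReal_le_ofReal hu2.le)
      have h1 := enorm_sub_rpow_le hp.le (h u) (φ n u) (τ u.1)
      have h2 := enorm_sub_rpow_le hp.le (φ n u) (φ n (u.1, 0)) (τ u.1)
      calc _ ≤ K * (‖h u - φ n u‖ₑ ^ p + K * (‖φ n u - φ n (u.1, 0)‖ₑ ^ p +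
              ‖φ n (u.1, 0) - τ u.1‖ₑ ^ p)) / ENNReal.ofReal u.2 ^ q := by
            gcongr
            exact h1.trans (by gcongr)
        _ = K * (‖h u - φ n u‖ₑ ^ p / ENNReal.ofReal u.2 ^ q) + K * (K *
              (‖φ n u - φ n (u.1, 0)‖ₑ ^ p / ENNReal.ofReal u.2 ^ q +
              ‖φ n (u.1, 0) - τ u.1‖ₑ ^ p / ENNReal.ofReal u.2 ^ q)) := by
            simp only [div_eq_mul_inv]; ring
        _ ≤ _ := by
            rw [enorm_sub_rev (h u)]
            gcongr
            · exact hdiv _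
            · exact hdiv _
    have hmono : ∀ k : ℝ × ℝ → ℝ≥0∞, ∫⁻ u in Tε, k u ≤ ∫⁻ u in tri, k u := fun k =>
      lintegral_mono_set Set.inter_subset_left
    have hS1 : slobPow q p (φ n) ≤ K * (slobPow q p (φ n - h) + slobPow q p h) := by
      simpa using slobPow_add_le (q := q) hp.le (hφm.sub hh) hh
    calc _ ≤ ∫⁻ u in Tε, (K * (E * ‖(φ n - h) u‖ₑ ^ p) + K * (K * (‖φ n u - φ n (u.1, 0)‖ₑ ^ p /
          ENNReal.ofReal u.2 ^ q + E * ‖φ n (u.1, 0) - τ u.1‖ₑ ^ p))) :=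
          setLIntegral_mono_ae' hTm (Eventually.of_forall hpt)
      _ ≤ ∫⁻ u in tri, (K * (E * ‖(φ n - h) u‖ₑ ^ p) + K * (K * (‖φ n u - φ n (u.1, 0)‖ₑ ^ p /
          ENNReal.ofReal u.2 ^ q + E * ‖φ n (u.1, 0) - τ u.1‖ₑ ^ p))) := hmono _
      _ = K * (E * lpPow p (φ n - h)) + K * (K * (hardyPow q p (fun u => φ n u - φ n (u.1, 0)) +
          E * ∫⁻ u in tri, ‖φ n (u.1, 0) - τ u.1‖ₑ ^ p)) := by
          rw [lintegral_add_left (by fun_prop), lintegral_const_mul' _ _ hKfin,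
            lintegral_const_mul' _ _ hEfin, lintegral_const_mul' _ _ hKfin,
            lintegral_const_mul' _ _ hKfin, lintegral_add_left (by fun_prop),
            lintegral_const_mul' _ _ hEfin]
          rfl
      _ ≤ _ := by
          gcongr
          · exact (hle _ hφm (hφ n).2).trans (by gcongr)
          · exact setLIntegral_tri_comp_fst_le (k := fun x => ‖φ n (x, 0) - τ x‖ₑ ^ p) (by fun_prop)
  have hlim : Tendsto (fun n => K * (E * lpPow p (φ n - h)) + K * (K * (C * (K *
      (slobPow q p (φ n - h) + slobPow q p h)) +
        E * ∫⁻ x in Set.Ioo (0 : ℝ) 1, ‖φ n (x, 0) - τ x‖ₑ ^ p))) atTop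
      (𝓝 (K * (E * 0) + K * (K * (C * (K * (0 + slobPow q p h)) + E * 0)))) := by
    have cm : ∀ {c b : ℝ≥0∞} {a : ℕ → ℝ≥0∞}, c ≠ ∞ → Tendsto a atTop (𝓝 b) →
        Tendsto (fun n => c * a n) atTop (𝓝 (c * b)) := fun hc ha =>
      ENNReal.Tendsto.const_mul ha (Or.inr hc)
    exact (cm hKfin (cm hEfin hL)).add (cm hKfin (cm hKfin ((cm hC.ne (cm hKfin
      (hS.add_const _))).add (cm hEfin hT))))
  refine (ge_of_tendsto' hlim hbound).trans (le_of_eq ?_)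
  simp only [mul_zero, zero_add, add_zero]
  ring

/-- Existence of traces. -/
theorem exists_isBottomTrace {q p : ℝ} (hq1 : 1 < q) (hp : 1 < p) {h : ℝ × ℝ → ℝ}
    (hh : Measurable h) (hL : lpPow p h ≠ ∞) (hS : slobPow q p h ≠ ∞) :
    ∃ (φ : ℕ → ℝ × ℝ → ℝ) (τ : ℝ → ℝ), Measurable τ ∧ (∀ n, Continuous (φ n)) ∧
      (∀ n, lpPow p (φ n) ≠ ∞ ∧ slobPow q p (φ n) ≠ ∞) ∧
      ∫⁻ x in Set.Ioo (0 : ℝ) 1, ‖τ x‖ₑ ^ p ≠ ∞ ∧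
      Tendsto (fun n => lpPow p (φ n - h)) atTop (𝓝 0) ∧
      Tendsto (fun n => slobPow q p (φ n - h)) atTop (𝓝 0) ∧
      Tendsto (fun n => ∫⁻ x in Set.Ioo (0 : ℝ) 1, ‖φ n (x, 0) - τ x‖ₑ ^ p) atTop (𝓝 0) := by
  have hp0 : 0 < p := by linarith
  obtain ⟨C, hC, hle⟩ := exists_trace_le hq1 hp
  obtain ⟨φ, hφ, hfin, hL', hS'⟩ := exists_continuous_approx (by linarith : 0 ≤ q) hp.le hh hL hS
  set μ := (volume : Measure ℝ).restrict (Set.Ioo 0 1) with hμ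
  set b : ℕ → ℝ → ℝ := fun n x => φ n (x, 0) with hb
  have hbc : ∀ n, Continuous (b n) := fun n => (hφ n).comp (by fun_prop)
  have : Fact (1 ≤ ENNReal.ofReal p) := ⟨by simpa using ENNReal.ofReal_le_ofReal hp.le⟩
  have hbL : ∀ n, MemLp (b n) (ENNReal.ofReal p) μ := by
    intro n
    refine ⟨(hbc n).aestronglyMeasurable, ?_⟩
    rw [eLpNorm_ofReal_eq hp0]
    refine ENNReal.rpow_lt_top_of_nonneg (by positivity) (ne_top_of_le_ne_top ?_
      (hle (φ n) (hφ n).measurable (hφ n).continuousOn))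
    exact ENNReal.mul_ne_top hC.ne (ENNReal.add_ne_top.2 (hfin n))
  set F : ℕ → Lp ℝ (ENNReal.ofReal p) μ := fun n => (hbL n).toLp (b n) with hF
  -- The trace inequality applied to φ n - φ m bounds the difference of boundary values by the
  -- distances of φ n and φ m to h.
  have hcauchy : CauchySeq F := by
    rw [Lp.cauchySeq_Lp_iff_cauchySeq_eLpNorm]
    have h1 : ∀ nm : ℕ × ℕ, eLpNorm (⇑(F nm.1) - ⇑(F nm.2)) (ENNReal.ofReal p) μ =
        (∫⁻ x, ‖(φ nm.1 - φ nm.2) (x, 0)‖ₑ ^ p ∂μ) ^ (1 / p) := by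
      intro nm
      rw [eLpNorm_congr_ae ((hbL nm.1).coeFn_toLp.sub (hbL nm.2).coeFn_toLp), eLpNorm_ofReal_eq hp0]
      rfl
    simp_rw [h1]
    rw [tendsto_rpow_zero_iff (by positivity)]
    have hdiff : ∀ n m, φ n - φ m = (φ n - h) + -(φ m - h) := fun n m => by
      ext u; simp
    have h2 : ∀ nm : ℕ × ℕ, ∫⁻ x, ‖(φ nm.1 - φ nm.2) (x, 0)‖ₑ ^ p ∂μ ≤
        C * (2 ^ (p - 1) * (lpPow p (φ nm.1 - h) + lpPow p (φ nm.2 - h)) +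
          2 ^ (p - 1) * (slobPow q p (φ nm.1 - h) + slobPow q p (φ nm.2 - h))) := by
      intro nm
      have hm1 := (hφ nm.1).measurable.sub hh
      have hm2 := (hφ nm.2).measurable.sub hh
      refine (hle _ ((hφ nm.1).sub (hφ nm.2)).measurable
        ((hφ nm.1).sub (hφ nm.2)).continuousOn).trans ?_
      rw [hdiff]
      gcongr
      · refine (lpPow_add_le hp.le hm1).trans_eq ?_
        rw [lpPow_neg]
      · refine (slobPow_add_le hp.le hm1 hm2.neg).trans_eq ?_
        rw [slobPow_neg]
    refine tendsto_of_tendsto_of_tendsto_of_le_of_le tendsto_const_nhds ?_ (fun _ => zero_le) h2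
    have t1 : Tendsto (fun nm : ℕ × ℕ => nm.1) atTop atTop := by
      rw [← prod_atTop_atTop_eq]; exact tendsto_fst
    have t2 : Tendsto (fun nm : ℕ × ℕ => nm.2) atTop atTop := by
      rw [← prod_atTop_atTop_eq]; exact tendsto_snd
    have k2 : (2 : ℝ≥0∞) ^ (p - 1) ≠ ∞ := (two_rpow_lt_top _).ne
    have := ENNReal.Tendsto.const_mul ((ENNReal.Tendsto.const_mul ((hL'.comp t1).add (hL'.comp t2))
      (Or.inr k2)).add (ENNReal.Tendsto.const_mul ((hS'.comp t1).add (hS'.comp t2)) (Or.inr k2)))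
      (Or.inr hC.ne)
    simpa using this
  obtain ⟨Φ, hΦ⟩ := cauchySeq_tendsto_of_complete hcauchy
  set τ := (Lp.aestronglyMeasurable Φ).mk Φ with hτ
  have hτm : Measurable τ := (Lp.aestronglyMeasurable Φ).stronglyMeasurable_mk.measurable
  have hτae : ⇑Φ =ᵐ[μ] τ := (Lp.aestronglyMeasurable Φ).ae_eq_mk
  have hτL : MemLp τ (ENNReal.ofReal p) μ := (memLp_congr_ae hτae).1 (Lp.memLp Φ)
  refine ⟨φ, τ, hτm, hφ, hfin, ?_, hL', hS', ?_⟩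
  · have := hτL.2
    rw [eLpNorm_ofReal_eq hp0] at this
    intro h
    rw [h, ENNReal.top_rpow_of_pos (by positivity)] at this
    exact this.ne rfl
  · rw [Lp.tendsto_Lp_iff_tendsto_eLpNorm'] at hΦ
    rw [← tendsto_rpow_zero_iff (show 0 < 1 / p by positivity)]
    refine hΦ.congr fun n => ?_
    rw [eLpNorm_congr_ae ((hbL n).coeFn_toLp.sub hτae), eLpNorm_ofReal_eq hp0]
    rfl

/-- A function of the edge variable alone is unchanged by `halve`, so its Hardy integral is at most
2^(1 - q) < 1 times itself; being finite, it is 0. Fubini then gives vanishing on the edge, since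
every vertical fibre has positive length. -/
theorem ae_eq_zero_of_hardyPow_lt_top {q p : ℝ} (hq1 : 1 < q) (hp : 0 < p) {κ : ℝ → ℝ}
    (hκ : Measurable κ) (h : hardyPow q p (fun u => κ u.1) < ∞) :
    ∀ᵐ x ∂volume.restrict (Set.Ioo (0 : ℝ) 1), κ x = 0 := by
  have hq : 0 ≤ q := by linarith
  have hm : Measurable fun u : ℝ × ℝ => κ u.1 := by fun_prop
  have h1 : hardyPow q p (fun u => κ u.1) ≤ ENNReal.ofReal (2 ^ (1 - q)) *
      hardyPow q p (fun u => κ u.1) := hardyPow_comp_halve_le hq hm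
  have h0 : hardyPow q p (fun u => κ u.1) = 0 := by
    by_contra h0
    have hc1 : ENNReal.ofReal ((2 : ℝ) ^ (1 - q)) < 1 := by
      rw [ENNReal.ofReal_lt_one]
      exact Real.rpow_lt_one_of_one_lt_of_neg (by norm_num) (by linarith)
    have := ENNReal.mul_lt_mul_left h0 h.ne hc1
    rw [one_mul] at this
    exact absurd h1 (not_le.2 this)
  rw [hardyPow, lintegral_eq_zero_iff (by fun_prop)] at h0
  have h2 : ∀ᵐ u ∂(volume : Measure (ℝ × ℝ)), u ∈ tri → κ u.1 = 0 := by
    rw [← ae_restrict_iff' measurableSet_tri]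
    filter_upwards [h0] with u hu
    have h3 : ENNReal.ofReal u.2 ^ q ≠ ∞ := ENNReal.rpow_ne_top_of_nonneg hq (by simp)
    simpa [h3, hp, hp.not_gt] using hu
  rw [Measure.volume_eq_prod] at h2
  rw [ae_restrict_iff' measurableSet_Ioo]
  filter_upwards [Measure.ae_ae_of_ae_prod h2] with x hx hx01
  by_contra hne
  have h4 : ∀ᵐ y ∂(volume : Measure ℝ), y ∉ Set.Ioo 0 (1 - x) := by
    filter_upwards [hx] with y hy hy'
    exact hne (hy ⟨hx01.1, hy'.1, by have := hy'.2; simp only; linarith⟩)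
  have h5 : volume (Set.Ioo 0 (1 - x)) = 0 := measure_eq_zero_iff_ae_notMem.2 h4
  rw [Real.volume_Ioo, ENNReal.ofReal_eq_zero] at h5
  linarith [hx01.2]

/-- Functions with equal traces differ by a function with finite Hardy integral. -/
theorem exists_hardyPow_sub_le_of_trace {q p : ℝ} (hq1 : 1 < q) (hp : 1 < p) :
    ∃ C : ℝ≥0∞, C < ∞ ∧ ∀ (f g : ℝ × ℝ → ℝ) (τ σ : ℝ → ℝ), Measurable f → Measurable g →
      Measurable τ → Measurable σ → IsBottomTrace q p f τ → IsBottomTrace q p g σ →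
      (∀ᵐ x ∂volume.restrict (Set.Ioo (0 : ℝ) 1), τ x = σ x) →
      hardyPow q p (f - g) ≤ C * (slobPow q p f + slobPow q p g) := by
  obtain ⟨C, hC, hle⟩ := exists_hardyPow_sub_trace_le hq1 hp
  refine ⟨2 ^ (p - 1) * C, ENNReal.mul_lt_top (two_rpow_lt_top _) hC, ?_⟩
  rintro f g τ σ hf hg hτ - hfτ ⟨φ, hφ, hL, hS, hT⟩ hae
  have hgτ : IsBottomTrace q p g τ := by
    refine ⟨φ, hφ, hL, hS, hT.congr fun n => lintegral_congr_ae ?_⟩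
    filter_upwards [hae] with x hx
    rw [hx]
  set a : ℝ × ℝ → ℝ := fun u => f u - τ u.1 with ha
  set b : ℝ × ℝ → ℝ := fun u => g u - τ u.1 with hb
  have ham : Measurable a := by fun_prop
  have h1 : f - g = a + -b := by
    ext u; simp only [Pi.add_apply, Pi.sub_apply, Pi.neg_apply, ha, hb]; ring
  calc hardyPow q p (f - g) ≤ 2 ^ (p - 1) * (hardyPow q p a + hardyPow q p (-b)) := by
        rw [h1]; exact hardyPow_add_le hp.le ham
    _ ≤ 2 ^ (p - 1) * (C * slobPow q p f + C * slobPow q p g) := by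
        rw [hardyPow_neg]
        gcongr
        · exact hle f τ hf hτ hfτ
        · exact hle g τ hg hτ hgτ
    _ = _ := by ring

/-- Functions with finite traces whose difference has a finite Hardy integral have equal traces. -/
theorem ae_eq_of_hardyPow_sub_lt_top {q p : ℝ} (hq1 : 1 < q) (hp : 1 < p) {f g : ℝ × ℝ → ℝ}
    {τ σ : ℝ → ℝ} (hf : Measurable f) (hg : Measurable g) (hτ : Measurable τ) (hσ : Measurable σ)
    (hfτ : IsBottomTrace q p f τ) (hgσ : IsBottomTrace q p g σ) (hfS : slobPow q p f ≠ ∞)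
    (hgS : slobPow q p g ≠ ∞) (hfg : hardyPow q p (f - g) ≠ ∞) :
    ∀ᵐ x ∂volume.restrict (Set.Ioo (0 : ℝ) 1), τ x = σ x := by
  obtain ⟨C, hC, hle⟩ := exists_hardyPow_sub_trace_le hq1 hp
  have h1 := (hle f τ hf hτ hfτ).trans_lt (ENNReal.mul_lt_top hC hfS.lt_top)
  have h2 := (hle g σ hg hσ hgσ).trans_lt (ENNReal.mul_lt_top hC hgS.lt_top)
  set a : ℝ × ℝ → ℝ := fun u => f u - τ u.1 with ha
  set b : ℝ × ℝ → ℝ := fun u => g u - σ u.1 with hb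
  have ham : Measurable a := by fun_prop
  have hbm : Measurable b := by fun_prop
  have k2 := two_rpow_lt_top (p - 1)
  -- Adding -(f - τ) + (g - σ) to f - g leaves τ - σ, a function of the edge variable alone.
  have h3 : hardyPow q p (-a + b) < ∞ := by
    refine (hardyPow_add_le hp.le ham.neg).trans_lt (ENNReal.mul_lt_top k2 ?_)
    rw [hardyPow_neg]
    exact ENNReal.add_lt_top.2 ⟨h1, h2⟩
  have h4 : hardyPow q p ((f - g) + (-a + b)) < ∞ :=
    (hardyPow_add_le hp.le (hf.sub hg)).trans_lt (ENNReal.mul_lt_top k2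
      (ENNReal.add_lt_top.2 ⟨hfg.lt_top, h3⟩))
  have h5 : (f - g) + (-a + b) = fun u => (τ - σ) u.1 := by
    ext u; simp only [Pi.add_apply, Pi.sub_apply, Pi.neg_apply, ha, hb]; ring
  rw [h5] at h4
  filter_upwards [ae_eq_zero_of_hardyPow_lt_top hq1 (by linarith) (hτ.sub hσ) h4] with x hx
  simpa [sub_eq_zero] using hx

/-! ### Parametrization of the faces and of the edges -/

theorem convex_ctri : Convex ℝ ctri := by
  rintro u ⟨a, b, c⟩ v ⟨d, e, f⟩ s t hs ht hst
  refine ⟨?_, ?_, ?_⟩ <;> simp only [Prod.fst_add, Prod.snd_add, Prod.smul_fst, Prod.smul_snd,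
    smul_eq_mul]
  · positivity
  · positivity
  · have := mul_le_mul_of_nonneg_left c hs
    have := mul_le_mul_of_nonneg_left f ht
    linarith

theorem convex_tri : Convex ℝ tri := by
  rintro u ⟨a, b, c⟩ v ⟨d, e, f⟩ s t hs ht hst
  refine ⟨?_, ?_, ?_⟩ <;> simp only [Prod.fst_add, Prod.snd_add, Prod.smul_fst, Prod.smul_snd,
    smul_eq_mul] <;> rcases hs.eq_or_lt with rfl | hs
  · simp_all
  · have := mul_pos hs a
    have := mul_nonneg ht d.le
    linarith
  · simp_all
  · have := mul_pos hs b
    have := mul_nonneg ht e.le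
    linarith
  · simp_all
  · have := mul_lt_mul_of_pos_left c hs
    have := mul_le_mul_of_nonneg_left f.le ht
    linarith

theorem ctri_subset_closure_tri : ctri ⊆ closure tri := by
  intro u hu
  have hc : ((1 / 4, 1 / 4) : ℝ × ℝ) ∈ innerBall := Metric.mem_closedBall_self (by norm_num)
  have hlim : Tendsto (fun n : ℕ => shrink (1 / ((n : ℝ) + 2)) u (1 / 4, 1 / 4)) atTop (𝓝 u) := by
    have h1 : Tendsto (fun n : ℕ => 1 / ((n : ℝ) + 2)) atTop (𝓝 0) := by
      have := (tendsto_one_div_add_atTop_nhds_zero_nat (𝕜 := ℝ)).comp (tendsto_add_atTop_nat 1)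
      refine this.congr fun n => ?_
      simp only [Function.comp]; push_cast; ring
    have h2 : Continuous fun ε : ℝ => shrink ε u (1 / 4, 1 / 4) := by unfold shrink; fun_prop
    simpa [shrink, Function.comp_def] using (h2.tendsto 0).comp h1
  refine mem_closure_of_tendsto hlim (Eventually.of_forall fun n => ?_)
  refine shrink_mem_tri (by positivity) ?_ hu hc
  rw [div_lt_one (by positivity)]
  have : (0 : ℝ) ≤ n := n.cast_nonneg
  linarith

/-- The closed triangle adds only part of the frontier of a convex set, which is null. Thus closed
faces can be integrated over the open triangle. -/
theorem restrict_ctri : (volume : Measure (ℝ × ℝ)).restrict ctri = volume.restrict tri := by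
  refine Measure.restrict_congr_set (EventuallyLE.antisymm ?_
    (LE.le.eventuallyLE tri_subset_ctri))
  have h0 : volume (frontier tri) = 0 := convex_tri.addHaar_frontier volume
  filter_upwards [compl_mem_ae_iff.2 h0] with u hu huc
  by_contra hut
  refine hu ⟨ctri_subset_closure_tri huc, ?_⟩
  rwa [isOpen_tri.interior_eq]

/-- The linear map spanned by the common edge and the two transversal edges of two faces. -/
noncomputable def frame (i j : Fin 4) : ℝ × ℝ × ℝ →ₗ[ℝ] E3 where
  toFun w := w.1 • (vertex (edgeEnd i j) - vertex (edgeStart i j)) +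
    w.2.1 • (vertex j - vertex (edgeStart i j)) - w.2.2 • (vertex i - vertex (edgeStart i j))
  map_add' x y := by simp only [Prod.fst_add, Prod.snd_add]; module
  map_smul' c x := by
    simp only [Prod.smul_fst, Prod.smul_snd, smul_eq_mul, RingHom.id_apply]; module

/-- The frame consists, up to sign, of the three edges leaving one vertex of a nondegenerate
tetrahedron. Being bi-Lipschitz, it reduces all distance comparisons to the sup norm. -/
theorem frame_injective {i j : Fin 4} (hij : i ≠ j) : Function.Injective (frame i j) := by
  rw [← LinearMap.ker_eq_bot, LinearMap.ker_eq_bot']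
  intro w hw
  have h0 := congrArg (fun x : E3 => x 0) hw
  have h1 := congrArg (fun x : E3 => x 1) hw
  have h2 := congrArg (fun x : E3 => x 2) hw
  obtain ⟨a, b, c⟩ := w
  fin_cases i <;> fin_cases j <;> simp [frame, vertex, edgeEnd, edgeStart] at h0 h1 h2 hij ⊢ <;>
    refine ⟨?_, ?_, ?_⟩ <;> linarith

theorem exists_frame_bounds {i j : Fin 4} (hij : i ≠ j) :
    ∃ c : ℝ, 0 < c ∧ ∀ w, ‖frame i j w‖ ≤ c * ‖w‖ ∧ ‖w‖ ≤ c * ‖frame i j w‖ := by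
  obtain ⟨K, hK, hanti⟩ := (frame i j).exists_antilipschitzWith
    (LinearMap.ker_eq_bot.2 (frame_injective hij))
  set L := (frame i j).toContinuousLinearMap
  refine ⟨max ‖L‖ K, lt_max_of_lt_right hK, fun w => ⟨?_, ?_⟩⟩
  · exact (L.le_opNorm w).trans (by gcongr; exact le_max_left _ _)
  · have h : ‖w‖ ≤ K * ‖frame i j w‖ := by simpa using hanti.le_mul_dist w 0
    exact h.trans (by gcongr; exact le_max_right _ _)

/-- The parametrization of the face `Γ_i` over the triangle in `ℝ × ℝ`. -/
noncomputable def param (i j : Fin 4) (u : ℝ × ℝ) : E3 := faceMap i j !₂[u.1, u.2]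

theorem param_eq (i j : Fin 4) (u : ℝ × ℝ) :
    param i j u = vertex (edgeStart i j) + frame i j (u.1, u.2, 0) := by
  simp [param, faceMap, frame, add_assoc]

theorem edgeStart_comm {i j : Fin 4} (hij : i ≠ j) : edgeStart j i = edgeStart i j :=
  ((edge_indices i j hij).2.2.2.2.2.1).symm

theorem edgeEnd_comm {i j : Fin 4} (hij : i ≠ j) : edgeEnd j i = edgeEnd i j :=
  ((edge_indices i j hij).2.2.2.2.2.2).symm

theorem param_swap_eq {i j : Fin 4} (hij : i ≠ j) (v : ℝ × ℝ) :
    param j i v = vertex (edgeStart i j) + frame i j (v.1, 0, -v.2) := by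
  simp [param, faceMap, frame, edgeStart_comm hij, edgeEnd_comm hij, add_assoc]

theorem continuous_param (i j : Fin 4) : Continuous (param i j) := by
  have : param i j = fun u => vertex (edgeStart i j) +
      (frame i j).toContinuousLinearMap (u.1, u.2, 0) := funext (param_eq i j)
  rw [this]
  fun_prop

/-- Comparison of distances on two faces with distances in the parameter domain. -/
theorem exists_edist_param {i j : Fin 4} (hij : i ≠ j) : ∃ c : ℝ≥0∞, c ≠ 0 ∧ c ≠ ∞ ∧
    (∀ u v, edist (param i j u) (param i j v) ≤ c * edist u v ∧
      edist u v ≤ c * edist (param i j u) (param i j v)) ∧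
    ∀ u ∈ tri, ∀ v ∈ tri, edist (param i j u) (param j i v) ≤ c * ENNReal.ofReal (foldDist u v) ∧
      ENNReal.ofReal (foldDist u v) ≤ c * edist (param i j u) (param j i v) := by
  obtain ⟨c, hc, hb⟩ := exists_frame_bounds hij
  refine ⟨ENNReal.ofReal c, by simpa using hc, by simp, fun u v => ?_, fun u hu v hv => ?_⟩
  · have h1 : dist (param i j u) (param i j v) = ‖frame i j (u.1 - v.1, u.2 - v.2, 0)‖ := by
      rw [dist_eq_norm, param_eq, param_eq, add_sub_add_left_eq_sub, ← map_sub]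
      simp
    have h2 : dist u v = ‖((u.1 - v.1, u.2 - v.2, 0) : ℝ × ℝ × ℝ)‖ := by
      simp [Prod.norm_def, Prod.dist_eq, Real.dist_eq]
    rw [edist_dist, edist_dist, ← ENNReal.ofReal_mul hc.le, ← ENNReal.ofReal_mul hc.le, h1, h2]
    exact ⟨ENNReal.ofReal_le_ofReal (hb _).1, ENNReal.ofReal_le_ofReal (hb _).2⟩
  · have h1 : dist (param i j u) (param j i v) = ‖frame i j (u.1 - v.1, u.2, v.2)‖ := by
      rw [dist_eq_norm, param_eq, param_swap_eq hij, add_sub_add_left_eq_sub, ← map_sub]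
      simp
    -- The difference of points on the two faces has frame coordinates `(u.1 - v.1, u.2, v.2)`, the
    -- minus sign in `frame` accounting for the last one. Their sup norm is the folded distance, as
    -- both heights are positive.
    have h2 : foldDist u v = ‖((u.1 - v.1, u.2, v.2) : ℝ × ℝ × ℝ)‖ := by
      simp [Prod.norm_def, foldDist, abs_of_pos hu.2.1, abs_of_pos hv.2.1, max_assoc]
    rw [edist_dist, ← ENNReal.ofReal_mul hc.le, ← ENNReal.ofReal_mul hc.le, h1, h2]
    exact ⟨ENNReal.ofReal_le_ofReal (hb _).1, ENNReal.ofReal_le_ofReal (hb _).2⟩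

theorem measurableEmbedding_param {i j : Fin 4} (hij : i ≠ j) :
    MeasurableEmbedding (param i j) := by
  have hinj : Function.Injective (param i j) := by
    intro u v h
    rw [param_eq, param_eq, add_right_inj] at h
    have := frame_injective hij h
    simp only [Prod.mk.injEq] at this
    exact Prod.ext this.1 this.2.1
  exact (continuous_param i j).measurableEmbedding hinj

theorem ne_iff_edge {i j : Fin 4} (hij : i ≠ j) (k : Fin 4) :
    k ≠ i ↔ k = edgeStart i j ∨ k = edgeEnd i j ∨ k = j := by
  revert i j k
  decide

theorem face_eq_image {i j : Fin 4} (hij : i ≠ j) : face i = param i j '' ctri := by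
  apply Set.Subset.antisymm
  · refine convexHull_min ?_ ?_
    · rintro _ ⟨k, hk, rfl⟩
      rcases (ne_iff_edge hij k).1 hk with rfl | rfl | rfl
      · exact ⟨(0, 0), ⟨le_rfl, le_rfl, by norm_num⟩, by simp [param, faceMap]⟩
      · exact ⟨(1, 0), ⟨by norm_num, le_rfl, by norm_num⟩, by simp [param, faceMap]⟩
      · exact ⟨(0, 1), ⟨le_rfl, by norm_num, by norm_num⟩, by simp [param, faceMap]⟩
    · have h1 : param i j '' ctri = (fun x => vertex (edgeStart i j) + x) ''
          (((frame i j).comp ((LinearMap.fst ℝ ℝ ℝ).prod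
            ((LinearMap.snd ℝ ℝ ℝ).prod 0))) '' ctri) := by
        rw [Set.image_image]
        exact Set.image_congr fun u _ => by simp [param_eq]
      rw [h1]
      exact (convex_ctri.linear_image _).translate _
  · rintro _ ⟨u, ⟨a, b, c⟩, rfl⟩
    have hmem : ∀ k, k ≠ i → vertex k ∈ face i := fun k hk =>
      subset_convexHull ℝ _ ⟨k, hk, rfl⟩
    have h := (convex_convexHull ℝ (vertex '' {k | k ≠ i})).sum_mem (t := Finset.univ)
      (w := ![1 - u.1 - u.2, u.1, u.2])
      (z := ![vertex (edgeStart i j), vertex (edgeEnd i j), vertex j])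
      (by intro k _; fin_cases k <;> simp <;> linarith)
      (by simp [Fin.sum_univ_three]; ring)
      (by
        intro k _
        fin_cases k
        · exact hmem _ (edge_indices i j hij).1
        · exact hmem _ (edge_indices i j hij).2.2.1
        · exact hmem _ hij.symm)
    rw [Fin.sum_univ_three] at h
    refine (congrArg (· ∈ face i) ?_).mpr h
    simp [param, faceMap]
    module

/-- An injective linear map scales Hausdorff measure of the source dimension by a constant, and
translations preserve it. Planes give surface measure on faces, and lines give arc length on edges.
-/
theorem restrict_image_affine {V : Type*} [NormedAddCommGroup V] [InnerProductSpace ℝ V]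
    [FiniteDimensional ℝ V] [MeasurableSpace V] [BorelSpace V] (ℓ : V →ₗ[ℝ] E3) (a : E3)
    (hℓ : Function.Injective ℓ) (B : Set V) :
    (μHE[Module.finrank ℝ V] : Measure E3).restrict ((fun x => a + ℓ x) '' B) =
      ENNReal.ofReal ℓ.normDet • Measure.map (fun x => a + ℓ x) (volume.restrict B) := by
  have hm : Measurable fun x => a + ℓ x := by
    have := ℓ.continuous_of_finiteDimensional.measurable
    fun_prop
  have hinj : Function.Injective fun x => a + ℓ x := fun x y h => hℓ (add_left_cancel h)
  ext A hA
  rw [Measure.restrict_apply hA, Measure.smul_apply, Measure.map_apply hm hA,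
    Measure.restrict_apply (hm hA), smul_eq_mul, ← Set.image_preimage_inter,
    ← LinearMap.euclideanHausdorffMeasure_image_eq_normDet_mul_volume]
  rw [← Set.image_image (fun y => a + y) ℓ]
  exact (IsometryEquiv.addLeft a).isometry.euclideanHausdorffMeasure_image _

theorem ofReal_normDet_ne_zero {V : Type*} [NormedAddCommGroup V] [InnerProductSpace ℝ V]
    [FiniteDimensional ℝ V] {ℓ : V →ₗ[ℝ] E3} (hℓ : Function.Injective ℓ) :
    ENNReal.ofReal ℓ.normDet ≠ 0 := by
  have : ℓ.normDet ≠ 0 := fun h =>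
    LinearMap.normDet_eq_zero_iff_ker_ne_bot.1 h (LinearMap.ker_eq_bot.2 hℓ)
  simpa using lt_of_le_of_ne ℓ.normDet_nonneg this.symm

/-- The standard identification of `ℝ × ℝ` with the Euclidean plane. -/
noncomputable def toPlane : ℝ × ℝ ≃ᵐ E2 :=
  MeasurableEquiv.finTwoArrow.symm.trans (MeasurableEquiv.toLp 2 _)

theorem measurePreserving_toPlane : MeasurePreserving toPlane :=
  ((volume_preserving_finTwoArrow ℝ).symm).trans (PiLp.volume_preserving_toLp _)

/-- Surface measure on a face in terms of its parametrization. -/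
theorem exists_surf_face_eq {i j : Fin 4} (hij : i ≠ j) : ∃ c : ℝ≥0∞, c ≠ 0 ∧ c ≠ ∞ ∧
    surf (face i) = c • Measure.map (param i j) (volume.restrict tri) := by
  set ℓ : E2 →ₗ[ℝ] E3 := (frame i j).comp (((EuclideanSpace.proj 0 : E2 →L[ℝ] ℝ) : E2 →ₗ[ℝ] ℝ).prod
    (((EuclideanSpace.proj 1 : E2 →L[ℝ] ℝ) : E2 →ₗ[ℝ] ℝ).prod 0)) with hℓ
  have hap : ∀ u, ℓ (toPlane u) = frame i j (u.1, u.2, 0) := fun u => rfl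
  have hinj : Function.Injective ℓ := by
    intro x y h
    obtain ⟨u, rfl⟩ := toPlane.surjective x
    obtain ⟨v, rfl⟩ := toPlane.surjective y
    rw [hap, hap] at h
    have := frame_injective hij h
    simp only [Prod.mk.injEq] at this
    rw [Prod.ext this.1 this.2.1]
  refine ⟨_, ofReal_normDet_ne_zero hinj, ENNReal.ofReal_ne_top, ?_⟩
  have h1 := restrict_image_affine ℓ (vertex (edgeStart i j)) hinj (toPlane '' ctri)
  have h2 : (fun x => vertex (edgeStart i j) + ℓ x) '' (toPlane '' ctri) = face i := by
    rw [Set.image_image, face_eq_image hij]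
    exact Set.image_congr fun u _ => by rw [hap, param_eq]
  have hm : Measurable fun x => vertex (edgeStart i j) + ℓ x := by
    have := ℓ.continuous_of_finiteDimensional.measurable
    fun_prop
  have h3 : (volume : Measure E2).restrict (toPlane '' ctri) =
      Measure.map toPlane (volume.restrict tri) := by
    rw [← restrict_ctri, ← measurePreserving_toPlane.map_eq,
      toPlane.measurableEmbedding.restrict_map, Set.preimage_image_eq _ toPlane.injective]
  rw [h2, h3, Measure.map_map hm toPlane.measurable] at h1
  rw [surf]
  have h4 : (fun x => vertex (edgeStart i j) + ℓ x) ∘ toPlane = param i j :=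
    funext fun u => by rw [Function.comp_apply, hap, param_eq]
  rw [h4] at h1
  simpa using h1

/-- Arc length on an edge in terms of its parametrization. -/
theorem exists_arc_edge_eq {i j : Fin 4} (hij : i ≠ j) : ∃ c : ℝ≥0∞, c ≠ 0 ∧ c ≠ ∞ ∧
    arc (edge i j) = c • Measure.map (fun x : ℝ => param i j (x, 0))
      (volume.restrict (Set.Ioo 0 1)) := by
  set ℓ : ℝ →ₗ[ℝ] E3 := (frame i j).comp (LinearMap.inl ℝ ℝ (ℝ × ℝ)) with hℓ
  have hinj : Function.Injective ℓ := (frame_injective hij).comp LinearMap.inl_injective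
  refine ⟨_, ofReal_normDet_ne_zero hinj, ENNReal.ofReal_ne_top, ?_⟩
  have h1 := restrict_image_affine ℓ (vertex (edgeStart i j)) hinj (Set.Icc 0 1)
  have h2 : (fun x => vertex (edgeStart i j) + ℓ x) '' Set.Icc 0 1 = edge i j := by
    rw [edge, segment_eq_image']
    exact Set.image_congr fun x _ => by simp [hℓ, frame]
  rw [h2, Measure.restrict_congr_set Ioo_ae_eq_Icc.symm] at h1
  rw [arc]
  have h4 : (fun x => vertex (edgeStart i j) + ℓ x) = fun x : ℝ => param i j (x, 0) :=
    funext fun x => by rw [param_eq]; rfl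
  rw [h4] at h1
  simpa using h1

/-! ### The boundary of the tetrahedron as the union of its faces -/

/-- Barycentric coordinates with respect to the vertices of the tetrahedron. -/
def bary : Fin 4 → E3 → ℝ := ![fun x => x 2, fun x => x 1, fun x => x 0, fun x => 1 - x 0 - x 1 - x 2]

theorem continuous_bary (k : Fin 4) : Continuous (bary k) := by
  fin_cases k <;> simp [bary] <;> fun_prop

theorem bary_combo (k : Fin 4) {s t : ℝ} (h : s + t = 1) (x y : E3) :
    bary k (s • x + t • y) = s * bary k x + t * bary k y := by
  obtain rfl : t = 1 - s := by linarith
  fin_cases k <;> simp [bary]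
  ring

theorem sum_bary (x : E3) : ∑ k, bary k x = 1 := by
  simp [Fin.sum_univ_four, bary]
  ring

theorem sum_bary_smul (x : E3) : ∑ k, bary k x • vertex k = x := by
  ext m
  fin_cases m <;> simp [Fin.sum_univ_four, bary, vertex]

theorem bary_vertex (k l : Fin 4) : bary k (vertex l) = if k = l then 1 else 0 := by
  fin_cases k <;> fin_cases l <;> simp [bary, vertex]

theorem refTet_eq : refTet = {x | ∀ k, 0 < bary k x} := by
  ext x
  simp only [refTet, Set.mem_ofPred_eq, Fin.forall_fin_succ, bary]
  simp
  constructor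
  · rintro ⟨a, b, c, d⟩; exact ⟨c, b, a, by linarith⟩
  · rintro ⟨c, b, a, d⟩; exact ⟨a, b, c, by linarith⟩

theorem face_eq (i : Fin 4) : face i = {x | (∀ k, 0 ≤ bary k x) ∧ bary i x = 0} := by
  apply Set.Subset.antisymm
  · refine convexHull_min ?_ ?_
    · rintro _ ⟨k, hk, rfl⟩
      refine ⟨fun l => ?_, ?_⟩
      · rw [bary_vertex]; split_ifs <;> norm_num
      · rw [bary_vertex, if_neg (Ne.symm hk)]
    · rintro x ⟨hx, hx0⟩ y ⟨hy, hy0⟩ s t hs ht hst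
      refine ⟨fun k => ?_, ?_⟩
      · rw [bary_combo k hst]
        have := hx k
        have := hy k
        positivity
      · rw [bary_combo i hst, hx0, hy0]; simp
  · rintro x ⟨hx, hx0⟩
    have h := (convex_convexHull ℝ (vertex '' {k | k ≠ i})).sum_mem (t := Finset.univ.erase i)
      (w := fun k => bary k x) (z := vertex) (fun k _ => hx k)
      (by rw [Finset.sum_erase (f := fun k => bary k x) _ hx0, sum_bary])
      (fun k hk => subset_convexHull ℝ _ ⟨k, Finset.ne_of_mem_erase hk, rfl⟩)
    rwa [Finset.sum_erase (f := fun k => bary k x • vertex k) _ (by rw [hx0, zero_smul]),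
      sum_bary_smul] at h

/-- In barycentric coordinates the tetrahedron is the set where all are positive. Moving towards the
centroid shows that its closure is the set where all are nonnegative, so on the frontier some
coordinate vanishes. -/
theorem frontier_refTet : frontier refTet = ⋃ i, face i := by
  have hopen : IsOpen refTet := by
    rw [refTet_eq, Set.ofPred_forall]
    exact isOpen_iInter_of_finite fun k => isOpen_lt continuous_const (continuous_bary k)
  have hclosure : closure refTet = {x | ∀ k, 0 ≤ bary k x} := by
    apply Set.Subset.antisymm
    · refine closure_minimal (fun x hx k => ?_) ?_
      · rw [refTet_eq] at hx
        exact (hx k).le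
      · rw [Set.ofPred_forall]
        exact isClosed_iInter fun k => isClosed_le continuous_const (continuous_bary k)
    · intro x hx
      set c : E3 := !₂[1 / 4, 1 / 4, 1 / 4] with hc
      have hcb : ∀ k, 0 < bary k c := by
        have hcm : ∀ m, c m = 1 / 4 := by intro m; fin_cases m <;> rfl
        intro k; fin_cases k <;> simp only [bary] <;> simp [hcm]; norm_num
      have h2 : Continuous fun ε : ℝ => (1 - ε) • x + ε • c := by fun_prop
      have hlim : Tendsto (fun n : ℕ => (1 - 1 / ((n : ℝ) + 1)) • x + (1 / ((n : ℝ) + 1)) • c) atTop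
          (𝓝 x) := by
        simpa [Function.comp_def] using
          (h2.tendsto 0).comp (tendsto_one_div_add_atTop_nhds_zero_nat (𝕜 := ℝ))
      refine mem_closure_of_tendsto hlim (Eventually.of_forall fun n => ?_)
      rw [refTet_eq]
      intro k
      rw [bary_combo k (by ring)]
      have h3 : 1 / ((n : ℝ) + 1) ≤ 1 := by
        rw [div_le_one (by positivity)]
        have : (0 : ℝ) ≤ n := n.cast_nonneg
        linarith
      have h4 : 0 < 1 / ((n : ℝ) + 1) := by positivity
      have := mul_pos h4 (hcb k)
      have := mul_nonneg (sub_nonneg.2 h3) (hx k)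
      linarith
  rw [frontier, hopen.interior_eq, hclosure]
  ext x
  simp only [Set.mem_sdiff, Set.mem_ofPred_eq, Set.mem_iUnion, face_eq, refTet_eq, not_forall, not_lt]
  constructor
  · rintro ⟨h, k, hk⟩
    exact ⟨k, h, le_antisymm hk (h k)⟩
  · rintro ⟨k, h, hk⟩
    exact ⟨h, k, hk.le⟩

theorem surf_face_le (i : Fin 4) : surf (face i) ≤ surf (frontier refTet) := by
  rw [frontier_refTet]
  exact Measure.restrict_mono (Set.subset_iUnion _ i) le_rfl

/-- Subadditivity suffices here: the edges may be counted twice, and their being null is not needed.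
-/
theorem surf_frontier_le : surf (frontier refTet) ≤ Measure.sum fun i => surf (face i) := by
  rw [frontier_refTet]
  exact Measure.restrict_iUnion_le

/-! ### Face integrals pulled back to the triangle -/

/-- The double integral over two faces in the Slobodeckij seminorm of the boundary. -/
noncomputable def facePair (s p : ℝ) (i j : Fin 4) (f : E3 → ℝ) : ℝ≥0∞ :=
  ∫⁻ x, ∫⁻ y, ‖f x - f y‖ₑ ^ p / edist x y ^ (s * p + 2) ∂(surf (face j)) ∂(surf (face i))

theorem lintegral_frontier_le (k : E3 → ℝ≥0∞) :
    ∫⁻ x, k x ∂(surf (frontier refTet)) ≤ ∑ i, ∫⁻ x, k x ∂(surf (face i)) := by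
  refine (lintegral_mono' surf_frontier_le le_rfl).trans_eq ?_
  rw [lintegral_sum_measure, tsum_fintype]

theorem exists_ne (i : Fin 4) : ∃ j, i ≠ j := by
  revert i; decide

/-- Integration over a face through its parametrization. -/
theorem exists_lintegral_face_eq {i j : Fin 4} (hij : i ≠ j) : ∃ c : ℝ≥0∞, c ≠ 0 ∧ c ≠ ∞ ∧
    ∀ k : E3 → ℝ≥0∞, ∫⁻ x, k x ∂(surf (face i)) = c * ∫⁻ u in tri, k (param i j u) := by
  obtain ⟨c, h0, h1, h⟩ := exists_surf_face_eq hij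
  refine ⟨c, h0, h1, fun k => ?_⟩
  rw [h, lintegral_smul_measure, (measurableEmbedding_param hij).lintegral_map, smul_eq_mul]

instance (i : Fin 4) : IsFiniteMeasure (surf (face i)) := by
  obtain ⟨j, hij⟩ := exists_ne i
  obtain ⟨c, h0, h1, h⟩ := exists_lintegral_face_eq hij
  constructor
  rw [← lintegral_one, h]
  simpa using ENNReal.mul_lt_top h1.lt_top volume_tri_lt_top

theorem measurable_facePair_integrand (r p : ℝ) {f : E3 → ℝ} (hf : Measurable f) :
    Measurable fun z : E3 × E3 => ‖f z.1 - f z.2‖ₑ ^ p / edist z.1 z.2 ^ r := by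
  have : Measurable fun z : E3 × E3 => edist z.1 z.2 := measurable_edist
  fun_prop

theorem seminormPow_frontier_le (s p : ℝ) {f : E3 → ℝ} (hf : Measurable f) :
    seminormPow s p (frontier refTet) f ≤ ∑ i, ∑ j, facePair s p i j f := by
  have hm := measurable_facePair_integrand (s * p + 2) p hf
  refine (lintegral_frontier_le _).trans (Finset.sum_le_sum fun i _ => ?_)
  refine (lintegral_mono fun x => lintegral_frontier_le _).trans_eq ?_
  rw [lintegral_finsetSum]
  · rfl
  · exact fun j _ => hm.lintegral_prod_right'

theorem facePair_le (s p : ℝ) (i j : Fin 4) (f : E3 → ℝ) :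
    facePair s p i j f ≤ seminormPow s p (frontier refTet) f :=
  lintegral_mono' (surf_face_le i) fun _ => lintegral_mono' (surf_face_le j) le_rfl

theorem lpPow_compare {i j : Fin 4} (hij : i ≠ j) (p : ℝ) : ∃ C : ℝ≥0∞, C ≠ ∞ ∧ ∀ f : E3 → ℝ,
    ∫⁻ x, ‖f x‖ₑ ^ p ∂(surf (face i)) ≤ C * lpPow p (f ∘ param i j) ∧
    lpPow p (f ∘ param i j) ≤ C * ∫⁻ x, ‖f x‖ₑ ^ p ∂(surf (face i)) := by
  obtain ⟨c, h0, h1, h⟩ := exists_lintegral_face_eq hij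
  refine ⟨c + c⁻¹, by simp [h0, h1], fun f => ?_⟩
  rw [h]
  change c * lpPow p (f ∘ param i j) ≤ _ ∧ lpPow p (f ∘ param i j) ≤ _ * (c * lpPow p (f ∘ param i j))
  refine ⟨by gcongr; exact le_self_add, ?_⟩
  calc lpPow p (f ∘ param i j) = c⁻¹ * (c * lpPow p (f ∘ param i j)) := by
        rw [← mul_assoc, ENNReal.inv_mul_cancel h0 h1, one_mul]
    _ ≤ _ := by gcongr; exact le_add_self

/-- Two double integrals over the triangle with comparable kernels are comparable. -/
theorem lintegral_kernel_compare {r p : ℝ} (hr : 0 ≤ r) {c : ℝ≥0∞} (h0 : c ≠ 0) (h1 : c ≠ ∞)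
    {a b : ℝ × ℝ → ℝ × ℝ → ℝ≥0∞} (hab : ∀ u ∈ tri, ∀ v ∈ tri, a u v ≤ c * b u v)
    (f g : ℝ × ℝ → ℝ) :
    ∫⁻ u in tri, ∫⁻ v in tri, ‖f u - g v‖ₑ ^ p / b u v ^ r ≤
      c ^ r * ∫⁻ u in tri, ∫⁻ v in tri, ‖f u - g v‖ₑ ^ p / a u v ^ r := by
  have hc : c ^ r ≠ ∞ := ENNReal.rpow_ne_top_of_nonneg hr h1
  rw [← lintegral_const_mul' _ _ hc]
  refine setLIntegral_mono_ae' measurableSet_tri (Eventually.of_forall fun u hu => ?_)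
  rw [← lintegral_const_mul' _ _ hc]
  refine setLIntegral_mono_ae' measurableSet_tri (Eventually.of_forall fun v hv => ?_)
  exact div_rpow_le_const_mul hr h0 h1 (hab u hu v hv)

theorem facePair_eq {i j i' j' : Fin 4} (hij : i ≠ j) (hij' : i' ≠ j') (s p : ℝ) :
    ∃ c : ℝ≥0∞, c ≠ 0 ∧ c ≠ ∞ ∧ ∀ f : E3 → ℝ, facePair s p i i' f =
      c * ∫⁻ u in tri, ∫⁻ v in tri, ‖(f ∘ param i j) u - (f ∘ param i' j') v‖ₑ ^ p /
        edist (param i j u) (param i' j' v) ^ (s * p + 2) := by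
  obtain ⟨c, h0, h1, h⟩ := exists_lintegral_face_eq hij
  obtain ⟨c', h0', h1', h'⟩ := exists_lintegral_face_eq hij'
  refine ⟨c * c', mul_ne_zero h0 h0', ENNReal.mul_ne_top h1 h1', fun f => ?_⟩
  rw [facePair, h, mul_assoc, ← lintegral_const_mul' _ _ h1']
  congr 1
  exact lintegral_congr fun u => h' _

theorem le_mul_of_eq_of_le {A B I c d : ℝ≥0∞} (h : A = c * I) (hI : I ≤ d * B) : A ≤ c * d * B := by
  rw [h, mul_assoc]; gcongr

theorem le_mul_of_eq_of_ge {A B I c d : ℝ≥0∞} (h0 : c ≠ 0) (h1 : c ≠ ∞) (h : A = c * I)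
    (hI : B ≤ d * I) : B ≤ d * c⁻¹ * A := by
  rw [h]
  calc B ≤ d * I := hI
    _ = d * ((c⁻¹ * c) * I) := by rw [ENNReal.inv_mul_cancel h0 h1, one_mul]
    _ = _ := by ring

theorem seminormPow_compare {i j : Fin 4} (hij : i ≠ j) {s p : ℝ} (hq : 0 ≤ s * p) :
    ∃ C : ℝ≥0∞, C ≠ ∞ ∧ ∀ f : E3 → ℝ,
      seminormPow s p (face i) f ≤ C * slobPow (s * p) p (f ∘ param i j) ∧
      slobPow (s * p) p (f ∘ param i j) ≤ C * seminormPow s p (face i) f := by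
  obtain ⟨c, h0, h1, h⟩ := facePair_eq hij hij s p
  obtain ⟨d, d0, d1, hd, -⟩ := exists_edist_param hij
  have hd' : d ^ (s * p + 2) ≠ ∞ := ENNReal.rpow_ne_top_of_nonneg (by linarith) d1
  refine ⟨c * d ^ (s * p + 2) + d ^ (s * p + 2) * c⁻¹, ENNReal.add_ne_top.2
    ⟨ENNReal.mul_ne_top h1 hd', ENNReal.mul_ne_top hd' (by simpa using h0)⟩, fun f => ⟨?_, ?_⟩⟩
  · refine (le_mul_of_eq_of_le (h f) (lintegral_kernel_compare (by linarith) d0 d1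
      (fun u _ v _ => (hd u v).2) _ _)).trans ?_
    gcongr
    · exact le_self_add
    · exact le_rfl
  · refine (le_mul_of_eq_of_ge h0 h1 (h f) (lintegral_kernel_compare (by linarith) d0 d1
      (fun u _ v _ => (hd u v).1) _ _)).trans ?_
    gcongr
    · exact le_add_self
    · exact le_rfl

/-- The comparison of the distance between two faces with the folded distance, raised to the power
sp + 2. The constant is a sum so that one number serves both directions. -/
theorem facePair_compare {i j : Fin 4} (hij : i ≠ j) {s p : ℝ} (hq : 0 ≤ s * p) :
    ∃ C : ℝ≥0∞, C ≠ ∞ ∧ ∀ f : E3 → ℝ,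
      facePair s p i j f ≤ C * crossPow (s * p) p (f ∘ param i j) (f ∘ param j i) ∧
      crossPow (s * p) p (f ∘ param i j) (f ∘ param j i) ≤ C * facePair s p i j f := by
  obtain ⟨c, h0, h1, h⟩ := facePair_eq hij hij.symm s p
  obtain ⟨d, d0, d1, -, hd⟩ := exists_edist_param hij
  have hd' : d ^ (s * p + 2) ≠ ∞ := ENNReal.rpow_ne_top_of_nonneg (by linarith) d1
  refine ⟨c * d ^ (s * p + 2) + d ^ (s * p + 2) * c⁻¹, ENNReal.add_ne_top.2
    ⟨ENNReal.mul_ne_top h1 hd', ENNReal.mul_ne_top hd' (by simpa using h0)⟩, fun f => ⟨?_, ?_⟩⟩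
  · refine (le_mul_of_eq_of_le (h f) (lintegral_kernel_compare (by linarith) d0 d1
      (fun u hu v hv => (hd u hu v hv).2) _ _)).trans ?_
    gcongr
    · exact le_self_add
    · exact le_rfl
  · refine (le_mul_of_eq_of_ge h0 h1 (h f) (lintegral_kernel_compare (by linarith) d0 d1
      (fun u hu v hv => (hd u hu v hv).1) _ _)).trans ?_
    gcongr
    · exact le_add_self

theorem edgeIntegral_eq (p : ℝ) (i j : Fin 4) (f : E3 → ℝ) :
    edgeIntegral p i j f f = hardyPow 1 p (f ∘ param i j - f ∘ param j i) := by
  have h1 : refTri = toPlane '' tri := by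
    ext x
    obtain ⟨u, rfl⟩ := toPlane.surjective x
    rw [toPlane.injective.mem_set_image]; rfl
  have h2 : (volume : Measure E2).restrict refTri = Measure.map toPlane (volume.restrict tri) := by
    rw [h1, ← measurePreserving_toPlane.map_eq,
      toPlane.measurableEmbedding.restrict_map, Set.preimage_image_eq _ toPlane.injective]
  rw [edgeIntegral, h2, toPlane.measurableEmbedding.lintegral_map]
  refine lintegral_congr fun u => ?_
  rw [ENNReal.rpow_one]; rfl

theorem normPow_of_pos {s : ℝ} (hs : 0 < s) (p : ℝ) (S : Set E3) (f : E3 → ℝ) :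
    normPow s p S f = (∫⁻ x, ‖f x‖ₑ ^ p ∂(surf S)) + seminormPow s p S f := by
  rw [normPow, if_pos hs]

theorem edge_comm {i j : Fin 4} (hij : i ≠ j) : edge j i = edge i j := by
  rw [edge, edge, edgeStart_comm hij, edgeEnd_comm hij]

/-- The endpoints of the edge are ordered independently of the order of i and j, so traces from the
two faces can be compared at the same parameter x. -/
theorem param_bottom_comm {i j : Fin 4} (hij : i ≠ j) (x : ℝ) :
    param j i (x, 0) = param i j (x, 0) := by
  rw [param_swap_eq hij, param_eq]; simp

theorem measurableEmbedding_param_bottom {i j : Fin 4} (hij : i ≠ j) :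
    MeasurableEmbedding fun x : ℝ => param i j (x, 0) := by
  refine ((continuous_param i j).comp (by fun_prop : Continuous fun x : ℝ => (x, (0 : ℝ))
    )).measurableEmbedding ?_
  intro x y h
  exact (Prod.mk.injEq _ _ _ _ ▸ (measurableEmbedding_param hij).injective h).1

theorem bottom_mem_ctri {x : ℝ} (hx : x ∈ Set.Ioo (0 : ℝ) 1) : (x, (0 : ℝ)) ∈ ctri :=
  ⟨hx.1.le, le_rfl, by have := hx.2; simp only; linarith⟩

theorem lpPow_congr {p : ℝ} {f g : ℝ × ℝ → ℝ} (h : ∀ u ∈ tri, f u = g u) :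
    lpPow p f = lpPow p g :=
  setLIntegral_congr_fun measurableSet_tri fun u hu => by simp only [h u hu]

theorem slobPow_congr {q p : ℝ} {f g : ℝ × ℝ → ℝ} (h : ∀ u ∈ tri, f u = g u) :
    slobPow q p f = slobPow q p g :=
  setLIntegral_congr_fun measurableSet_tri fun u hu =>
    setLIntegral_congr_fun measurableSet_tri fun v hv => by simp only [h u hu, h v hv]

/-! ### Traces on the edges of the faces -/

/-- A trace on an edge of a face gives a trace on the bottom edge of the parameter triangle. -/
theorem IsEdgeTrace.exists_isBottomTrace {i j : Fin 4} (hij : i ≠ j) {s p : ℝ} (hs : 0 < s)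
    (hp : 0 < p) {f g : E3 → ℝ} (h : IsEdgeTrace s p i (edge i j) f g) :
    ∃ τ : ℝ → ℝ, Measurable τ ∧
      (∀ᵐ x ∂volume.restrict (Set.Ioo (0 : ℝ) 1), τ x = g (param i j (x, 0))) ∧
      IsBottomTrace (s * p) p (f ∘ param i j) τ := by
  obtain ⟨hg, φ, hφ, hW, hT⟩ := h
  obtain ⟨c, c0, c1, harc⟩ := exists_arc_edge_eq hij
  have hemb := measurableEmbedding_param_bottom hij
  have hgm : AEStronglyMeasurable (fun x : ℝ => g (param i j (x, 0)))
      (volume.restrict (Set.Ioo 0 1)) := by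
    have h1 := hg.1
    rw [harc] at h1
    refine (h1.mono_ac ?_).comp_measurable hemb.measurable
    refine Measure.AbsolutelyContinuous.mk fun A _ hA => ?_
    simpa [c0] using hA
  refine ⟨hgm.mk _, hgm.stronglyMeasurable_mk.measurable, hgm.ae_eq_mk.symm, ?_⟩
  have hN : Tendsto (fun n => normPow s p (face i) (φ n - f)) atTop (𝓝 0) :=
    (tendsto_rpow_zero_iff (show 0 < 1 / p by positivity)).1 hW
  have hmap : Set.MapsTo (param i j) ctri (face i) := by
    rw [face_eq_image hij]; exact Set.mapsTo_image _ _
  have hcont : ∀ n, ContinuousOn (φ n ∘ param i j) ctri := fun n =>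
    (hφ n).1.comp (continuous_param i j).continuousOn hmap
  have heq : ∀ n, ∀ u ∈ ctri, ctri.indicator (φ n ∘ param i j) u = φ n (param i j u) :=
    fun n u hu => Set.indicator_of_mem hu _
  have hdiff : ∀ n, ∀ u ∈ tri, (ctri.indicator (φ n ∘ param i j) - f ∘ param i j) u =
      ((φ n - f) ∘ param i j) u := fun n u hu => by
    simp [heq n u (tri_subset_ctri hu)]
  -- The approximants are only known to be continuous on the closed face; cutting off outside the
  -- closed triangle makes them globally measurable.
  refine ⟨fun n => ctri.indicator (φ n ∘ param i j), fun n => ⟨?_, ?_⟩, ?_, ?_, ?_⟩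
  · change Measurable (ctri.indicator (φ n ∘ param i j))
    classical
    rw [← Set.piecewise_eq_indicator]
    exact (hcont n).measurable_piecewise continuousOn_const isClosed_ctri.measurableSet
  · exact (hcont n).congr fun u hu => heq n u hu
  · obtain ⟨C, hC, hle⟩ := lpPow_compare hij p
    refine tendsto_of_tendsto_of_tendsto_of_le_of_le tendsto_const_nhds
      (by simpa using ENNReal.Tendsto.const_mul hN (Or.inr hC)) (fun _ => zero_le) fun n => ?_
    change lpPow p _ ≤ C * _
    rw [lpPow_congr (hdiff n)]
    refine (hle _).2.trans ?_
    gcongr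
    exact le_self_add
  · obtain ⟨C, hC, hle⟩ := seminormPow_compare hij (s := s) (p := p) (by positivity)
    refine tendsto_of_tendsto_of_tendsto_of_le_of_le tendsto_const_nhds
      (by simpa using ENNReal.Tendsto.const_mul hN (Or.inr hC)) (fun _ => zero_le) fun n => ?_
    change slobPow _ p _ ≤ C * _
    rw [slobPow_congr (hdiff n), normPow_of_pos hs]
    refine (hle _).2.trans ?_
    gcongr
    exact le_add_self
  · have h2 : Tendsto (fun n => ∫⁻ x, ‖(φ n - g) x‖ₑ ^ p ∂(arc (edge i j))) atTop (𝓝 0) := by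
      simp_rw [eLpNorm_ofReal_eq hp] at hT
      exact (tendsto_rpow_zero_iff (show 0 < 1 / p by positivity)).1 hT
    have h3 := ENNReal.Tendsto.const_mul (a := c⁻¹) h2 (Or.inr (by simpa using c0))
    rw [mul_zero] at h3
    refine h3.congr fun n => ?_
    rw [harc, lintegral_smul_measure, hemb.lintegral_map, smul_eq_mul, ← mul_assoc,
      ENNReal.inv_mul_cancel c0 c1, one_mul]
    refine lintegral_congr_ae ?_
    filter_upwards [hgm.ae_eq_mk, ae_restrict_mem measurableSet_Ioo] with x hx hx01
    rw [← hx, heq n _ (bottom_mem_ctri hx01), Pi.sub_apply]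

/-- Composition with this map extends continuous functions on the triangle to continuous functions
on space, as needed to build approximants on a face. -/
theorem exists_leftInverse_param {i j : Fin 4} (hij : i ≠ j) :
    ∃ ρ : E3 → ℝ × ℝ, Continuous ρ ∧ ∀ u, ρ (param i j u) = u := by
  obtain ⟨G, hG⟩ := (frame i j).exists_leftInverse_of_injective
    (LinearMap.ker_eq_bot.2 (frame_injective hij))
  have hGc : Continuous G := G.continuous_of_finiteDimensional
  refine ⟨fun x => ((G (x - vertex (edgeStart i j))).1, (G (x - vertex (edgeStart i j))).2.1),
    by fun_prop, fun u => ?_⟩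
  have : G (frame i j (u.1, u.2, 0)) = (u.1, u.2, 0) := LinearMap.congr_fun hG _
  simp [param_eq, this]

/-- Traces exist in the supercritical range. -/
theorem MemW.exists_isEdgeTrace {i j : Fin 4} (hij : i ≠ j) {s p : ℝ} (hs : 0 < s)
    (hp : 1 < p) (hq : 1 < s * p) {f : E3 → ℝ} (hf : Measurable f) (h : MemW s p (face i) f) :
    ∃ (g : E3 → ℝ) (τ : ℝ → ℝ), IsEdgeTrace s p i (edge i j) f g ∧ Measurable τ ∧
      (∀ x, g (param i j (x, 0)) = τ x) ∧ IsBottomTrace (s * p) p (f ∘ param i j) τ := by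
  have hp0 : 0 < p := by linarith
  obtain ⟨C, hC, hle⟩ := lpPow_compare hij p
  obtain ⟨C', hC', hle'⟩ := seminormPow_compare hij (s := s) (p := p) (by linarith)
  obtain ⟨c, c0, c1, harc⟩ := exists_arc_edge_eq hij
  have hemb := measurableEmbedding_param_bottom hij
  obtain ⟨ρ, hρ, hρp⟩ := exists_leftInverse_param hij
  have hfin : normPow s p (face i) f ≠ ∞ := by
    intro h'
    have := h.2
    rw [wNorm, h', ENNReal.top_rpow_of_pos (by positivity)] at this
    exact this.ne rfl
  rw [normPow_of_pos hs, ENNReal.add_ne_top] at hfin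
  have hfm : Measurable (f ∘ param i j) := hf.comp (continuous_param i j).measurable
  obtain ⟨φ, τ, hτ, hφ, hφfin, hτfin, hL, hS, hT⟩ := exists_isBottomTrace hq hp hfm
    (ne_top_of_le_ne_top (ENNReal.mul_ne_top hC hfin.1) (hle f).2)
    (ne_top_of_le_ne_top (ENNReal.mul_ne_top hC' hfin.2) (hle' f).2)
  have hcomp : ∀ n, (φ n ∘ ρ) ∘ param i j = φ n := fun n => by
    ext u; simp [hρp]
  have harcint : ∀ k : E3 → ℝ≥0∞, ∫⁻ x, k x ∂(arc (edge i j)) =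
      c * ∫⁻ x in Set.Ioo (0 : ℝ) 1, k (param i j (x, 0)) := fun k => by
    rw [harc, lintegral_smul_measure, hemb.lintegral_map, smul_eq_mul]
  have hp' : (0 : ℝ) < 1 / p := by positivity
  -- The trace and the approximants are those on the triangle, carried back by ρ; τ is kept as its
  -- bottom-edge representative, so that traces from two faces can be compared there.
  refine ⟨fun x => τ (ρ x).1, τ, ⟨⟨?_, ?_⟩, fun n => φ n ∘ ρ, fun n => ⟨?_, ⟨?_, ?_⟩, ?_⟩, ?_, ?_⟩, hτ,
    fun x => by simp only [hρp], φ, fun n => ⟨(hφ n).measurable, (hφ n).continuousOn⟩, hL, hS, hT⟩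
  · exact (hτ.comp (measurable_fst.comp hρ.measurable)).aestronglyMeasurable
  · rw [eLpNorm_ofReal_eq hp0, harcint]
    simp only [hρp]
    exact ENNReal.rpow_lt_top_of_nonneg hp'.le (ENNReal.mul_ne_top c1 hτfin)
  · exact ((hφ n).comp hρ).continuousOn
  · exact ((hφ n).comp hρ).aestronglyMeasurable
  · rw [eLpNorm_ofReal_eq hp0]
    have h1 := (hle (φ n ∘ ρ)).1
    rw [hcomp] at h1
    exact ENNReal.rpow_lt_top_of_nonneg hp'.le
      (ne_top_of_le_ne_top (ENNReal.mul_ne_top hC (hφfin n).1) h1)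
  · have h1 := (hle (φ n ∘ ρ)).1
    have h2 := (hle' (φ n ∘ ρ)).1
    rw [hcomp] at h1 h2
    rw [wNorm, normPow_of_pos hs]
    exact ENNReal.rpow_lt_top_of_nonneg hp'.le (ENNReal.add_ne_top.2
      ⟨ne_top_of_le_ne_top (ENNReal.mul_ne_top hC (hφfin n).1) h1,
        ne_top_of_le_ne_top (ENNReal.mul_ne_top hC' (hφfin n).2) h2⟩)
  · simp only [wNorm]
    rw [tendsto_rpow_zero_iff hp']
    have hlim := (ENNReal.Tendsto.const_mul hL (Or.inr hC)).add
      (ENNReal.Tendsto.const_mul hS (Or.inr hC'))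
    simp only [mul_zero, add_zero] at hlim
    refine tendsto_of_tendsto_of_tendsto_of_le_of_le tendsto_const_nhds hlim
      (fun _ => zero_le) fun n => ?_
    have h3 : (φ n ∘ ρ - f) ∘ param i j = φ n - f ∘ param i j := by
      ext u; simp [hρp]
    have h1 := (hle (φ n ∘ ρ - f)).1
    have h2 := (hle' (φ n ∘ ρ - f)).1
    rw [h3] at h1 h2
    change normPow s p (face i) (φ n ∘ ρ - f) ≤ _
    rw [normPow_of_pos hs]
    exact add_le_add h1 h2
  · simp_rw [eLpNorm_ofReal_eq hp0]
    rw [tendsto_rpow_zero_iff hp']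
    have h4 := ENNReal.Tendsto.const_mul (a := c) hT (Or.inr c1)
    rw [mul_zero] at h4
    refine h4.congr fun n => ?_
    rw [harcint]
    simp [hρp]

/-- The jump across an edge is controlled if the traces agree. -/
theorem exists_hardyPow_le_of_tracesAgree {i j : Fin 4} (hij : i ≠ j) {s p : ℝ} (hs : 0 < s)
    (hp : 1 < p) (hq : 1 < s * p) : ∃ C : ℝ≥0∞, C ≠ ∞ ∧ ∀ f : E3 → ℝ, Measurable f →
      TracesAgree s p i j f → hardyPow (s * p) p (f ∘ param i j - f ∘ param j i) ≤
        C * (normPow s p (face i) f + normPow s p (face j) f) := by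
  have hp0 : 0 < p := by linarith
  obtain ⟨C, hC, hle⟩ := exists_hardyPow_sub_le_of_trace hq hp
  obtain ⟨D, hD, hDle⟩ := seminormPow_compare hij (s := s) (p := p) (by linarith)
  obtain ⟨D', hD', hDle'⟩ := seminormPow_compare hij.symm (s := s) (p := p) (by linarith)
  refine ⟨C * (D + D'), ENNReal.mul_ne_top hC.ne (ENNReal.add_ne_top.2 ⟨hD, hD'⟩), ?_⟩
  rintro f hf ⟨g, h, hg, hh, hgh⟩
  rw [← edge_comm hij] at hh
  obtain ⟨τ, hτ, hτg, hτB⟩ := hg.exists_isBottomTrace hij hs hp0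
  obtain ⟨σ, hσ, hσh, hσB⟩ := hh.exists_isBottomTrace hij.symm hs hp0
  obtain ⟨c, c0, c1, harc⟩ := exists_arc_edge_eq hij
  have hae : ∀ᵐ x ∂volume.restrict (Set.Ioo (0 : ℝ) 1), τ x = σ x := by
    have h1 : ∀ᵐ x ∂volume.restrict (Set.Ioo (0 : ℝ) 1),
        g (param i j (x, 0)) = h (param i j (x, 0)) := by
      rw [harc, EventuallyEq, Measure.ae_ennreal_smul_measure_iff c0,
        (measurableEmbedding_param_bottom hij).ae_map_iff] at hgh
      exact hgh
    filter_upwards [h1, hτg, hσh] with x h1 h2 h3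
    rw [h2, h3, h1, param_bottom_comm hij]
  have hm : ∀ i j, Measurable (f ∘ param i j) := fun i j =>
    hf.comp (continuous_param i j).measurable
  calc _ ≤ C * (slobPow (s * p) p (f ∘ param i j) + slobPow (s * p) p (f ∘ param j i)) :=
        hle _ _ τ σ (hm i j) (hm j i) hτ hσ hτB hσB hae
    _ ≤ C * ((D + D') * normPow s p (face i) f + (D + D') * normPow s p (face j) f) := by
        rw [normPow_of_pos hs, normPow_of_pos hs]
        gcongr
        · refine (hDle f).2.trans ?_
          gcongr
          · exact le_self_add
          · exact le_add_self
        · refine (hDle' f).2.trans ?_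
          gcongr
          · exact le_add_self
          · exact le_add_self
    _ = _ := by ring

/-- Traces agree if the jump across the edge is controlled. -/
theorem tracesAgree_of_hardyPow_ne_top {i j : Fin 4} (hij : i ≠ j) {s p : ℝ} (hs : 0 < s)
    (hp : 1 < p) (hq : 1 < s * p) {f : E3 → ℝ} (hf : Measurable f) (hi : MemW s p (face i) f)
    (hj : MemW s p (face j) f)
    (hX : hardyPow (s * p) p (f ∘ param i j - f ∘ param j i) ≠ ∞) : TracesAgree s p i j f := by
  have hp0 : 0 < p := by linarith
  obtain ⟨g, τ, hg, hτ, hgτ, hτB⟩ := hi.exists_isEdgeTrace hij hs hp hq hf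
  obtain ⟨h, σ, hh, hσ, hhσ, hσB⟩ := hj.exists_isEdgeTrace hij.symm hs hp hq hf
  rw [edge_comm hij] at hh
  refine ⟨g, h, hg, hh, ?_⟩
  obtain ⟨c, c0, c1, harc⟩ := exists_arc_edge_eq hij
  have hm : ∀ i j, Measurable (f ∘ param i j) := fun i j =>
    hf.comp (continuous_param i j).measurable
  have hfin : ∀ {i j : Fin 4}, i ≠ j → MemW s p (face i) f →
      slobPow (s * p) p (f ∘ param i j) ≠ ∞ := by
    intro i j hij h
    obtain ⟨D, hD, hDle⟩ := seminormPow_compare hij (s := s) (p := p) (by linarith)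
    have hfin : normPow s p (face i) f ≠ ∞ := by
      intro h'
      have := h.2
      rw [wNorm, h', ENNReal.top_rpow_of_pos (by positivity)] at this
      exact this.ne rfl
    rw [normPow_of_pos hs, ENNReal.add_ne_top] at hfin
    exact ne_top_of_le_ne_top (ENNReal.mul_ne_top hD hfin.2) (hDle f).2
  have hae := ae_eq_of_hardyPow_sub_lt_top hq hp (hm i j) (hm j i) hτ hσ hτB hσB (hfin hij hi)
    (hfin hij.symm hj) hX
  rw [harc, EventuallyEq, Measure.ae_ennreal_smul_measure_iff c0,
    (measurableEmbedding_param_bottom hij).ae_map_iff]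
  filter_upwards [hae] with x hx
  rw [hgτ, hx, ← hhσ, param_bottom_comm hij]

/-! ### Interaction of two faces in terms of the jump across their common edge -/

/-- The weighted `p`-th power of the jump across an edge. -/
noncomputable def edgeJump (q p : ℝ) (i j : Fin 4) (f : E3 → ℝ) : ℝ≥0∞ :=
  hardyPow q p (f ∘ param i j - f ∘ param j i)

theorem edgeJump_comm (q p : ℝ) (i j : Fin 4) (f : E3 → ℝ) :
    edgeJump q p j i f = edgeJump q p i j f := by
  rw [edgeJump, edgeJump, ← neg_sub, hardyPow_neg]

theorem measurable_comp_param {f : E3 → ℝ} (hf : Measurable f) (i j : Fin 4) :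
    Measurable (f ∘ param i j) := hf.comp (continuous_param i j).measurable

/-- This is `crossPow_le` carried to the faces; besides the jump, only the norm on one of the two
faces enters. -/
theorem exists_facePair_le {i j : Fin 4} (hij : i ≠ j) {s p : ℝ} (hs : 0 < s) (hp : 1 < p) :
    ∃ C : ℝ≥0∞, C ≠ ∞ ∧ ∀ f : E3 → ℝ, Measurable f →
      facePair s p i j f ≤ C * (normPow s p (face i) f + edgeJump (s * p) p i j f) := by
  have hq : 0 < s * p := by positivity
  obtain ⟨C, hC, hle⟩ := crossPow_le hq hp.le
  obtain ⟨D, hD, hDle⟩ := facePair_compare hij hq.le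
  obtain ⟨E, hE, hEle⟩ := seminormPow_compare hij hq.le
  refine ⟨D * C * (E + 1), by finiteness, fun f hf => ?_⟩
  calc _ ≤ D * (C * (slobPow (s * p) p (f ∘ param i j) + edgeJump (s * p) p i j f)) :=
        (hDle f).1.trans (mul_le_mul_right (hle _ _ (measurable_comp_param hf _ _)
          (measurable_comp_param hf _ _)) _)
    _ ≤ D * (C * ((E + 1) * normPow s p (face i) f + (E + 1) * edgeJump (s * p) p i j f)) := by
        rw [normPow_of_pos hs]
        gcongr
        · refine (hEle f).2.trans ?_
          gcongr
          · exact le_self_add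
          · exact le_add_self
        · exact le_mul_of_one_le_left' le_add_self
    _ = _ := by ring

theorem exists_edgeJump_le_facePair {i j : Fin 4} (hij : i ≠ j) {s p : ℝ} (hs : 0 < s)
    (hp : 1 < p) : ∃ C : ℝ≥0∞, C ≠ ∞ ∧ ∀ f : E3 → ℝ, Measurable f →
      edgeJump (s * p) p i j f ≤ C * (facePair s p i j f + normPow s p (face j) f) := by
  have hq : 0 < s * p := by positivity
  obtain ⟨D, hD, hDle⟩ := facePair_compare hij hq.le
  obtain ⟨E, hE, hEle⟩ := seminormPow_compare hij.symm hq.le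
  have h2 := (two_rpow_lt_top (p - 1)).ne
  refine ⟨4 * 2 ^ (p - 1) * (D + E), by finiteness, fun f hf => ?_⟩
  calc _ ≤ _ := hardyPow_sub_le_crossPow hq.le hp.le (measurable_comp_param hf _ _)
          (measurable_comp_param hf _ _)
    _ ≤ 4 * 2 ^ (p - 1) * ((D + E) * facePair s p i j f + (D + E) * normPow s p (face j) f) := by
        rw [normPow_of_pos hs]
        gcongr
        · refine (hDle f).2.trans ?_
          gcongr
          exact le_self_add
        · refine (hEle f).2.trans ?_
          gcongr
          · exact le_add_self
          · exact le_add_self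
    _ = _ := by ring

/-- In the subcritical range, the jump across an edge is controlled by the norms on the faces. -/
theorem exists_edgeJump_le_of_lt {i j : Fin 4} (hij : i ≠ j) {s p : ℝ} (hs : 0 < s)
    (hp : 1 < p) (hq1 : s * p < 1) : ∃ C : ℝ≥0∞, C ≠ ∞ ∧ ∀ f : E3 → ℝ, Measurable f →
      edgeJump (s * p) p i j f ≤ C * (normPow s p (face i) f + normPow s p (face j) f) := by
  have hq : 0 < s * p := by positivity
  obtain ⟨C, hC, hle⟩ := exists_hardyPow_le hq hq1 hp
  have key : ∀ {i j : Fin 4}, i ≠ j → ∃ D : ℝ≥0∞, D ≠ ∞ ∧ ∀ f : E3 → ℝ, Measurable f →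
      hardyPow (s * p) p (f ∘ param i j) ≤ D * normPow s p (face i) f := by
    intro i j hij
    obtain ⟨D, hD, hDle⟩ := lpPow_compare hij p
    obtain ⟨E, hE, hEle⟩ := seminormPow_compare hij hq.le
    refine ⟨C * (D + E), by finiteness, fun f hf => ?_⟩
    rw [normPow_of_pos hs, mul_assoc, mul_add]
    refine (hle _ (measurable_comp_param hf _ _)).trans ?_
    gcongr
    · refine (hDle f).2.trans ?_
      gcongr
      exact le_self_add
    · refine (hEle f).2.trans ?_
      gcongr
      exact le_add_self
  obtain ⟨D, hD, hDle⟩ := key hij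
  obtain ⟨E, hE, hEle⟩ := key hij.symm
  have h2 := (two_rpow_lt_top (p - 1)).ne
  refine ⟨2 ^ (p - 1) * (D + E), by finiteness, fun f hf => ?_⟩
  rw [edgeJump, sub_eq_add_neg]
  refine (hardyPow_add_le hp.le (measurable_comp_param hf _ _)).trans ?_
  rw [hardyPow_neg, mul_assoc, mul_add (D + E)]
  gcongr
  · refine (hDle f hf).trans ?_
    gcongr
    exact le_self_add
  · refine (hEle f hf).trans ?_
    gcongr
    exact le_add_self

/-! ### Equivalence of the boundary norm and the face-wise norm -/

/-- The `p`-th power of the face-wise norm. -/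
noncomputable def facesPow (s p : ℝ) (f : E3 → ℝ) : ℝ≥0∞ :=
  (∑ i, normPow s p (face i) f) +
    if s * p = 1 then ∑ i, ∑ j ∈ Finset.Ioi i, edgeIntegral p i j f f else 0

theorem faceNorm_eq {p : ℝ} (hp : 0 < p) (s : ℝ) (f : E3 → ℝ) :
    faceNorm s p f = facesPow s p f ^ (1 / p) := by
  simp [faceNorm, facesPow, wNorm, ← ENNReal.rpow_mul, hp.ne']

theorem normPow_face_le_facesPow (s p : ℝ) (i : Fin 4) (f : E3 → ℝ) :
    normPow s p (face i) f ≤ facesPow s p f :=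
  (Finset.single_le_sum (f := fun i => normPow s p (face i) f) (fun _ _ => zero_le)
    (Finset.mem_univ i)).trans le_self_add

theorem edgeIntegral_le_facesPow {s p : ℝ} (hq : s * p = 1) {i j : Fin 4} (hij : i < j)
    (f : E3 → ℝ) : edgeIntegral p i j f f ≤ facesPow s p f := by
  rw [facesPow, if_pos hq]
  refine le_trans ?_ le_add_self
  refine le_trans ?_ (Finset.single_le_sum (f := fun i => ∑ j ∈ Finset.Ioi i,
    edgeIntegral p i j f f) (fun _ _ => zero_le) (Finset.mem_univ i))
  exact Finset.single_le_sum (f := fun j => edgeIntegral p i j f f) (fun _ _ => zero_le)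
    (Finset.mem_Ioi.2 hij)

theorem normPow_face_le (s p : ℝ) (i : Fin 4) (f : E3 → ℝ) :
    normPow s p (face i) f ≤ normPow s p (frontier refTet) f := by
  unfold normPow
  have := facePair_le s p i i f
  gcongr
  · exact surf_face_le i
  · split_ifs
    · exact this
    · exact le_rfl

/-- The three regimes meet here: Hardy's inequality for sp < 1, the edge integral itself for sp = 1,
and agreement of traces for sp > 1. -/
theorem exists_edgeJump_le_facesPow {i j : Fin 4} (hij : i < j) {s p : ℝ} (hs : 0 < s)
    (hp : 1 < p) : ∃ C : ℝ≥0∞, C ≠ ∞ ∧ ∀ f : E3 → ℝ, Measurable f →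
      (1 < s * p → TracesAgree s p i j f) → edgeJump (s * p) p i j f ≤ C * facesPow s p f := by
  have hadd : ∀ f, normPow s p (face i) f + normPow s p (face j) f ≤ 2 * facesPow s p f := by
    intro f
    rw [two_mul]
    exact add_le_add (normPow_face_le_facesPow s p i f) (normPow_face_le_facesPow s p j f)
  rcases lt_trichotomy (s * p) 1 with hq | hq | hq
  · obtain ⟨C, hC, hle⟩ := exists_edgeJump_le_of_lt hij.ne hs hp hq
    refine ⟨C * 2, by finiteness, fun f hf _ => (hle f hf).trans ?_⟩
    rw [mul_assoc]
    gcongr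
    exact hadd f
  · refine ⟨1, by finiteness, fun f hf _ => ?_⟩
    rw [one_mul, edgeJump, hq, ← edgeIntegral_eq]
    exact edgeIntegral_le_facesPow hq hij f
  · obtain ⟨C, hC, hle⟩ := exists_hardyPow_le_of_tracesAgree hij.ne hs hp hq
    refine ⟨C * 2, by finiteness, fun f hf hT => (hle f hf (hT hq)).trans ?_⟩
    rw [mul_assoc]
    gcongr
    exact hadd f

theorem exists_facePair_le_facesPow (i j : Fin 4) {s p : ℝ} (hs : 0 < s) (hp : 1 < p) :
    ∃ C : ℝ≥0∞, C ≠ ∞ ∧ ∀ f : E3 → ℝ, Measurable f →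
      (1 < s * p → ∀ i j, i < j → TracesAgree s p i j f) →
      facePair s p i j f ≤ C * facesPow s p f := by
  rcases eq_or_ne i j with rfl | hij
  · refine ⟨1, by finiteness, fun f _ _ => ?_⟩
    rw [one_mul]
    refine le_trans ?_ (normPow_face_le_facesPow s p i f)
    rw [normPow_of_pos hs]
    exact le_add_self
  · obtain ⟨C, hC, hle⟩ := exists_facePair_le hij hs hp
    obtain ⟨D, hD, hDle⟩ : ∃ C : ℝ≥0∞, C ≠ ∞ ∧ ∀ f : E3 → ℝ, Measurable f →
        (1 < s * p → ∀ i j, i < j → TracesAgree s p i j f) →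
        edgeJump (s * p) p i j f ≤ C * facesPow s p f := by
      rcases lt_or_gt_of_ne hij with h | h
      · obtain ⟨D, hD, hDle⟩ := exists_edgeJump_le_facesPow h hs hp
        exact ⟨D, hD, fun f hf hT => hDle f hf fun hq => hT hq i j h⟩
      · obtain ⟨D, hD, hDle⟩ := exists_edgeJump_le_facesPow h hs hp
        refine ⟨D, hD, fun f hf hT => ?_⟩
        rw [← edgeJump_comm]
        exact hDle f hf fun hq => hT hq j i h
    refine ⟨C * (1 + D), by finiteness, fun f hf hT => (hle f hf).trans ?_⟩
    rw [mul_assoc, add_mul, one_mul]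
    gcongr
    · exact normPow_face_le_facesPow s p i f
    · exact hDle f hf hT

theorem exists_normPow_frontier_le {s p : ℝ} (hs : 0 ≤ s) (hp : 1 < p) :
    ∃ C : ℝ≥0∞, C ≠ ∞ ∧ ∀ f : E3 → ℝ, Measurable f →
      (1 < s * p → ∀ i j, i < j → TracesAgree s p i j f) →
      normPow s p (frontier refTet) f ≤ C * facesPow s p f := by
  have hlp : ∀ f, ∫⁻ x, ‖f x‖ₑ ^ p ∂(surf (frontier refTet)) ≤ facesPow s p f := fun f =>
    (lintegral_frontier_le _).trans
      ((Finset.sum_le_sum fun i _ => le_self_add).trans le_self_add)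
  rcases hs.eq_or_lt with rfl | hs
  · refine ⟨1, by finiteness, fun f _ _ => ?_⟩
    rw [normPow, if_neg (lt_irrefl _), add_zero, one_mul]
    exact hlp f
  · choose C hC hle using fun i j => exists_facePair_le_facesPow i j hs hp
    refine ⟨1 + ∑ i, ∑ j, C i j, ?_, fun f hf hT => ?_⟩
    · simp [hC]
    · rw [normPow_of_pos hs, add_mul, one_mul]
      refine add_le_add (hlp f) ((seminormPow_frontier_le s p hf).trans ?_)
      simp_rw [Finset.sum_mul]
      exact Finset.sum_le_sum fun i _ => Finset.sum_le_sum fun j _ => hle i j f hf hT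

theorem exists_edgeJump_le_normPow {i j : Fin 4} (hij : i ≠ j) {s p : ℝ} (hs : 0 < s)
    (hp : 1 < p) : ∃ C : ℝ≥0∞, C ≠ ∞ ∧ ∀ f : E3 → ℝ, Measurable f →
      edgeJump (s * p) p i j f ≤ C * normPow s p (frontier refTet) f := by
  obtain ⟨C, hC, hle⟩ := exists_edgeJump_le_facePair hij hs hp
  refine ⟨C * 2, by finiteness, fun f hf => (hle f hf).trans ?_⟩
  rw [mul_assoc, two_mul]
  gcongr
  · rw [normPow_of_pos hs]
    exact (facePair_le s p i j f).trans le_add_self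
  · exact normPow_face_le s p j f

/-- Each of the four face norms is a restriction of the boundary norm, and in the critical case the
edge integrals are jumps, controlled by the interactions contained in the boundary seminorm. -/
theorem exists_facesPow_le {s p : ℝ} (hp : 1 < p) (hs : 0 ≤ s) :
    ∃ C : ℝ≥0∞, C ≠ ∞ ∧ ∀ f : E3 → ℝ, Measurable f →
      facesPow s p f ≤ C * normPow s p (frontier refTet) f := by
  have hsum : ∀ f, ∑ i, normPow s p (face i) f ≤ 4 * normPow s p (frontier refTet) f :=
    fun f => (Finset.sum_le_sum fun i _ => normPow_face_le s p i f).trans_eq (by simp)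
  by_cases hq : s * p = 1
  · have hs' : 0 < s := hs.lt_of_ne (by rintro rfl; simp at hq)
    have : ∀ i j : Fin 4, ∃ C : ℝ≥0∞, C ≠ ∞ ∧ (i < j → ∀ f : E3 → ℝ, Measurable f →
        edgeIntegral p i j f f ≤ C * normPow s p (frontier refTet) f) := by
      intro i j
      by_cases hij : i = j
      · exact ⟨0, by simp, fun h => absurd hij h.ne⟩
      · obtain ⟨C, hC, hle⟩ := exists_edgeJump_le_normPow hij hs' hp
        refine ⟨C, hC, fun _ f hf => ?_⟩
        rw [edgeIntegral_eq, ← hq]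
        exact hle f hf
    choose C hC hle using this
    refine ⟨4 + ∑ i, ∑ j ∈ Finset.Ioi i, C i j, ?_, fun f hf => ?_⟩
    · simp [hC]
    · rw [facesPow, if_pos hq, add_mul]
      refine add_le_add (hsum f) ?_
      simp_rw [Finset.sum_mul]
      exact Finset.sum_le_sum fun i _ => Finset.sum_le_sum fun j hj =>
        hle i j (Finset.mem_Ioi.1 hj) f hf
  · refine ⟨4, by simp, fun f _ => ?_⟩
    rw [facesPow, if_neg hq, add_zero]
    exact hsum f

theorem memW_iff {s p : ℝ} (hp : 0 < p) {S : Set E3} {f : E3 → ℝ} :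
    MemW s p S f ↔ MemLpOn p S f ∧ normPow s p S f ≠ ∞ := by
  rw [MemW, wNorm, ENNReal.rpow_lt_top_iff_of_pos (by positivity), lt_top_iff_ne_top]

theorem MemLpOn.face {p : ℝ} {f : E3 → ℝ} (h : MemLpOn p (frontier refTet) f) (i : Fin 4) :
    MemLpOn p (face i) f := MemLp.mono_measure (surf_face_le i) h

/-- A finite boundary norm makes the jump finite, and for sp > 1 a finite jump forces equal traces.
-/
theorem MemW.tracesAgree {s p : ℝ} (hp : 1 < p) (hq : 1 < s * p) {f : E3 → ℝ}
    (hf : Measurable f) (h : MemW s p (frontier refTet) f) {i j : Fin 4} (hij : i < j) :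
    TracesAgree s p i j f := by
  have hp0 : 0 < p := by linarith
  have hs : 0 < s := pos_of_mul_pos_left (by linarith) hp0.le
  rw [memW_iff hp0] at h
  have hi : ∀ i, MemW s p (TetBoundary.face i) f := fun i =>
    (memW_iff hp0).2 ⟨h.1.face i, ne_top_of_le_ne_top h.2 (normPow_face_le s p i f)⟩
  obtain ⟨C, hC, hle⟩ := exists_edgeJump_le_normPow hij.ne hs hp
  exact tracesAgree_of_hardyPow_ne_top hij.ne hs hp hq hf (hi i) (hi j)
    (ne_top_of_le_ne_top (ENNReal.mul_ne_top hC h.2) (hle f hf))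

/-! ### Independence of the representative -/

theorem normPow_congr {s p : ℝ} {S : Set E3} {f g : E3 → ℝ} (h : f =ᵐ[surf S] g) :
    normPow s p S f = normPow s p S g := by
  have h1 : ∫⁻ x, ‖f x‖ₑ ^ p ∂(surf S) = ∫⁻ x, ‖g x‖ₑ ^ p ∂(surf S) :=
    lintegral_congr_ae (h.mono fun x hx => by simp only [hx])
  have h2 : seminormPow s p S f = seminormPow s p S g :=
    lintegral_congr_ae (h.mono fun x hx => lintegral_congr_ae (h.mono fun y hy => by
      simp only [hx, hy]))
  rw [normPow, normPow, h1, h2]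

theorem ae_eq_face {f g : E3 → ℝ} (h : f =ᵐ[surf (frontier refTet)] g) (i : Fin 4) :
    f =ᵐ[surf (face i)] g := ae_mono (surf_face_le i) h

theorem edgeIntegral_congr {p : ℝ} {i j : Fin 4} (hij : i ≠ j) {f g : E3 → ℝ}
    (h : f =ᵐ[surf (frontier refTet)] g) : edgeIntegral p i j f f = edgeIntegral p i j g g := by
  have key : ∀ {i j : Fin 4}, i ≠ j →
      ∀ᵐ u ∂volume.restrict tri, f (param i j u) = g (param i j u) := by
    intro i j hij
    obtain ⟨c, h0, h1, hc⟩ := exists_surf_face_eq hij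
    have := ae_eq_face h i
    rwa [hc, EventuallyEq, Measure.ae_ennreal_smul_measure_iff h0,
      (measurableEmbedding_param hij).ae_map_iff] at this
  rw [edgeIntegral_eq, edgeIntegral_eq]
  refine lintegral_congr_ae ?_
  filter_upwards [key hij, key hij.symm] with u h1 h2
  simp only [Pi.sub_apply, Function.comp_apply, h1, h2]

theorem facesPow_congr {s p : ℝ} {f g : E3 → ℝ} (h : f =ᵐ[surf (frontier refTet)] g) :
    facesPow s p f = facesPow s p g := by
  have h1 : ∀ i, normPow s p (face i) f = normPow s p (face i) g := fun i =>
    normPow_congr (ae_eq_face h i)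
  have h2 : ∑ i, ∑ j ∈ Finset.Ioi i, edgeIntegral p i j f f =
      ∑ i, ∑ j ∈ Finset.Ioi i, edgeIntegral p i j g g :=
    Finset.sum_congr rfl fun i _ => Finset.sum_congr rfl fun j hj =>
      edgeIntegral_congr (Finset.mem_Ioi.1 hj).ne h
  simp only [facesPow, h1, h2]

theorem IsEdgeTrace.congr {s p : ℝ} {i : Fin 4} {γ : Set E3} {f f' g : E3 → ℝ}
    (h : f =ᵐ[surf (face i)] f') (hg : IsEdgeTrace s p i γ f g) : IsEdgeTrace s p i γ f' g := by
  obtain ⟨hg, φ, h1, h2, h3⟩ := hg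
  refine ⟨hg, φ, h1, h2.congr fun n => ?_, h3⟩
  rw [wNorm, wNorm, normPow_congr (EventuallyEq.rfl.sub h)]

theorem TracesAgree.congr {s p : ℝ} {i j : Fin 4} {f f' : E3 → ℝ}
    (h : f =ᵐ[surf (frontier refTet)] f') (hT : TracesAgree s p i j f) :
    TracesAgree s p i j f' := by
  obtain ⟨g, g', h1, h2, h3⟩ := hT
  exact ⟨g, g', h1.congr (ae_eq_face h i), h2.congr (ae_eq_face h j), h3⟩

theorem MemLpOn.exists_measurable {p : ℝ} {S : Set E3} {f : E3 → ℝ} (h : MemLpOn p S f) :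
    ∃ f' : E3 → ℝ, Measurable f' ∧ f =ᵐ[surf S] f' :=
  ⟨h.1.mk f, h.1.stronglyMeasurable_mk.measurable, h.1.ae_eq_mk⟩

end TetBoundary

/-! ### The characterization and the norm equivalence -/

theorem mainTheorem6 (s p : ℝ) (hs0 : 0 ≤ s) (hs1 : s < 1) (hp : 1 < p) :
    (∀ f : TetBoundary.E3 → ℝ, TetBoundary.MemLpOn p (frontier TetBoundary.refTet) f →
      (TetBoundary.MemW s p (frontier TetBoundary.refTet) f ↔
        (∀ i, TetBoundary.MemW s p (TetBoundary.face i) f) ∧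
        (1 / p < s → ∀ i j, i < j → TetBoundary.TracesAgree s p i j f) ∧
        (s = 1 / p → ∀ i j, i < j → TetBoundary.edgeIntegral p i j f f < ∞))) ∧
    ∃ C : ℝ≥0, 0 < C ∧ ∀ f : TetBoundary.E3 → ℝ,
      TetBoundary.MemW s p (frontier TetBoundary.refTet) f →
        TetBoundary.wNorm s p (frontier TetBoundary.refTet) f ≤ C * TetBoundary.faceNorm s p f ∧
        TetBoundary.faceNorm s p f ≤ C * TetBoundary.wNorm s p (frontier TetBoundary.refTet) f := by
  open TetBoundary in
  have hp0 : 0 < p := by linarith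
  have hlt : 1 / p < s ↔ 1 < s * p := div_lt_iff₀ hp0
  have heq : s = 1 / p ↔ s * p = 1 := eq_div_iff hp0.ne'
  obtain ⟨A, hA, hAle⟩ := exists_normPow_frontier_le hs0 hp
  obtain ⟨B, hB, hBle⟩ := exists_facesPow_le hp hs0
  -- The estimates were proved for Borel functions. Passing to a Borel representative changes
  -- neither the norms nor the trace condition.
  have hAle' : ∀ f, MemLpOn p (frontier refTet) f →
      (1 < s * p → ∀ i j, i < j → TracesAgree s p i j f) →
      normPow s p (frontier refTet) f ≤ A * facesPow s p f := by
    intro f hf hT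
    obtain ⟨f', hm, hff'⟩ := hf.exists_measurable
    rw [normPow_congr hff', facesPow_congr hff']
    exact hAle f' hm fun hq i j hij => (hT hq i j hij).congr hff'
  have hBle' : ∀ f, MemLpOn p (frontier refTet) f →
      facesPow s p f ≤ B * normPow s p (frontier refTet) f := by
    intro f hf
    obtain ⟨f', hm, hff'⟩ := hf.exists_measurable
    rw [normPow_congr hff', facesPow_congr hff']
    exact hBle f' hm
  have hT : ∀ f, MemW s p (frontier refTet) f →
      1 < s * p → ∀ i j, i < j → TracesAgree s p i j f := by
    intro f hf hq i j hij
    obtain ⟨f', hm, hff'⟩ := hf.1.exists_measurable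
    rw [memW_iff hp0, normPow_congr hff'] at hf
    have hf' : MemW s p (frontier refTet) f' :=
      (memW_iff hp0).2 ⟨(memLp_congr_ae hff').1 hf.1, hf.2⟩
    exact (hf'.tracesAgree hp hq hm hij).congr hff'.symm
  refine ⟨fun f hf => ⟨fun h => ?_, fun ⟨h1, h2, h3⟩ => ?_⟩, ?_⟩
  · have hfin := ((memW_iff hp0).1 h).2
    have hfin' := ne_top_of_le_ne_top (ENNReal.mul_ne_top hB hfin) (hBle' f hf)
    refine ⟨fun i => (memW_iff hp0).2 ⟨hf.face i,
      ne_top_of_le_ne_top hfin (normPow_face_le s p i f)⟩, fun hq => hT f h (hlt.1 hq),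
      fun hq i j hij => ?_⟩
    exact (edgeIntegral_le_facesPow (heq.1 hq) hij f).trans_lt hfin'.lt_top
  · refine (memW_iff hp0).2 ⟨hf, ne_top_of_le_ne_top (ENNReal.mul_ne_top hA ?_)
      (hAle' f hf fun hq => h2 (hlt.2 hq))⟩
    refine ENNReal.add_ne_top.2 ⟨?_, ?_⟩
    · exact ENNReal.sum_ne_top.2 fun i _ => ((memW_iff hp0).1 (h1 i)).2
    · split_ifs with hq
      · exact ENNReal.sum_ne_top.2 fun i _ => ENNReal.sum_ne_top.2 fun j hj =>
          (h3 (heq.2 hq) i j (Finset.mem_Ioi.1 hj)).ne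
      · exact ENNReal.zero_ne_top
  · have hr : 0 ≤ 1 / p := by positivity
    -- One constant for both directions: A + B dominates each p-th power constant, and the summand 1
    -- makes it positive.
    have hD : (A + B + 1) ^ (1 / p) ≠ ∞ := ENNReal.rpow_ne_top_of_nonneg hr (by finiteness)
    have hD1 : 1 ≤ (A + B + 1) ^ (1 / p) := by
      simpa using ENNReal.rpow_le_rpow (show 1 ≤ A + B + 1 from le_add_self) hr
    refine ⟨((A + B + 1) ^ (1 / p)).toNNReal,
      ENNReal.toNNReal_pos (one_pos.trans_le hD1).ne' hD, fun f hf => ?_⟩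
    rw [ENNReal.coe_toNNReal hD, faceNorm_eq hp0, wNorm, ← ENNReal.mul_rpow_of_nonneg _ _ hr,
      ← ENNReal.mul_rpow_of_nonneg _ _ hr]
    constructor
    · refine ENNReal.rpow_le_rpow ((hAle' f hf.1 (hT f hf)).trans ?_) hr
      gcongr
      exact le_self_add.trans le_self_add
    · refine ENNReal.rpow_le_rpow ((hBle' f hf.1).trans ?_) hr
      gcongr
      exact le_add_self.trans le_self_add
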